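/- **Proposition.** Let $m\ge 1$ and let $x,y,t\in\mathbb R^m$. Put $m_j(z)=e^{t_jz^3+y_jz^2+x_jz}$ for $1\le j\le m$ and $m_0=1$. Let $M_j=m_j/m_{j-1}$ for odd $j$ and $M_j=m_{j-1}/m_j$ for even $j$. Given pairwise disjoint sets $\Omega_{\ell,j}\subset\mathbb C$ ($\ell=1,2$, $1\le j\le m$), a measure $\mu$ on their union, and functions $A_j,B_j$, set $\Omega_\ell=\bigcup_j\Omega_{\ell,j}$, $\Omega=\Omega_1\cup\Omega_2$ and $$D(x,y,t)=\det(1-K_1K_2),$$ the Fredholm determinant on $L^2(\Omega_1,\mu)$ defined by the Fredholm series. Here $K_1(u,v)=(\delta_{i,j}+\delta_{i,j+(-1)^i})\frac{M_i(u)A_i(u)B_j(v)}{u-v}$ for $u\in\Omega_{1,i}$, $v\in\Omega_{2,j}$, and $K_2(u,v)=(\delta_{i,j}+\delta_{i,j-(-1)^i})\frac{M_i(u)^{-1}A_i(u)B_j(v)}{u-v}$ for $u\in\Omega_{2,i}$, $v\in\Omega_{1,j}$. Let $f=c\,\Delta F$ and $g=c^{-1}\Delta^{-1}G$, where $\Delta=\mathrm{diag}(m_1,\dots,m_m,1)$,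 $c=(m_{j-1}m_j)^{-1/2}$ on $\Omega_{1,j}\cup\Omega_{2,j}$ (using the branch $m_j^{1/2}=e^{(t_jz^3+y_jz^2+x_jz)/2}$), and $F,G$ are the $(m+1)$-vectors with entries $F_k=A_k\chi_{\Omega_{1,k}}+A_{k+1}\chi_{\Omega_{1,k+1}}$ for odd $k\le m$, $F_k=A_k\chi_{\Omega_{2,k}}+A_{k+1}\chi_{\Omega_{2,k+1}}$ for even $k\le m$, $F_{m+1}=A_1\chi_{\Omega_{2,1}}$ (with $\Omega_{\ell,m+1}=\emptyset$). The vector $G$ is defined in the same way with $B$ in place of $A$ and $\Omega_{1,\cdot}$, $\Omega_{2,\cdot}$ interchanged. Let $H$ be the operator on $L^2(\Omega,\mu)$ with kernel $f(u)^Tg(v)/(u-v)$ for $u\ne v$ and $0$ for $u=v$. Let $$Y_1=\int_\Omega\big((1-H)^{-1}f\big)(s)\,g(s)^T\,d\mu(s),$$ an $(m+1)\times(m+1)$ matrix. For $1\le i\le m$ let $q_i$ be the block of $Y_1$ with rows and columns in $\{i,i+1,\dots,m\}$ and let $s_i$ be the block with rows and columns in the complement $\{1,\dots,i-1\}\cup\{m+1\}$.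 Assume that the data are of one of the following two kinds. *(KPZ fixed point.)* $y_i=\gamma_i$ and $t_i=-\tau_i/3$ with $0<\tau_1\le\dots\le\tau_m$, and $\gamma_i<\gamma_{i+1}$ if $\tau_i=\tau_{i+1}$; $d\mu=dz$; $\zeta_1,\dots,\zeta_{m-1}\in\mathbb C$ with $0<|\zeta_i|<1$. The contours $\Gamma_{m,L}^+,\dots,\Gamma_{2,L}^+,\Gamma_{1,L},\Gamma_{2,L}^-,\dots,\Gamma_{m,L}^-$ are, in this order from right to left, horizontal translates in the left half plane of one upward oriented Lipschitz graph over the imaginary axis. This graph extends to infinity, at its two ends, at angles in $(7\pi/6,3\pi/2)$ and $(\pi/2,5\pi/6)$. The contours $\Gamma_{m,R}^+,\dots,\Gamma_{1,R},\dots,\Gamma_{m,R}^-$ are, in this order from left to right, such translates in the right half plane with angles in $(3\pi/2,11\pi/6)$ and $(\pi/6,\pi/2)$. If two of the $\tau_i$ coincide, the angles are in $(5\pi/4,3\pi/2)$ and $(\pi/2,3\pi/4)$ on the left and in $(7\pi/4,11\pi/6)$ and $(\pi/6,\pi/4)$ on the right. Write $\Gamma_{j,L}=\Gamma^+_{j,L}\cup\Gamma_{j,L}^-$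 and $\Gamma_{j,R}=\Gamma^+_{j,R}\cup\Gamma_{j,R}^-$ for $j\ge 2$. Then $\Omega_{1,j}=\Gamma_{j,L}$, $\Omega_{2,j}=\Gamma_{j,R}$ for odd $j$ and $\Omega_{1,j}=\Gamma_{j,R}$, $\Omega_{2,j}=\Gamma_{j,L}$ for even $j$. Finally $A_j=1$ and $B_j=Q_jP_j$, where, with $\zeta_0=\infty$ and $\zeta_m=0$: $Q_j=-(1-\zeta_j)$ on $\Omega_{1,j}$ and $1-\zeta_{j-1}^{-1}$ on $\Omega_{2,j}$ for odd $j$; $Q_j=-(1-\zeta_{j-1}^{-1})$ on $\Omega_{1,j}$ and $1-\zeta_j$ on $\Omega_{2,j}$ for even $j$; $P_1=\frac1{2\pi\mathrm i}$; and for $j>1$, $P_j=\frac1{2\pi\mathrm i(1-\zeta_{j-1})}$ on $\Gamma_{j,L}^+\cup\Gamma_{j,R}^+$ and $P_j=\frac{-\zeta_{j-1}}{2\pi\mathrm i(1-\zeta_{j-1})}$ on $\Gamma_{j,L}^-\cup\Gamma_{j,R}^-$. *(Periodic KPZ fixed point.)* $y_i=\gamma_i/2$, $t_i=-\tau_i/3$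 with $0<\tau_1\le\dots\le\tau_m$, and $x_i<x_{i+1}$ if $\tau_i=\tau_{i+1}$; $\mu$ is the counting measure; $0<|\zeta_1|<\dots<|\zeta_m|<1$ and $\zeta_0=\zeta_{m+1}=0$. With $S_{j,L}$ and $S_{j,R}$ the sets of solutions of $e^{-s^2/2}=\zeta_j$ with $\operatorname{Re}s<0$ and $\operatorname{Re}s>0$, $\Omega_{1,j}=S_{j,L}$, $\Omega_{2,j}=S_{j,R}$ for odd $j$ and $\Omega_{1,j}=S_{j,R}$, $\Omega_{2,j}=S_{j,L}$ for even $j$. Let $H_j(z)=\exp\big(-\kappa\int_{-\mathrm i\infty}^{\mathrm i\infty}\frac{\log(1-\zeta_je^{w^2/2})}{w-z}dw\big)$ for $\operatorname{Re}z<0$ and $H_j(z)=H_j(-z)$ for $\operatorname{Re}z>0$. Then $A_j(z)=\frac{H_{j+1}(z)}{zH_j(z)^p}$ on $S_{j,L}$ and $\frac{H_{j-1}(z)}{zH_j(z)^p}$ on $S_{j,R}$, and $B_j=Q\cdot R$ with $Q=1-\zeta_{j-(-1)^j}/\zeta_j$ on $\Omega_{1,j}$, $Q=1-\zeta_{j+(-1)^j}/\zeta_j$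 on $\Omega_{2,j}$, and $R=H_{j+1}$ on $S_{j,L}$, $R=H_{j-1}$ on $S_{j,R}$ if $\delta=1$, with $S_{j,L}$ and $S_{j,R}$ interchanged in $R$ if $\delta=-1$. The normalization constants $\kappa\in\mathbb C$, $p\in\{0,1,2,\dots\}$, $\delta\in\{1,-1\}$ are arbitrary (for instance $(\kappa,p,\delta)=(1,1,1)$ or $(\frac1{2\pi\mathrm i},2,-1)$). Let $a=(1,2,\dots,m)$ and suppose that $D(x+\xi a,y,t)\ne0$ for every $\xi\ge0$. Then for every $\xi\ge 0$, at $(x+\xi a,y,t)$, the Fredholm series converges absolutely, $f,g\in L^2\cap L^\infty$, $H$ is bounded and $1-H$ is invertible; the integrals below converge absolutely; and $$D(x,y,t)=\exp\Big[\int_0^\infty\sum_{i=1}^m\operatorname{Tr}q_i(x+\xi a,y,t)\,d\xi\Big]=\exp\Big[-\int_0^\infty\sum_{i=1}^m\operatorname{Tr}s_i(x+\xi a,y,t)\,d\xi\Big].$$ -/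

import Mathlib

open MeasureTheory Filter Topology
open scoped NNReal

noncomputable section

namespace KPZDet

/-- The entry `v_j` of a vector with labels `j = 1, …, m`; it is `0` for `j = 0` and for `j > m`. -/
def entry {m : ℕ} {α : Type*} [Zero α] (v : Fin m → α) (j : ℕ) : α :=
  if h : 1 ≤ j ∧ j ≤ m then v ⟨j - 1, by omega⟩ else 0

/-- The cubic polynomial `t_j z³ + y_j z² + x_j z` (zero for `j = 0` and for `j > m`). -/
def cubic {m : ℕ} (x y t : Fin m → ℝ) (j : ℕ) (z : ℂ) : ℂ :=
  ((entry t j : ℝ) : ℂ) * z ^ 3 + ((entry y j : ℝ) : ℂ) * z ^ 2 + ((entry x j : ℝ) : ℂ) * z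

/-- The cubic exponential `m_j(z) = exp(t_j z³ + y_j z² + x_j z)`; `m_0 = m_{m+1} = 1`. -/
def mexp {m : ℕ} (x y t : Fin m → ℝ) (j : ℕ) (z : ℂ) : ℂ :=
  Complex.exp (cubic x y t j z)

/-- The branch `exp((t_j z³ + y_j z² + x_j z) / 2)` of the square root of `m_j(z)`. -/
def mexpSqrt {m : ℕ} (x y t : Fin m → ℝ) (j : ℕ) (z : ℂ) : ℂ :=
  Complex.exp (cubic x y t j z / 2)

/-- The diagonal entries of `diag(m_1, m_1/m_2, m_3/m_2, m_3/m_4, …)`. -/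
def mratio {m : ℕ} (x y t : Fin m → ℝ) (j : ℕ) (z : ℂ) : ℂ :=
  if Odd j then mexp x y t j z / mexp x y t (j - 1) z
  else mexp x y t (j - 1) z / mexp x y t j z

/-- The data from which the operators are built, with labels `j = 1, …, m`:
the sets `Ω_{1,j}` and `Ω_{2,j}` (empty for other `j`), the positive measure `ν` carried by
their union, the density `τ` of the complex measure `dμ = τ dν` that is used for integration, and
the functions `A_j`, `B_j`. Two instances are used: `kpzData` and `perData`. -/
structure Data where
  Om₁ : ℕ → Set ℂ
  Om₂ : ℕ → Set ℂ
  ν : Measure ℂ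
  τ : ℂ → ℂ
  A : ℕ → ℂ → ℂ
  B : ℕ → ℂ → ℂ

section Operators

variable (S : Data) {m : ℕ} (x y t : Fin m → ℝ)

/-! ### The determinant `D = det(1 - K₁ K₂)` -/

/-- The kernel of `K₁ : L²(Ω₂) → L²(Ω₁)`: for `u ∈ Ω_{1,i}` and `v ∈ Ω_{2,j}` it equals
`(δ_i(j) + δ_i(j + (-1)^i)) M_i(u) A_i(u) B_j(v) / (u - v)`. -/
def kerK₁ (u v : ℂ) : ℂ :=
  ∑ i ∈ Finset.Icc 1 m, ∑ j ∈ Finset.Icc 1 m,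
    ((if i = j then 1 else 0) + (if (i : ℤ) = (j : ℤ) + (-1) ^ i then 1 else 0)) *
      (S.Om₁ i).indicator (fun u => mratio x y t i u * S.A i u) u *
      (S.Om₂ j).indicator (S.B j) v / (u - v)

/-- The kernel of `K₂ : L²(Ω₁) → L²(Ω₂)`: for `u ∈ Ω_{2,i}` and `v ∈ Ω_{1,j}` it equals
`(δ_i(j) + δ_i(j - (-1)^i)) M_i(u)⁻¹ A_i(u) B_j(v) / (u - v)`. -/
def kerK₂ (u v : ℂ) : ℂ :=
  ∑ i ∈ Finset.Icc 1 m, ∑ j ∈ Finset.Icc 1 m,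
    ((if i = j then 1 else 0) + (if (i : ℤ) = (j : ℤ) - (-1) ^ i then 1 else 0)) *
      (S.Om₂ i).indicator (fun u => (mratio x y t i u)⁻¹ * S.A i u) u *
      (S.Om₁ j).indicator (S.B j) v / (u - v)

/-- `Ω₁`, the union of the sets `Ω_{1,j}`. -/
def omega₁ : Set ℂ := ⋃ j, S.Om₁ j

/-- `Ω₂`, the union of the sets `Ω_{2,j}`. -/
def omega₂ : Set ℂ := ⋃ j, S.Om₂ j

/-- The kernel of the product `K₁ K₂` on `L²(Ω₁, dμ)`. -/
def kerK (u v : ℂ) : ℂ :=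
  ∫ w in omega₂ S, kerK₁ S x y t u w * kerK₂ S x y t w v * S.τ w ∂S.ν

/-- The density `det[K(u_i, u_j)] ∏ τ(u_i)` in the `n`-th term of the Fredholm series. -/
def fredIntegrand (n : ℕ) (u : Fin n → ℂ) : ℂ :=
  (Matrix.of fun i j => kerK S x y t (u i) (u j)).det * ∏ i, S.τ (u i)

/-- The product measure on `Ω₁ⁿ`. -/
def fredMeasure (n : ℕ) : Measure (Fin n → ℂ) :=
  Measure.pi fun _ => S.ν.restrict (omega₁ S)

/-- The Fredholm determinant `D(x, y, t) = det(1 - K₁ K₂)`, as the Fredholm series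
`∑ₙ ((-1)ⁿ / n!) ∫_{Ω₁ⁿ} det[K(u_i, u_j)] dμ(u₁) ⋯ dμ(uₙ)`. -/
def fredDet : ℂ :=
  ∑' n : ℕ, (-1) ^ n / (n.factorial : ℂ) * ∫ u, fredIntegrand S x y t n u ∂fredMeasure S n

/-! ### The cubic integrable operator `H` and the matrix `Y₁` -/

/-- The vector `F(z)`, with entries (labels `1, …, m+1`)
`F_k = A_k χ_{Ω_{1,k}} + A_{k+1} χ_{Ω_{1,k+1}}` for odd `k ≤ m`,
`F_k = A_k χ_{Ω_{2,k}} + A_{k+1} χ_{Ω_{2,k+1}}` for even `k ≤ m`, and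
`F_{m+1} = A_1 χ_{Ω_{2,1}}`: the first `m+1` rows of the block matrix
`[[Λ₁, Λ₂ - E₁₁], [0, E₁₁]]` applied to `(A χ₁ e, A χ₂ e)`. -/
def vecF (k : Fin (m + 1)) (z : ℂ) : ℂ :=
  if (k : ℕ) = m then (S.Om₂ 1).indicator (S.A 1) z
  else if Odd ((k : ℕ) + 1) then
    (S.Om₁ (k + 1)).indicator (S.A (k + 1)) z + (S.Om₁ (k + 2)).indicator (S.A (k + 2)) z
  else
    (S.Om₂ (k + 1)).indicator (S.A (k + 1)) z + (S.Om₂ (k + 2)).indicator (S.A (k + 2)) z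

/-- The vector `G(z)`: the same block matrix applied to `(B χ₂ e, B χ₁ e)`. -/
def vecG (k : Fin (m + 1)) (z : ℂ) : ℂ :=
  if (k : ℕ) = m then (S.Om₁ 1).indicator (S.B 1) z
  else if Odd ((k : ℕ) + 1) then
    (S.Om₂ (k + 1)).indicator (S.B (k + 1)) z + (S.Om₂ (k + 2)).indicator (S.B (k + 2)) z
  else
    (S.Om₁ (k + 1)).indicator (S.B (k + 1)) z + (S.Om₁ (k + 2)).indicator (S.B (k + 2)) z

/-- The conjugating scalar `c(z)`: it is `1 / √(m_{j-1}(z) m_j(z))` on `Ω_{1,j} ∪ Ω_{2,j}`. -/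
def conjScalar (z : ℂ) : ℂ :=
  ∑ j ∈ Finset.Icc 1 m,
    ((S.Om₁ j).indicator (fun _ => 1) z + (S.Om₂ j).indicator (fun _ => 1) z) /
      (mexpSqrt x y t (j - 1) z * mexpSqrt x y t j z)

/-- `f = c Δ F` with `Δ = diag(m_1, …, m_m, 1)`. -/
def vecf (k : Fin (m + 1)) (z : ℂ) : ℂ :=
  conjScalar S x y t z * mexp x y t (k + 1) z * vecF S k z

/-- `g = c⁻¹ Δ⁻¹ G` with `Δ = diag(m_1, …, m_m, 1)`. -/
def vecg (k : Fin (m + 1)) (z : ℂ) : ℂ :=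
  (conjScalar S x y t z)⁻¹ * (mexp x y t (k + 1) z)⁻¹ * vecG S k z

/-- The kernel `H(u, v) = f(u)ᵀ g(v) / (u - v)` for `u ≠ v`, and `H(u, u) = 0`. -/
def kerH (u v : ℂ) : ℂ :=
  open Classical in
  if u = v then 0 else (∑ k : Fin (m + 1), vecf S x y t k u * vecg S x y t k v) / (u - v)

/-- `T` is the bounded operator on `L²(Ω)` with kernel `k` with respect to `dμ = τ dν`. -/
def HasKernel (k : ℂ → ℂ → ℂ) (T : Lp ℂ 2 S.ν →L[ℂ] Lp ℂ 2 S.ν) : Prop :=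
  ∀ φ : Lp ℂ 2 S.ν, ∀ᵐ u ∂S.ν,
    Integrable (fun v => k u v * φ v * S.τ v) S.ν ∧
      (T φ : ℂ → ℂ) u = ∫ v, k u v * φ v * S.τ v ∂S.ν

/-- The operator `H` (the bounded operator with kernel `kerH`; zero if there is none). -/
def opH : Lp ℂ 2 S.ν →L[ℂ] Lp ℂ 2 S.ν :=
  open Classical in
  if h : ∃ T, HasKernel S (kerH S x y t) T then h.choose else 0

/-- The class of a function in `L²(Ω)` (zero if it is not square integrable). -/
def toL2 (φ : ℂ → ℂ) : Lp ℂ 2 S.ν :=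
  open Classical in
  if h : MemLp φ 2 S.ν then h.toLp φ else 0

/-- The matrix `Y₁ = ∫_Ω ((1 - H)⁻¹ f)(s) g(s)ᵀ dμ(s)`. -/
def matY₁ : Matrix (Fin (m + 1)) (Fin (m + 1)) ℂ :=
  Matrix.of fun i j =>
    ∫ s, ((Ring.inverse (1 - opH S x y t) (toL2 S (vecf S x y t i)) : Lp ℂ 2 S.ν) : ℂ → ℂ) s *
      vecg S x y t j s * S.τ s ∂S.ν

/-- Everything that enters the formula for `D` and `Y₁` is well defined: the Fredholm series of
`det(1 - K₁ K₂)` converges absolutely, `f, g ∈ L² ∩ L^∞`, the kernel `kerH` defines a bounded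
operator `H`, and `1 - H` is invertible. -/
structure WellDefined : Prop where
  kernel : ∀ u v, IntegrableOn
    (fun w => kerK₁ S x y t u w * kerK₂ S x y t w v * S.τ w) (omega₂ S) S.ν
  term : ∀ n, Integrable (fredIntegrand S x y t n) (fredMeasure S n)
  series : Summable fun n : ℕ =>
    1 / (n.factorial : ℝ) * ∫ u, ‖fredIntegrand S x y t n u‖ ∂fredMeasure S n
  f_two : ∀ k, MemLp (vecf S x y t k) 2 S.ν
  f_top : ∀ k, MemLp (vecf S x y t k) ⊤ S.ν
  g_two : ∀ k, MemLp (vecg S x y t k) 2 S.ν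
  g_top : ∀ k, MemLp (vecg S x y t k) ⊤ S.ν
  bounded : HasKernel S (kerH S x y t) (opH S x y t)
  invertible : IsUnit (1 - opH S x y t)

end Operators

/-! ### Blocks of `Y₁` and the ray of heights -/

/-- The block `q` of an `(m+1) × (m+1)` matrix for the index set `s ⊆ {1, …, m}`:
rows and columns with index in `s`. -/
def qBlock {m : ℕ} (s : Finset (Fin m)) (Y : Matrix (Fin (m + 1)) (Fin (m + 1)) ℂ) :
    Matrix {k // k ∈ s.map Fin.castSuccEmb} {k // k ∈ s.map Fin.castSuccEmb} ℂ :=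
  Y.submatrix Subtype.val Subtype.val

/-- The block `s` of an `(m+1) × (m+1)` matrix for the index set `s ⊆ {1, …, m}`:
rows and columns with index in `{1, …, m+1} \ s`. -/
def sBlock {m : ℕ} (s : Finset (Fin m)) (Y : Matrix (Fin (m + 1)) (Fin (m + 1)) ℂ) :
    Matrix {k // k ∉ s.map Fin.castSuccEmb} {k // k ∉ s.map Fin.castSuccEmb} ℂ :=
  Y.submatrix Subtype.val Subtype.val

/-- The heights `x + ξ a` with `a = (1, 2, …, m)`. -/
def shiftHeights {m : ℕ} (x : Fin m → ℝ) (ξ : ℝ) : Fin m → ℝ :=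
  fun i => x i + ξ * ((i : ℕ) + 1)

/-! ### The KPZ fixed point -/

/-- The contours in one half plane (the left one for `σ = -1`, the right one for `σ = 1`):
horizontal translates `Γ_j^±` of the graph `{φ(r) + i r : r ∈ ℝ}` of a Lipschitz function, oriented
upwards, which extends from `∞ e^{i θbot}` to `∞ e^{i θtop}`. `Γ_1` is a single contour, written both
as `Γ_1^+` and `Γ_1^-`; going away from the imaginary axis the contours are
`Γ_m^+, …, Γ_2^+, Γ_1, Γ_2^-, …, Γ_m^-`. -/
structure Contours (m : ℕ) (σ : ℝ) where
  φ : ℝ → ℝ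
  K : ℝ≥0
  lipschitz : LipschitzWith K φ
  θbot : ℝ
  θtop : ℝ
  tendsto_bot : Tendsto (fun r : ℝ => ((φ r : ℂ) + r * Complex.I) / ‖(φ r : ℂ) + r * Complex.I‖)
    atBot (𝓝 (Complex.exp (θbot * Complex.I)))
  tendsto_top : Tendsto (fun r : ℝ => ((φ r : ℂ) + r * Complex.I) / ‖(φ r : ℂ) + r * Complex.I‖)
    atTop (𝓝 (Complex.exp (θtop * Complex.I)))
  plus : ℕ → ℝ
  minus : ℕ → ℝ
  plus_one : plus 1 = minus 1
  plus_lt : ∀ j k, 1 ≤ j → j < k → k ≤ m → σ * plus k < σ * plus j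
  minus_lt : ∀ j k, 1 ≤ j → j < k → k ≤ m → σ * minus j < σ * minus k
  half_plane : ∀ j r, 1 ≤ j → j ≤ m → 0 < σ * (φ r + plus j) ∧ 0 < σ * (φ r + minus j)

namespace Contours

variable {m : ℕ} {σ : ℝ} (C : Contours m σ)

/-- The translate by `s` of the base graph. -/
def graph (s : ℝ) : Set ℂ := {z | z.re = C.φ z.im + s}

/-- The measure `dr` (`r` the imaginary part) on the translate by `s`. It is comparable with the
arc length `√(1 + φ'(r)²) dr` because `φ` is Lipschitz, so the `L²` space is the usual one. -/
def graphMeasure (s : ℝ) : Measure ℂ :=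
  (volume : Measure ℝ).map fun r => ((C.φ r + s : ℝ) : ℂ) + r * Complex.I

/-- `Γ_j = Γ_j^+ ∪ Γ_j^-` for `1 ≤ j ≤ m` (for `j = 1` this is the single contour `Γ_1`). -/
def Gam (j : ℕ) : Set ℂ := C.graph (C.plus j) ∪ C.graph (C.minus j)

/-- The sum of the measures `dr` over all the contours `Γ_j^±`, `Γ_1` being counted once. -/
def measure : Measure ℂ :=
  ∑ j ∈ Finset.Icc 1 m, C.graphMeasure (C.plus j) +
    ∑ j ∈ Finset.Icc 2 m, C.graphMeasure (C.minus j)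

end Contours

section KPZ

variable {m : ℕ} (ζ : Fin (m - 1) → ℂ) (CL : Contours m (-1)) (CR : Contours m 1)

/-- `Ω_{1,j}`: `Γ_{j,L}` for odd `j`, `Γ_{j,R}` for even `j`. -/
def kpzOm₁ (j : ℕ) : Set ℂ :=
  {z | 1 ≤ j ∧ j ≤ m ∧ if Odd j then z ∈ CL.Gam j else z ∈ CR.Gam j}

/-- `Ω_{2,j}`: `Γ_{j,R}` for odd `j`, `Γ_{j,L}` for even `j`. -/
def kpzOm₂ (j : ℕ) : Set ℂ :=
  {z | 1 ≤ j ∧ j ≤ m ∧ if Odd j then z ∈ CR.Gam j else z ∈ CL.Gam j}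

/-- `1 - 1/ζ_{j-1}`, with the convention `ζ_0 = ∞`. -/
def oneSubInv (j : ℕ) : ℂ := if j = 1 then 1 else 1 - 1 / entry ζ (j - 1)

/-- The factor `Q_j` (`entry ζ m = 0` is the convention `ζ_m = 0`). -/
def kpzQ (j : ℕ) (z : ℂ) : ℂ :=
  if Odd j then
    (kpzOm₁ CL CR j).indicator (fun _ => -(1 - entry ζ j)) z +
      (kpzOm₂ CL CR j).indicator (fun _ => oneSubInv ζ j) z
  else
    (kpzOm₁ CL CR j).indicator (fun _ => -oneSubInv ζ j) z +
      (kpzOm₂ CL CR j).indicator (fun _ => 1 - entry ζ j) z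

/-- The factor `P_j`: `1/(2πi)` on `Γ_1`, and for `j > 1`, `1/(2πi(1 - ζ_{j-1}))` on `Γ_j^+` and
`-ζ_{j-1}/(2πi(1 - ζ_{j-1}))` on `Γ_j^-`. -/
def kpzP (j : ℕ) (z : ℂ) : ℂ :=
  if j = 1 then 1 / (2 * Real.pi * Complex.I)
  else
    (CL.graph (CL.plus j) ∪ CR.graph (CR.plus j)).indicator
        (fun _ => 1 / (2 * Real.pi * Complex.I * (1 - entry ζ (j - 1)))) z +
      (CL.graph (CL.minus j) ∪ CR.graph (CR.minus j)).indicator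
        (fun _ => -entry ζ (j - 1) / (2 * Real.pi * Complex.I * (1 - entry ζ (j - 1)))) z

/-- The data of the KPZ fixed point. The complex measure is `dz = (φ'(r) + i) dr`. -/
def kpzData : Data where
  Om₁ := kpzOm₁ CL CR
  Om₂ := kpzOm₂ CL CR
  ν := CL.measure + CR.measure
  τ z := ((if z.re < 0 then deriv CL.φ z.im else deriv CR.φ z.im : ℝ) : ℂ) + Complex.I
  A _ _ := 1
  B j z := kpzQ ζ CL CR j z * kpzP ζ CL CR j z

/-- `S` is the KPZ data for some admissible `ζ` and contours, and `y = γ`, `t = -τ/3` for positions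
`γ` and times `0 < τ_1 ≤ ⋯ ≤ τ_m` such that `γ_i < γ_j` if `i < j` and `τ_i = τ_j`. The contours go to
infinity in the sectors where the cubic factors decay; when two times are equal the quadratic
factors have to decay as well. -/
def IsKPZ (S : Data) (y t : Fin m → ℝ) : Prop :=
  (∀ i, t i < 0) ∧
  (∀ i j, i < j → t j ≤ t i ∧ (t i = t j → y i < y j)) ∧
  ∃ (ζ : Fin (m - 1) → ℂ) (CL : Contours m (-1)) (CR : Contours m 1),
    (∀ i, 0 < ‖ζ i‖ ∧ ‖ζ i‖ < 1) ∧
    CL.θtop ∈ Set.Ioo (Real.pi / 2) (5 * Real.pi / 6) ∧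
    CL.θbot ∈ Set.Ioo (7 * Real.pi / 6) (3 * Real.pi / 2) ∧
    CR.θtop ∈ Set.Ioo (Real.pi / 6) (Real.pi / 2) ∧
    CR.θbot ∈ Set.Ioo (3 * Real.pi / 2) (11 * Real.pi / 6) ∧
    ((∃ i j, i < j ∧ t i = t j) →
      CL.θtop < 3 * Real.pi / 4 ∧ 5 * Real.pi / 4 < CL.θbot ∧
      CR.θtop < Real.pi / 4 ∧ 7 * Real.pi / 4 < CR.θbot) ∧
    S = kpzData ζ CL CR

end KPZ

/-! ### The periodic KPZ fixed point -/

/-- The Bethe roots of `e^{-s²/2} = ζ` in the left half plane. -/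
def betheL (ζ : ℂ) : Set ℂ := {s | Complex.exp (-s ^ 2 / 2) = ζ ∧ s.re < 0}

/-- The Bethe roots of `e^{-s²/2} = ζ` in the right half plane. -/
def betheR (ζ : ℂ) : Set ℂ := {s | Complex.exp (-s ^ 2 / 2) = ζ ∧ 0 < s.re}

/-- The function `exp(-κ ∫_{-i∞}^{i∞} log(1 - ζ e^{w²/2}) / (w ∓ z) dw)`, with `w - z` for
`Re z < 0` and `w + z` for `Re z > 0` (the integral is parametrized by `w = i r`).
It is `1` for `ζ = 0`. -/
def perH (κ ζ z : ℂ) : ℂ :=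
  Complex.exp (-κ * ∫ r : ℝ,
    Complex.log (1 - ζ * Complex.exp ((Complex.I * r) ^ 2 / 2)) /
      (Complex.I * r + (if z.re < 0 then -z else z)) * Complex.I)

section Periodic

variable {m : ℕ} (ζ : Fin m → ℂ) (κ : ℂ) (p : ℕ) (δ : ℤˣ)

/-- `Ω_{1,j}`: the left Bethe roots for odd `j`, the right ones for even `j`. -/
def perOm₁ (j : ℕ) : Set ℂ :=
  {z | 1 ≤ j ∧ j ≤ m ∧ if Odd j then z ∈ betheL (entry ζ j) else z ∈ betheR (entry ζ j)}

/-- `Ω_{2,j}`: the right Bethe roots for odd `j`, the left ones for even `j`. -/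
def perOm₂ (j : ℕ) : Set ℂ :=
  {z | 1 ≤ j ∧ j ≤ m ∧ if Odd j then z ∈ betheR (entry ζ j) else z ∈ betheL (entry ζ j)}

/-- `Q_{1,j} = 1 - ζ_{j-(-1)^j} / ζ_j`, with `ζ_0 = ζ_{m+1} = 0`. -/
def perQ₁ (j : ℕ) : ℂ := 1 - entry ζ (if Odd j then j + 1 else j - 1) / entry ζ j

/-- `Q_{2,j} = 1 - ζ_{j+(-1)^j} / ζ_j`, with `ζ_0 = ζ_{m+1} = 0`. -/
def perQ₂ (j : ℕ) : ℂ := 1 - entry ζ (if Odd j then j - 1 else j + 1) / entry ζ j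

/-- `A_j(z)`: `H_{j+1}(z) / (z H_j(z)^p)` in the left and `H_{j-1}(z) / (z H_j(z)^p)` in the right
half plane, where `H_k` is `perH` for `ζ_k`. -/
def perA (j : ℕ) (z : ℂ) : ℂ :=
  perH κ (entry ζ (if z.re < 0 then j + 1 else j - 1)) z / (z * perH κ (entry ζ j) z ^ p)

/-- `B_j(z)`: the factor `Q_{1,j}` on `Ω_{1,j}` and `Q_{2,j}` on `Ω_{2,j}`, times, for `δ = 1`,
`H_{j+1}(z)` in the left and `H_{j-1}(z)` in the right half plane; for `δ = -1` the half planes are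
exchanged. -/
def perB (j : ℕ) (z : ℂ) : ℂ :=
  ((perOm₁ ζ j).indicator (fun _ => perQ₁ ζ j) z + (perOm₂ ζ j).indicator (fun _ => perQ₂ ζ j) z) *
    perH κ (entry ζ (if ((δ : ℤ) : ℝ) * z.re < 0 then j + 1 else j - 1)) z

/-- The data of the periodic KPZ fixed point, with counting measure. The constants `κ`, `p`, `δ`
select the normalization of the functions `H_j` in the kernel: `(κ, p, δ) = (1, 1, 1)` and
`(κ, p, δ) = (1/(2πi), 2, -1)` both occur in the literature. -/
def perData : Data where
  Om₁ := perOm₁ ζ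
  Om₂ := perOm₂ ζ
  ν := Measure.count.restrict ((⋃ j, perOm₁ ζ j) ∪ ⋃ j, perOm₂ ζ j)
  τ _ := 1
  A := perA ζ κ p
  B := perB ζ κ δ

/-- `S` is the data of the periodic KPZ fixed point for some `ζ` with
`0 < |ζ_1| < ⋯ < |ζ_m| < 1` and some normalization, and the heights `x` and the parameters
`t = -τ/3` satisfy `0 < τ_1 ≤ ⋯ ≤ τ_m` and `x_i < x_j` if `i < j` and `τ_i = τ_j`. -/
def IsPeriodicKPZ (S : Data) (x t : Fin m → ℝ) : Prop :=
  (∀ i, t i < 0) ∧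
  (∀ i j, i < j → t j ≤ t i ∧ (t i = t j → x i < x j)) ∧
  ∃ (ζ : Fin m → ℂ) (κ : ℂ) (p : ℕ) (δ : ℤˣ),
    (∀ i, 0 < ‖ζ i‖ ∧ ‖ζ i‖ < 1) ∧ (∀ i j, i < j → ‖ζ i‖ < ‖ζ j‖) ∧
    S = perData ζ κ p δ

end Periodic

end KPZDet

end

set_option linter.unusedSectionVars false

noncomputable section

namespace KPZDet

/-! ### Hadamard's inequality -/

/-! Conjugation by the weight `w_i`, equal to `M_i^{1/2}` on `Ω_{1,i}` and to `M_i^{-1/2}` on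
`Ω_{2,i}`, turns `K₁` and `K₂` into the two parts `a`, `b` of one integrable kernel `H = a + b = ∑
f_k(u) g_k(v) / (u - v)`: `a` collects the odd labels `k`, `b` the even ones, and the label `m + 1`
counts as `0`. Since `a` maps `L²(Ω₂)` to `L²(Ω₁)` and `b` maps back, `a² = b² = 0`, and `D = det(1
- ab)` plays the role of `det(1 - H)`.

Consecutive entries of `(1, …, m)` differ by one, so the shift of the heights multiplies every `w_i`
by the same factor `exp(ξ e(z))`, with `e(z) = z/2` on the left and `-z/2` on the right. Its real
part is negative and bounded away from zero on the domains: the kernels decay exponentially and `D →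
1`. The `ξ`-derivative of `H` has the additional factor `e(u) + e(v)`. There is a function `X`,
independent of `k`, such that `e(u) = k u + X(u)` where `f_k` is nonzero and `e(v) = -k v - X(v)`
where `g_k` is nonzero. Hence `H' = ∑ k f_k ⊗ g_k + [X, H]`. As `H` commutes with its resolvent, the
commutator has trace zero against it, and `-(log D)' = ∑ k (Y₁)_{kk}`. This is `∑ Tr q_i`, because
`k ≤ m` belongs to exactly `k` of the index sets `{i, …, m}`. Integration over `(0, ∞)` gives the
first formula. With `u` in place of `X` one gets `[u, H] = ∑ f_k ⊗ g_k`, so `Tr Y₁ = 0` and `Tr s_i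
= -Tr q_i`, which is the second.

The analysis takes place in the ring `Ker w` of kernels bounded by a constant times `P(u) P(v)` with
`P` square integrable. There Hadamard's inequality makes the Fredholm series converge, the first
minor yields the resolvent (`Ker.minor_eq`, `Ker.minor_eq'`), and the determinant can be
differentiated (`Ker.hasDerivAt_fdet`); no theory of trace class operators enters. The transition to
`H` is `Ker.tr_derivative_eq`, the commutator argument is `LaxSystem.tr_full_eMul` and
`LaxSystem.sum_tr_rankOne`, and the integration is `eq_exp_neg_integral_logDeriv`. It remains to
verify the estimates collected in `Admissible` for the contours (`kpz_admissible`) and for the Bethe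
roots (`per_admissible`). -/

theorem prod_le_average_pow {n : ℕ} (z : Fin n → ℝ) (hz : ∀ i, 0 ≤ z i) :
    ∏ i, z i ≤ ((∑ i, z i) / n) ^ n := by
  rcases Nat.eq_zero_or_pos n with rfl | hn
  · simp
  have hn' : (0 : ℝ) < n := by exact_mod_cast hn
  have h := Real.geom_mean_le_arith_mean_weighted Finset.univ (fun _ => (n : ℝ)⁻¹) z
    (fun _ _ => by positivity) (by simp [hn'.ne']) (fun i _ => hz i)
  have h2 : (∏ i, z i ^ (n : ℝ)⁻¹) ^ n = ∏ i, z i := by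
    rw [← Finset.prod_pow]
    exact Finset.prod_congr rfl fun i _ => Real.rpow_inv_natCast_pow (hz i) hn.ne'
  rw [← h2]
  refine (pow_le_pow_left₀ (Finset.prod_nonneg fun i _ => Real.rpow_nonneg (hz i) _) h n).trans ?_
  rw [← Finset.mul_sum, inv_mul_eq_div]

/-- The constant `n^{n/2}` in Hadamard's inequality. -/
def hadamardConst (n : ℕ) : ℝ := √((n : ℝ) ^ n)

theorem hadamardConst_nonneg (n : ℕ) : 0 ≤ hadamardConst n := Real.sqrt_nonneg _

-- The number `|det A|²` is the product of the eigenvalues of `A* A`. Their sum is the sum of all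
-- `|A_{ij}|²`, at most `n²`, so the inequality of arithmetic and geometric means bounds the product
-- by `n^n`.
open scoped ComplexOrder in
theorem norm_det_le_of_norm_le_one {n : ℕ} (A : Matrix (Fin n) (Fin n) ℂ)
    (hA : ∀ i j, ‖A i j‖ ≤ 1) : ‖A.det‖ ≤ hadamardConst n := by
  have hP := Matrix.posSemidef_conjTranspose_mul_self A
  have hdet : ((‖A.det‖ ^ 2 : ℝ) : ℂ) = ((∏ i, hP.1.eigenvalues i : ℝ) : ℂ) := by
    have := hP.1.det_eq_prod_eigenvalues
    rw [Matrix.det_mul, Matrix.det_conjTranspose] at this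
    push_cast
    rw [← Complex.conj_mul']
    simpa using this
  have htr : ∑ i, hP.1.eigenvalues i = ∑ i, ∑ j, ‖A j i‖ ^ 2 := by
    have := hP.1.trace_eq_sum_eigenvalues
    have h2 : (A.conjTranspose * A).trace = ((∑ i, ∑ j, ‖A j i‖ ^ 2 : ℝ) : ℂ) := by
      simp [Matrix.trace, Matrix.mul_apply, Complex.conj_mul']
    rw [h2] at this
    rw [← RCLike.ofReal_sum] at this
    exact Complex.ofReal_injective this.symm
  have hle : ∑ i, hP.1.eigenvalues i ≤ (n : ℝ) * n := by
    rw [htr]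
    calc ∑ i, ∑ j, ‖A j i‖ ^ 2 ≤ ∑ _i : Fin n, ∑ _j : Fin n, (1 : ℝ) :=
          Finset.sum_le_sum fun i _ => Finset.sum_le_sum fun j _ =>
            pow_le_one₀ (norm_nonneg _) (hA j i)
      _ = n * n := by simp
  have hnn : ∀ i, 0 ≤ hP.1.eigenvalues i := fun i => hP.eigenvalues_nonneg i
  apply Real.le_sqrt_of_sq_le
  have h3 : ‖A.det‖ ^ 2 = ∏ i, hP.1.eigenvalues i := by exact_mod_cast hdet
  rw [h3]
  refine (prod_le_average_pow _ hnn).trans ?_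
  refine pow_le_pow_left₀ (div_nonneg (Finset.sum_nonneg fun i _ => hnn i) (by positivity)) ?_ n
  exact div_le_of_le_mul₀ (by positivity) (by positivity) hle

/-- Rescaling rows and columns pulls the weights out of the determinant. In this form the inequality
makes determinants of dominated kernels integrable. -/
theorem norm_det_le {n : ℕ} (A : Matrix (Fin n) (Fin n) ℂ) (p q : Fin n → ℝ)
    (hp : ∀ i, 0 ≤ p i) (hq : ∀ i, 0 ≤ q i) (hA : ∀ i j, ‖A i j‖ ≤ p i * q j) :
    ‖A.det‖ ≤ hadamardConst n * ((∏ i, p i) * ∏ i, q i) := by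
  let B : Matrix (Fin n) (Fin n) ℂ := Matrix.of fun i j => A i j / (p i * q j)
  have hB : A = Matrix.diagonal (fun i => (p i : ℂ)) * B * Matrix.diagonal (fun j => (q j : ℂ)) := by
    ext i j
    rw [Matrix.mul_diagonal, Matrix.diagonal_mul]
    simp only [B, Matrix.of_apply]
    -- A vanishing weight makes the rescaled entry zero by the convention for division; the bound
    -- forces `A i j = 0` as well.
    by_cases h : (p i : ℂ) * q j = 0
    · have h' : p i * q j = 0 := by exact_mod_cast h
      have : A i j = 0 := by
        have := hA i j
        rw [h'] at this
        simpa using this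
      simp [this]
    · have h1 := left_ne_zero_of_mul h
      have h2 := right_ne_zero_of_mul h
      field_simp
  have hB1 : ∀ i j, ‖B i j‖ ≤ 1 := by
    intro i j
    simp only [B, Matrix.of_apply, norm_div, norm_mul, Complex.norm_real, Real.norm_eq_abs,
      abs_of_nonneg (hp i), abs_of_nonneg (hq j)]
    exact div_le_one_of_le₀ (hA i j) (mul_nonneg (hp i) (hq j))
  have := norm_det_le_of_norm_le_one B hB1
  rw [hB, Matrix.det_mul, Matrix.det_mul, Matrix.det_diagonal, Matrix.det_diagonal, norm_mul,
    norm_mul, norm_prod, norm_prod]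
  simp only [Complex.norm_real, Real.norm_eq_abs, abs_of_nonneg (hp _), abs_of_nonneg (hq _)]
  have h1 : 0 ≤ ∏ i, p i := Finset.prod_nonneg fun i _ => hp i
  have h2 : 0 ≤ ∏ i, q i := Finset.prod_nonneg fun i _ => hq i
  calc (∏ i, p i) * ‖B.det‖ * ∏ i, q i ≤ (∏ i, p i) * hadamardConst n * ∏ i, q i := by gcongr
    _ = _ := by ring

theorem summable_pow_div_sqrt_factorial (y : ℝ) (hy : 0 ≤ y) :
    Summable fun n : ℕ => y ^ n / √(n.factorial : ℝ) := by
  rcases hy.eq_or_lt with rfl | hy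
  · refine summable_of_ne_finset_zero (s := {0}) fun n hn => ?_
    simp only [Finset.mem_singleton] at hn
    simp [hn]
  refine summable_of_ratio_test_tendsto_lt_one (l := 0) one_pos ?_ ?_
  · refine Eventually.of_forall fun n => ?_
    have : 0 < √(n.factorial : ℝ) := Real.sqrt_pos.2 (by exact_mod_cast n.factorial_pos)
    positivity
  · have h : ∀ n : ℕ, ‖y ^ (n + 1) / √((n + 1).factorial : ℝ)‖ / ‖y ^ n / √(n.factorial : ℝ)‖ =
        y / √((n : ℝ) + 1) := by
      intro n
      have h1 : 0 < √(n.factorial : ℝ) := Real.sqrt_pos.2 (by exact_mod_cast n.factorial_pos)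
      have h2 : 0 < √((n : ℝ) + 1) := Real.sqrt_pos.2 (by positivity)
      rw [Nat.factorial_succ]
      push_cast
      rw [Real.sqrt_mul (by positivity), Real.norm_of_nonneg (by positivity),
        Real.norm_of_nonneg (by positivity)]
      field_simp
      ring
    simp_rw [h]
    refine Tendsto.div_atTop tendsto_const_nhds (Real.tendsto_sqrt_atTop.comp ?_)
    exact tendsto_atTop_add_const_right _ _ tendsto_natCast_atTop_atTop

/-- One term of the exponential series gives `n^n ≤ e^n n!`. Thus `n^{n/2} / n!` decays faster than
any geometric sequence. -/
theorem hadamardConst_le (n : ℕ) :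
    hadamardConst n / n.factorial ≤ (Real.exp 1) ^ n / √(n.factorial : ℝ) := by
  have h0 : (0 : ℝ) < n.factorial := by exact_mod_cast n.factorial_pos
  have h1 : (n : ℝ) ^ n ≤ Real.exp 1 ^ n * n.factorial := by
    have := Real.pow_div_factorial_le_exp (n : ℝ) (by positivity) n
    rw [div_le_iff₀ h0] at this
    rwa [← Real.exp_nat_mul, mul_one]
  have h3 : (1 : ℝ) ≤ Real.exp 1 ^ n := one_le_pow₀ (Real.one_le_exp (by norm_num))
  have h2 : hadamardConst n ≤ Real.exp 1 ^ n * √(n.factorial : ℝ) := by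
    unfold hadamardConst
    rw [Real.sqrt_le_left (by positivity), mul_pow, Real.sq_sqrt h0.le]
    refine h1.trans ?_
    gcongr
    exact le_self_pow₀ h3 (by norm_num)
  rw [div_le_div_iff₀ h0 (Real.sqrt_pos.2 h0)]
  calc hadamardConst n * √(n.factorial : ℝ)
      ≤ Real.exp 1 ^ n * √(n.factorial : ℝ) * √(n.factorial : ℝ) := by gcongr
    _ = Real.exp 1 ^ n * n.factorial := by rw [mul_assoc, Real.mul_self_sqrt h0.le]

theorem summable_hadamardConst (x : ℝ) (hx : 0 ≤ x) :
    Summable fun n : ℕ => hadamardConst n / n.factorial * x ^ n := by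
  refine Summable.of_nonneg_of_le (fun n => ?_) (fun n => ?_)
    (summable_pow_div_sqrt_factorial (Real.exp 1 * x) (by positivity))
  · have := hadamardConst_nonneg n
    positivity
  · calc hadamardConst n / n.factorial * x ^ n ≤ (Real.exp 1) ^ n / √(n.factorial : ℝ) * x ^ n := by
          exact mul_le_mul_of_nonneg_right (hadamardConst_le n) (by positivity)
      _ = _ := by rw [mul_pow]; ring

/-- A bordered determinant has one row more, but its coefficient is still `1/n!`. The excess factor
`n + 1` is absorbed by `2^{n+1}`; the base `2x + 1` is at least `1`, so that the exponent may be
raised from `n` to `n + 1`. -/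
theorem summable_hadamardConst_succ (x : ℝ) (hx : 0 ≤ x) :
    Summable fun n : ℕ => hadamardConst (n + 1) / n.factorial * x ^ n := by
  have h := (summable_nat_add_iff 1).2 (summable_hadamardConst (2 * x + 1) (by positivity))
  refine Summable.of_nonneg_of_le (fun n => ?_) (fun n => ?_) (h.mul_left 2)
  · have := hadamardConst_nonneg (n + 1)
    positivity
  · have h1 : ((n : ℝ) + 1) * x ^ n ≤ 2 * (2 * x + 1) ^ (n + 1) := by
      have h2 : ((n : ℝ) + 1) ≤ 2 ^ (n + 1) := by
        exact_mod_cast (Nat.lt_two_pow_self (n := n + 1)).le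
      calc ((n : ℝ) + 1) * x ^ n ≤ 2 ^ (n + 1) * x ^ n := by gcongr
        _ = 2 * (2 * x) ^ n := by rw [pow_succ, mul_pow]; ring
        _ ≤ 2 * (2 * x + 1) ^ n := by gcongr; linarith
        _ ≤ 2 * (2 * x + 1) ^ (n + 1) := by
          gcongr 2 * ?_
          exact pow_le_pow_right₀ (by linarith) (Nat.le_succ n)
    have h0 := hadamardConst_nonneg (n + 1)
    rw [Nat.factorial_succ]
    push_cast
    have hf : (0 : ℝ) < n.factorial := by exact_mod_cast n.factorial_pos
    calc hadamardConst (n + 1) / n.factorial * x ^ n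
        = hadamardConst (n + 1) / ((n + 1) * n.factorial) * ((n + 1) * x ^ n) := by field_simp
      _ ≤ hadamardConst (n + 1) / ((n + 1) * n.factorial) * (2 * (2 * x + 1) ^ (n + 1)) := by
          gcongr
      _ = _ := by ring

/-! ### The ring of kernels dominated by a square integrable weight -/

/-- A nonnegative square integrable weight. -/
structure Weight {X : Type*} [MeasurableSpace X] (ν : Measure X) where
  P : X → ℝ
  meas : Measurable P
  nonneg : ∀ u, 0 ≤ P u
  sq : Integrable (fun u => P u ^ 2) ν

/-- The measurable kernels `h` with `|h(u, v)| ≤ C P(u) P(v)`. -/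
def kerSubmodule {X : Type*} [MeasurableSpace X] {ν : Measure X} (w : Weight ν) :
    Submodule ℂ (X → X → ℂ) where
  carrier := {h | Measurable (Function.uncurry h) ∧ ∃ C, ∀ u v, ‖h u v‖ ≤ C * (w.P u * w.P v)}
  add_mem' := by
    rintro a b ⟨ha, C, hC⟩ ⟨hb, D, hD⟩
    refine ⟨ha.add hb, C + D, fun u v => ?_⟩
    rw [add_mul]
    exact norm_add_le_of_le (hC u v) (hD u v)
  zero_mem' := ⟨measurable_const, 0, fun u v => by simp⟩
  smul_mem' := by
    rintro c a ⟨ha, C, hC⟩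
    refine ⟨ha.const_mul c, ‖c‖ * C, fun u v => ?_⟩
    simp only [Pi.smul_apply, smul_eq_mul, norm_mul, mul_assoc]
    exact mul_le_mul_of_nonneg_left (hC u v) (norm_nonneg c)

/-- The type of measurable kernels `h` with `|h(u, v)| ≤ C P(u) P(v)`. -/
def Ker {X : Type*} [MeasurableSpace X] {ν : Measure X} (w : Weight ν) : Type _ := kerSubmodule w

namespace Ker

variable {X : Type*} [MeasurableSpace X] {ν : Measure X} {w : Weight ν}

instance : AddCommGroup (Ker w) := inferInstanceAs (AddCommGroup (kerSubmodule w))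

instance : Module ℂ (Ker w) := inferInstanceAs (Module ℂ (kerSubmodule w))

theorem measurable_uncurry (h : Ker w) : Measurable (fun z : X × X => h.1 z.1 z.2) := h.2.1

theorem measurable_comp₂ (h : Ker w) {Y : Type*} [MeasurableSpace Y] {f g : Y → X}
    (hf : Measurable f) (hg : Measurable g) : Measurable fun y => h.1 (f y) (g y) :=
  h.measurable_uncurry.comp (hf.prodMk hg)

theorem exists_bound (h : Ker w) :
    ∃ C, 0 ≤ C ∧ ∀ u v, ‖h.1 u v‖ ≤ C * (w.P u * w.P v) := by
  obtain ⟨C, hC⟩ := h.2.2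
  refine ⟨max C 0, le_max_right _ _, fun u v => (hC u v).trans ?_⟩
  exact mul_le_mul_of_nonneg_right (le_max_left _ _) (mul_nonneg (w.nonneg u) (w.nonneg v))

@[simp] theorem add_apply (a b : Ker w) (u v : X) : (a + b).1 u v = a.1 u v + b.1 u v := rfl

@[simp] theorem sub_apply (a b : Ker w) (u v : X) : (a - b).1 u v = a.1 u v - b.1 u v := rfl

@[simp] theorem smul_apply (c : ℂ) (a : Ker w) (u v : X) : (c • a).1 u v = c * a.1 u v := rfl

@[simp] theorem zero_apply (u v : X) : (0 : Ker w).1 u v = 0 := rfl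

theorem ext' {a b : Ker w} (h : ∀ u v, a.1 u v = b.1 u v) : a = b :=
  Subtype.ext (funext fun u => funext fun v => h u v)

theorem integrable_of_le {f : X → ℂ} (hf : Measurable f) (C : ℝ)
    (h : ∀ s, ‖f s‖ ≤ C * w.P s ^ 2) : Integrable f ν :=
  (w.sq.const_mul C).mono' hf.aestronglyMeasurable (Eventually.of_forall h)

theorem integrable_mul (a b : Ker w) (u v : X) : Integrable (fun s => a.1 u s * b.1 s v) ν := by
  obtain ⟨C, hC0, hC⟩ := a.exists_bound
  obtain ⟨D, hD0, hD⟩ := b.exists_bound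
  refine integrable_of_le (w := w) ((a.measurable_comp₂ measurable_const measurable_id).mul
    (b.measurable_comp₂ measurable_id measurable_const)) (C * D * (w.P u * w.P v)) fun s => ?_
  rw [norm_mul]
  calc _ ≤ (C * (w.P u * w.P s)) * (D * (w.P s * w.P v)) :=
        mul_le_mul (hC _ _) (hD _ _) (norm_nonneg _) ((norm_nonneg _).trans (hC _ _))
    _ = _ := by ring

theorem integrable_diag (a : Ker w) : Integrable (fun s => a.1 s s) ν := by
  obtain ⟨C, hC0, hC⟩ := a.exists_bound
  refine integrable_of_le (w := w) (a.measurable_comp₂ measurable_id measurable_id) C fun s => ?_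
  rw [pow_two]
  exact hC s s

variable [SFinite ν]

theorem integrable_prod_of_le {f : X × X → ℂ} (hf : Measurable f) (C : ℝ)
    (h : ∀ s t, ‖f (s, t)‖ ≤ C * (w.P s ^ 2 * w.P t ^ 2)) : Integrable f (ν.prod ν) :=
  ((w.sq.mul_prod w.sq).const_mul C).mono' hf.aestronglyMeasurable
    (Eventually.of_forall fun z => h z.1 z.2)

/-- Multiplication is composition of integral operators. The bounds hold at every point, not just
almost everywhere, so that the diagonal values in traces and determinants are controlled without any
continuity of the kernels. -/
instance : Mul (Ker w) where
  mul a b := ⟨fun u v => ∫ s, a.1 u s * b.1 s v ∂ν, by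
    obtain ⟨C, hC0, hC⟩ := a.exists_bound
    obtain ⟨D, hD0, hD⟩ := b.exists_bound
    constructor
    · have : Measurable fun z : (X × X) × X => a.1 z.1.1 z.2 * b.1 z.2 z.1.2 :=
        (a.measurable_comp₂ (measurable_fst.comp measurable_fst) measurable_snd).mul
          (b.measurable_comp₂ measurable_snd (measurable_snd.comp measurable_fst))
      exact this.stronglyMeasurable.integral_prod_right'.measurable
    · refine ⟨C * D * ∫ s, w.P s ^ 2 ∂ν, fun u v => ?_⟩
      calc _ ≤ ∫ s, C * D * (w.P u * w.P v) * w.P s ^ 2 ∂ν := by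
            refine norm_integral_le_of_norm_le (w.sq.const_mul _) (Eventually.of_forall fun s => ?_)
            rw [norm_mul]
            calc _ ≤ (C * (w.P u * w.P s)) * (D * (w.P s * w.P v)) :=
                  mul_le_mul (hC _ _) (hD _ _) (norm_nonneg _) ((norm_nonneg _).trans (hC _ _))
              _ = _ := by ring
        _ = _ := by rw [integral_const_mul]; ring⟩

theorem mul_apply (a b : Ker w) (u v : X) : (a * b).1 u v = ∫ s, a.1 u s * b.1 s v ∂ν := rfl

theorem mul_assoc' (a b c : Ker w) : a * b * c = a * (b * c) := by
  obtain ⟨C, hC0, hC⟩ := a.exists_bound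
  obtain ⟨D, hD0, hD⟩ := b.exists_bound
  obtain ⟨E, hE0, hE⟩ := c.exists_bound
  refine ext' fun u v => ?_
  simp only [mul_apply]
  simp_rw [← integral_mul_const, ← integral_const_mul]
  rw [integral_integral_swap]
  · simp only [mul_assoc]
  · refine integrable_prod_of_le (w := w) (C := C * D * E * (w.P u * w.P v)) ?_ fun s t => ?_
    · exact ((a.measurable_comp₂ measurable_const measurable_snd).mul
        (b.measurable_comp₂ measurable_snd measurable_fst)).mul
        (c.measurable_comp₂ measurable_fst measurable_const)
    · simp only [Function.uncurry, norm_mul]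
      calc _ ≤ (C * (w.P u * w.P t)) * (D * (w.P t * w.P s)) * (E * (w.P s * w.P v)) := by
            have := hC u t
            have := hD t s
            have := hE s v
            have h1 := mul_nonneg hC0 (mul_nonneg (w.nonneg u) (w.nonneg t))
            have h2 := mul_nonneg hD0 (mul_nonneg (w.nonneg t) (w.nonneg s))
            gcongr
        _ = _ := by ring

instance : NonUnitalRing (Ker w) where
  left_distrib a b c := ext' fun u v => by
    simp only [mul_apply, add_apply, mul_add]
    exact integral_add (a.integrable_mul b u v) (a.integrable_mul c u v)
  right_distrib a b c := ext' fun u v => by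
    simp only [mul_apply, add_apply, add_mul]
    exact integral_add (a.integrable_mul c u v) (b.integrable_mul c u v)
  zero_mul a := ext' fun u v => by simp [mul_apply]
  mul_zero a := ext' fun u v => by simp [mul_apply]
  mul_assoc := mul_assoc'

theorem smul_mul (c : ℂ) (a b : Ker w) : (c • a) * b = c • (a * b) := ext' fun u v => by
  simp only [mul_apply, smul_apply, mul_assoc]
  rw [integral_const_mul]

theorem mul_smul' (c : ℂ) (a b : Ker w) : a * (c • b) = c • (a * b) := ext' fun u v => by
  simp only [mul_apply, smul_apply]
  rw [← integral_const_mul]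
  congr 1 with s
  ring

/-- The trace `∫ h(u, u)`. -/
def tr (a : Ker w) : ℂ := ∫ s, a.1 s s ∂ν

theorem tr_add (a b : Ker w) : tr (a + b) = tr a + tr b :=
  integral_add a.integrable_diag b.integrable_diag

theorem tr_sub (a b : Ker w) : tr (a - b) = tr a - tr b :=
  integral_sub a.integrable_diag b.integrable_diag

theorem tr_smul (c : ℂ) (a : Ker w) : tr (c • a) = c * tr a := integral_const_mul _ _

@[simp] theorem tr_zero : tr (0 : Ker w) = 0 := by simp [tr]

theorem tr_sum {ι : Type*} (s : Finset ι) (a : ι → Ker w) :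
    tr (∑ i ∈ s, a i) = ∑ i ∈ s, tr (a i) := by
  classical
  induction s using Finset.induction_on with
  | empty => simp
  | insert i s hi ih => rw [Finset.sum_insert hi, Finset.sum_insert hi, tr_add, ih]

theorem integrable_mul_swap (a b : Ker w) :
    Integrable (fun z : X × X => a.1 z.1 z.2 * b.1 z.2 z.1) (ν.prod ν) := by
  obtain ⟨C, hC0, hC⟩ := a.exists_bound
  obtain ⟨D, hD0, hD⟩ := b.exists_bound
  refine integrable_prod_of_le (w := w) (C := C * D) ?_ fun s t => ?_
  · exact (a.measurable_comp₂ measurable_fst measurable_snd).mul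
      (b.measurable_comp₂ measurable_snd measurable_fst)
  · rw [norm_mul]
    calc _ ≤ (C * (w.P s * w.P t)) * (D * (w.P t * w.P s)) :=
          mul_le_mul (hC _ _) (hD _ _) (norm_nonneg _) ((norm_nonneg _).trans (hC _ _))
      _ = _ := by ring

theorem tr_mul_comm (a b : Ker w) : tr (a * b) = tr (b * a) := by
  simp only [tr, mul_apply]
  rw [integral_integral_swap (a.integrable_mul_swap b)]
  simp only [mul_comm]

/-! ### The operators on `L²` -/

variable (w) in
theorem memLp_weight : MemLp w.P 2 ν :=
  (memLp_two_iff_integrable_sq w.meas.aestronglyMeasurable).2 w.sq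

variable (w) in
/-- The weight as an element of `L²`. -/
def weightLp : Lp ℝ 2 ν := (memLp_weight w).toLp w.P

theorem memLp_of_le {f : X → ℂ} (hf : Measurable f) (C : ℝ) (h : ∀ s, ‖f s‖ ≤ C * w.P s) :
    MemLp f 2 ν :=
  (memLp_weight w).of_le_mul hf.aestronglyMeasurable (Eventually.of_forall fun s => by
    rw [Real.norm_of_nonneg (w.nonneg s)]
    exact h s)

theorem integrable_mul_Lp {f : X → ℂ} (hf : Measurable f) (C : ℝ) (h : ∀ s, ‖f s‖ ≤ C * w.P s)
    (φ : Lp ℂ 2 ν) : Integrable (fun v => f v * φ v) ν :=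
  (memLp_of_le hf C h).integrable_mul (Lp.memLp φ)

theorem norm_integral_mul_Lp_le {f : X → ℂ} (hf : Measurable f) (C : ℝ)
    (_hC : 0 ≤ C) (h : ∀ s, ‖f s‖ ≤ C * w.P s) (φ : Lp ℂ 2 ν) :
    ‖∫ v, f v * φ v ∂ν‖ ≤ C * ‖weightLp w‖ * ‖φ‖ := by
  -- The inner product is conjugate linear in its first argument, hence the conjugate.
  have hmem : MemLp (fun v => (starRingEnd ℂ) (f v)) 2 ν :=
    memLp_of_le (by fun_prop) C (fun s => by simpa using h s)
  have h1 : ∫ v, f v * φ v ∂ν = inner ℂ (hmem.toLp _) φ := by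
    rw [L2.inner_def]
    refine integral_congr_ae ?_
    filter_upwards [hmem.coeFn_toLp] with v hv
    rw [hv]
    simp [mul_comm]
  rw [h1]
  refine (norm_inner_le_norm _ _).trans ?_
  gcongr
  refine Lp.norm_le_mul_norm_of_ae_le_mul ?_
  filter_upwards [hmem.coeFn_toLp, (memLp_weight w).coeFn_toLp] with v hv hv'
  rw [hv, weightLp, hv', Real.norm_of_nonneg (w.nonneg v)]
  simpa using h v

theorem row_bound (a : Ker w) : ∃ C, 0 ≤ C ∧ ∀ u, 0 ≤ C * w.P u ∧
    ∀ v, ‖a.1 u v‖ ≤ C * w.P u * w.P v := by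
  obtain ⟨C, hC0, hC⟩ := a.exists_bound
  exact ⟨C, hC0, fun u => ⟨mul_nonneg hC0 (w.nonneg u), fun v => by
    rw [mul_assoc]; exact hC u v⟩⟩

theorem measurable_row (a : Ker w) (u : X) : Measurable (a.1 u) :=
  a.measurable_comp₂ measurable_const measurable_id

theorem integrable_row_mul (a : Ker w) (u : X) (φ : Lp ℂ 2 ν) :
    Integrable (fun v => a.1 u v * φ v) ν := by
  obtain ⟨C, -, hC⟩ := a.row_bound
  exact integrable_mul_Lp (a.measurable_row u) _ (hC u).2 φ

theorem measurable_integral (a : Ker w) (φ : Lp ℂ 2 ν) :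
    Measurable fun u => ∫ v, a.1 u v * φ v ∂ν := by
  have : Measurable fun z : X × X => a.1 z.1 z.2 * φ z.2 :=
    a.measurable_uncurry.mul ((Lp.stronglyMeasurable φ).measurable.comp measurable_snd)
  exact this.stronglyMeasurable.integral_prod_right'.measurable

theorem memLp_integral (a : Ker w) (φ : Lp ℂ 2 ν) : MemLp (fun u => ∫ v, a.1 u v * φ v ∂ν) 2 ν := by
  obtain ⟨C, -, hC⟩ := a.row_bound
  refine memLp_of_le (w := w) (a.measurable_integral φ) (C * ‖weightLp w‖ * ‖φ‖) fun u => ?_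
  refine (norm_integral_mul_Lp_le (a.measurable_row u) _ (hC u).1 (hC u).2 φ).trans_eq ?_
  ring

/-- The operator on `L²` with kernel `a`. -/
def op (a : Ker w) : Lp ℂ 2 ν →L[ℂ] Lp ℂ 2 ν :=
  LinearMap.mkContinuousOfExistsBound
    { toFun := fun φ => (a.memLp_integral φ).toLp _
      map_add' := fun φ ψ => by
        refine Lp.ext ?_
        filter_upwards [(a.memLp_integral (φ + ψ)).coeFn_toLp, (a.memLp_integral φ).coeFn_toLp,
          (a.memLp_integral ψ).coeFn_toLp, Lp.coeFn_add ((a.memLp_integral φ).toLp _)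
          ((a.memLp_integral ψ).toLp _)] with u h1 h2 h3 h4
        rw [h1, h4, Pi.add_apply, h2, h3, ← integral_add (a.integrable_row_mul u φ)
          (a.integrable_row_mul u ψ)]
        refine integral_congr_ae ?_
        filter_upwards [Lp.coeFn_add φ ψ] with v hv
        rw [hv, Pi.add_apply, mul_add]
      map_smul' := fun c φ => by
        refine Lp.ext ?_
        filter_upwards [(a.memLp_integral (c • φ)).coeFn_toLp, (a.memLp_integral φ).coeFn_toLp,
          Lp.coeFn_smul c ((a.memLp_integral φ).toLp _)] with u h1 h2 h4
        rw [h1, RingHom.id_apply, h4, Pi.smul_apply, h2, smul_eq_mul, ← integral_const_mul]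
        refine integral_congr_ae ?_
        filter_upwards [Lp.coeFn_smul c φ] with v hv
        rw [hv, Pi.smul_apply, smul_eq_mul]
        ring }
    (by
      obtain ⟨C, hC0, hC⟩ := a.row_bound
      refine ⟨C * ‖weightLp w‖ * ‖weightLp w‖, fun φ => ?_⟩
      have : C * ‖weightLp w‖ * ‖weightLp w‖ * ‖φ‖ =
        (C * ‖weightLp w‖ * ‖φ‖) * ‖weightLp w‖ := by ring
      rw [this]
      refine Lp.norm_le_mul_norm_of_ae_le_mul ?_
      filter_upwards [(a.memLp_integral φ).coeFn_toLp, (memLp_weight w).coeFn_toLp] with u hu hv'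
      simp only [LinearMap.coe_mk, AddHom.coe_mk]
      rw [hu, weightLp, hv', Real.norm_of_nonneg (w.nonneg u)]
      refine (norm_integral_mul_Lp_le (a.measurable_row u) _ (hC u).1 (hC u).2 φ).trans_eq ?_
      rw [weightLp]
      ring)

theorem coeFn_op (a : Ker w) (φ : Lp ℂ 2 ν) : a.op φ =ᵐ[ν] fun u => ∫ v, a.1 u v * φ v ∂ν :=
  (a.memLp_integral φ).coeFn_toLp

theorem op_add (a b : Ker w) : (a + b).op = a.op + b.op := by
  ext1 φ
  refine Lp.ext ?_
  rw [_root_.add_apply]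
  filter_upwards [(a + b).coeFn_op φ, a.coeFn_op φ, b.coeFn_op φ, Lp.coeFn_add (a.op φ) (b.op φ)]
    with u h1 h2 h3 h4
  rw [h1, h4, Pi.add_apply, h2, h3, ← integral_add (a.integrable_row_mul u φ)
    (b.integrable_row_mul u φ)]
  simp only [add_apply, add_mul]

theorem op_mul (a b : Ker w) : (a * b).op = a.op * b.op := by
  ext1 φ
  refine Lp.ext ?_
  rw [mul_apply_eq_comp]
  filter_upwards [(a * b).coeFn_op φ, a.coeFn_op (b.op φ)] with u h1 h2
  rw [h1, h2]
  have h3 : ∫ s, a.1 u s * (b.op φ) s ∂ν = ∫ s, a.1 u s * ∫ v, b.1 s v * φ v ∂ν ∂ν := by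
    refine integral_congr_ae ?_
    filter_upwards [b.coeFn_op φ] with s hs
    rw [hs]
  rw [h3]
  simp only [mul_apply]
  simp_rw [← integral_mul_const, ← integral_const_mul]
  rw [integral_integral_swap]
  · simp only [mul_assoc]
  · obtain ⟨C, hC0, hC⟩ := a.exists_bound
    obtain ⟨D, hD0, hD⟩ := b.exists_bound
    have hi : Integrable (fun v => w.P v * ‖φ v‖) ν :=
      (memLp_weight w).integrable_mul (Lp.memLp φ).norm
    refine ((hi.mul_prod w.sq).const_mul (C * D * w.P u)).mono' ?_ ?_
    · refine Measurable.aestronglyMeasurable ?_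
      exact ((a.measurable_comp₂ measurable_const measurable_snd).mul
        (b.measurable_comp₂ measurable_snd measurable_fst)).mul
        ((Lp.stronglyMeasurable φ).measurable.comp measurable_fst)
    · refine Eventually.of_forall fun z => ?_
      simp only [Function.uncurry, norm_mul]
      calc _ ≤ (C * (w.P u * w.P z.2)) * (D * (w.P z.2 * w.P z.1)) * ‖φ z.1‖ := by
            have := hC u z.2
            have := hD z.2 z.1
            gcongr
            exact mul_nonneg hC0 (mul_nonneg (w.nonneg _) (w.nonneg _))
        _ = _ := by ring

end Ker

theorem measurable_det {Y : Type*} [MeasurableSpace Y] {n : ℕ} {M : Y → Matrix (Fin n) (Fin n) ℂ}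
    (h : ∀ i j, Measurable fun y => M y i j) : Measurable fun y => (M y).det := by
  simp only [Matrix.det_apply]
  refine Finset.measurable_sum _ fun σ _ => ?_
  exact (Finset.measurable_prod _ fun i _ => h _ _).const_smul _

/-- A series of integrals with dominated terms can be integrated term by term. -/
theorem tsum_mul_integral_eq {X : Type*} [MeasurableSpace X] {ν : Measure X} (F : ℕ → X → ℂ)
    (c : ℕ → ℂ) (b : ℕ → ℝ) (Q : X → ℝ) (hF : ∀ n, Measurable (F n)) (hQ : Integrable Q ν)
    (hb : ∀ n s, ‖F n s‖ ≤ b n * Q s) (hc : Summable fun n => ‖c n‖ * b n) :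
    ∑' n, c n * ∫ s, F n s ∂ν = ∫ s, ∑' n, c n * F n s ∂ν := by
  have hint : ∀ n, Integrable (fun s => c n * F n s) ν := fun n =>
    ((hQ.const_mul (b n)).mono' (hF n).aestronglyMeasurable
      (Eventually.of_forall (hb n))).const_mul (c n)
  have h1 : Summable fun n => ∫ s, ‖c n * F n s‖ ∂ν := by
    refine Summable.of_nonneg_of_le (fun n => integral_nonneg fun s => norm_nonneg _) (fun n => ?_)
      (hc.mul_right (∫ s, Q s ∂ν))
    rw [← integral_const_mul]
    refine integral_mono (hint n).norm (hQ.const_mul _) fun s => ?_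
    simp only [norm_mul, mul_assoc]
    exact mul_le_mul_of_nonneg_left (hb n s) (norm_nonneg _)
  rw [← integral_tsum_of_summable_integral_norm hint h1]
  exact tsum_congr fun n => (integral_const_mul _ _).symm

namespace Ker

variable {X : Type*} [MeasurableSpace X] {ν : Measure X} {w : Weight ν}

/-! ### Determinants of kernels and their expansion -/

/-- The determinant of `k(x_i, x_j)`. -/
def minorDet (k : Ker w) {n : ℕ} (x : Fin n → X) : ℂ := (Matrix.of fun i j => k.1 (x i) (x j)).det

/-- The determinant of `k(x_i, x_j)` bordered by a row `ρ` and a column with argument `v`. -/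
def borderDet (ρ : X → ℂ) (k : Ker w) (v : X) {n : ℕ} (x : Fin n → X) : ℂ :=
  (Matrix.of fun i j => (Fin.cons ρ (fun a => k.1 (x a)) : Fin (n + 1) → X → ℂ) i
    ((Fin.cons v x : Fin (n + 1) → X) j)).det

theorem borderDet_row (k : Ker w) (u v : X) {n : ℕ} (x : Fin n → X) :
    borderDet (k.1 u) k v x = (Matrix.of fun i j => k.1 ((Fin.cons u x : Fin (n + 1) → X) i)
      ((Fin.cons v x : Fin (n + 1) → X) j)).det := by
  unfold borderDet
  congr 1
  ext i j
  refine Fin.cases ?_ (fun i => ?_) i <;> simp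

/-- Moving row `j` to the top is a cycle of sign `(-1)^j`. -/
theorem det_insertNth (k : Ker w) (s v : X) {n : ℕ} (x : Fin n → X) (j : Fin (n + 1)) :
    (Matrix.of fun i l => k.1 ((j.insertNth s x : Fin (n + 1) → X) i)
      ((Fin.cons v x : Fin (n + 1) → X) l)).det = (-1) ^ (j : ℕ) * borderDet (k.1 s) k v x := by
  have h := Matrix.det_permute j.cycleRange.symm (Matrix.of fun i l =>
    k.1 ((j.insertNth s x : Fin (n + 1) → X) i) ((Fin.cons v x : Fin (n + 1) → X) l))
  rw [Equiv.Perm.sign_symm, Fin.sign_cycleRange] at h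
  have h2 : (Matrix.of fun i l => k.1 ((j.insertNth s x : Fin (n + 1) → X) i)
      ((Fin.cons v x : Fin (n + 1) → X) l)).submatrix j.cycleRange.symm id =
      Matrix.of fun i l => k.1 ((Fin.cons s x : Fin (n + 1) → X) i)
        ((Fin.cons v x : Fin (n + 1) → X) l) := by
    ext i l
    simp only [Matrix.submatrix_apply, Matrix.of_apply, id]
    rw [Fin.insertNth_apply_cycleRange_symm]
  rw [h2] at h
  rw [borderDet_row, h]
  push_cast
  rw [← mul_assoc, ← mul_pow]
  simp

/-- Laplace expansion along the border. The corner entry meets an ordinary minor; in the other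
minors `x_j` no longer labels a column but still labels a row, and will become the new border row.
-/
theorem borderDet_succ (ρ : X → ℂ) (k : Ker w) (v : X) {n : ℕ} (x : Fin (n + 1) → X) :
    borderDet ρ k v x = ρ v * k.minorDet x +
      ∑ j : Fin (n + 1), (-1) ^ ((j : ℕ) + 1) * (ρ (x j) *
        (Matrix.of fun i l => k.1 (x i) ((Fin.cons v (x ∘ j.succAbove) : Fin (n + 1) → X) l)).det) := by
  unfold borderDet
  rw [Matrix.det_succ_row_zero, Fin.sum_univ_succ]
  congr 1
  · simp only [Fin.val_zero, pow_zero, one_mul, Matrix.of_apply, Fin.cons_zero, minorDet]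
    congr 2
  · refine Finset.sum_congr rfl fun j _ => ?_
    simp only [Fin.val_succ, Matrix.of_apply, Fin.cons_zero, Fin.cons_succ, mul_assoc]
    congr 3
    ext i l
    simp only [Matrix.submatrix_apply, Matrix.of_apply, Fin.cons_succ]
    refine Fin.cases ?_ (fun l => ?_) l
    · simp
    · simp

theorem norm_minorDet_le (k : Ker w) {C : ℝ} (hC0 : 0 ≤ C)
    (hC : ∀ u v, ‖k.1 u v‖ ≤ C * (w.P u * w.P v)) {n : ℕ} (x : Fin n → X) :
    ‖k.minorDet x‖ ≤ hadamardConst n * C ^ n * ∏ i, w.P (x i) ^ 2 := by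
  refine (norm_det_le _ (fun i => C * w.P (x i)) (fun j => w.P (x j))
    (fun i => mul_nonneg hC0 (w.nonneg _)) (fun j => w.nonneg _) fun i j => ?_).trans_eq ?_
  · rw [mul_assoc]
    exact hC _ _
  · rw [Finset.prod_mul_distrib, Finset.prod_pow]
    simp only [Finset.prod_const, Finset.card_univ, Fintype.card_fin]
    ring

theorem norm_borderDet_le (k : Ker w) {C : ℝ} (hC0 : 0 ≤ C)
    (hC : ∀ u v, ‖k.1 u v‖ ≤ C * (w.P u * w.P v)) {ρ : X → ℂ} {R : ℝ} (hR0 : 0 ≤ R)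
    (hR : ∀ s, ‖ρ s‖ ≤ R * w.P s) (v : X) {n : ℕ} (x : Fin n → X) :
    ‖borderDet ρ k v x‖ ≤ hadamardConst (n + 1) * C ^ n * (R * w.P v) * ∏ i, w.P (x i) ^ 2 := by
  refine (norm_det_le _ (Fin.cons R (fun i => C * w.P (x i)))
    (fun j => w.P ((Fin.cons v x : Fin (n + 1) → X) j)) (fun i => ?_) (fun j => w.nonneg _)
    fun i j => ?_).trans_eq ?_
  · refine Fin.cases ?_ (fun i => ?_) i
    · simpa
    · simpa using mul_nonneg hC0 (w.nonneg _)
  · refine Fin.cases ?_ (fun i => ?_) i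
    · simpa using hR _
    · simpa [mul_assoc] using hC _ _
  · simp only [Fin.prod_univ_succ, Fin.cons_zero, Fin.cons_succ, Finset.prod_mul_distrib,
      Finset.prod_pow, Finset.prod_const, Finset.card_univ, Fintype.card_fin]
    ring

theorem measurable_borderDet (k : Ker w) {Y : Type*} [MeasurableSpace Y] {n : ℕ}
    {ρ : Y → X → ℂ} (hρ : Measurable fun z : Y × X => ρ z.1 z.2) {v : Y → X} (hv : Measurable v)
    {x : Y → Fin n → X} (hx : Measurable x) : Measurable fun y => borderDet (ρ y) k (v y) (x y) := by
  refine measurable_det fun i j => ?_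
  have hj : Measurable fun y => (Fin.cons (v y) (x y) : Fin (n + 1) → X) j := by
    refine Fin.cases ?_ (fun j => ?_) j
    · simpa using hv
    · simpa using measurable_pi_iff.1 hx j
  refine Fin.cases ?_ (fun i => ?_) i
  · simpa [Function.comp_def] using hρ.comp (measurable_id.prodMk hj)
  · simpa using k.measurable_comp₂ (measurable_pi_iff.1 hx i) hj

theorem measurable_minorDet (k : Ker w) {n : ℕ} :
    Measurable fun x : Fin n → X => k.minorDet x :=
  measurable_det fun i j => k.measurable_comp₂ (measurable_pi_apply i) (measurable_pi_apply j)

/-! ### The terms of the Fredholm series -/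

variable [SigmaFinite ν]

variable (w) in
theorem integrable_prod_weight (n : ℕ) :
    Integrable (fun x : Fin n → X => ∏ i, w.P (x i) ^ 2) (Measure.pi fun _ => ν) :=
  Integrable.fintype_prod fun _ => w.sq

variable (w) in
theorem integral_prod_weight (n : ℕ) :
    ∫ x : Fin n → X, ∏ i, w.P (x i) ^ 2 ∂(Measure.pi fun _ => ν) = (∫ s, w.P s ^ 2 ∂ν) ^ n := by
  rw [integral_fintype_prod_eq_prod (f := fun _ s => w.P s ^ 2)]
  simp

variable (w) in
theorem integral_sq_nonneg : 0 ≤ ∫ s, w.P s ^ 2 ∂ν := integral_nonneg fun _ => sq_nonneg _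

/-- The integral of `det k(x_i, x_j)`. -/
def minorInt (k : Ker w) (n : ℕ) : ℂ := ∫ x : Fin n → X, k.minorDet x ∂(Measure.pi fun _ => ν)

/-- The integral of the bordered determinant. -/
def borderInt (ρ : X → ℂ) (k : Ker w) (v : X) (n : ℕ) : ℂ :=
  ∫ x : Fin n → X, borderDet ρ k v x ∂(Measure.pi fun _ => ν)

theorem integrable_minorDet (k : Ker w) (n : ℕ) :
    Integrable (fun x : Fin n → X => k.minorDet x) (Measure.pi fun _ => ν) := by
  obtain ⟨C, hC0, hC⟩ := k.exists_bound
  exact ((integrable_prod_weight w n).const_mul _).mono' k.measurable_minorDet.aestronglyMeasurable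
    (Eventually.of_forall fun x => k.norm_minorDet_le hC0 hC x)

theorem integral_norm_minorDet_le (k : Ker w) {C : ℝ} (hC0 : 0 ≤ C)
    (hC : ∀ u v, ‖k.1 u v‖ ≤ C * (w.P u * w.P v)) (n : ℕ) :
    ∫ x : Fin n → X, ‖k.minorDet x‖ ∂(Measure.pi fun _ => ν) ≤
      hadamardConst n * (C * ∫ s, w.P s ^ 2 ∂ν) ^ n := by
  refine (integral_mono (k.integrable_minorDet n).norm ((integrable_prod_weight w n).const_mul _)
    fun x => k.norm_minorDet_le hC0 hC x).trans_eq ?_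
  rw [integral_const_mul, integral_prod_weight, mul_pow]
  ring

theorem norm_minorInt_le (k : Ker w) {C : ℝ} (hC0 : 0 ≤ C)
    (hC : ∀ u v, ‖k.1 u v‖ ≤ C * (w.P u * w.P v)) (n : ℕ) :
    ‖k.minorInt n‖ ≤ hadamardConst n * (C * ∫ s, w.P s ^ 2 ∂ν) ^ n :=
  (norm_integral_le_integral_norm _).trans (k.integral_norm_minorDet_le hC0 hC n)

theorem norm_borderInt_le (k : Ker w) {C : ℝ} (hC0 : 0 ≤ C)
    (hC : ∀ u v, ‖k.1 u v‖ ≤ C * (w.P u * w.P v)) {ρ : X → ℂ} {R : ℝ}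
    (hR0 : 0 ≤ R) (hR : ∀ s, ‖ρ s‖ ≤ R * w.P s) (v : X) (n : ℕ) :
    ‖borderInt ρ k v n‖ ≤
      hadamardConst (n + 1) * (C * ∫ s, w.P s ^ 2 ∂ν) ^ n * (R * w.P v) := by
  refine (norm_integral_le_of_norm_le ((integrable_prod_weight w n).const_mul _)
    (Eventually.of_forall fun x => k.norm_borderDet_le hC0 hC hR0 hR v x)).trans_eq ?_
  rw [integral_const_mul, integral_prod_weight, mul_pow]
  ring

theorem measurable_borderInt (k : Ker w) {Y : Type*} [MeasurableSpace Y] {n : ℕ}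
    {ρ : Y → X → ℂ} (hρ : Measurable fun z : Y × X => ρ z.1 z.2) {v : Y → X} (hv : Measurable v) :
    Measurable fun y => borderInt (ρ y) k (v y) n := by
  have h : Measurable fun z : Y × (Fin n → X) => borderDet (ρ z.1) k (v z.1) z.2 :=
    k.measurable_borderDet (ρ := fun z : Y × (Fin n → X) => ρ z.1)
      (hρ.comp ((measurable_fst.comp measurable_fst).prodMk measurable_snd))
      (hv.comp measurable_fst) measurable_snd
  exact h.stronglyMeasurable.integral_prod_right'.measurable

theorem integral_pi_succ {n : ℕ} (j : Fin (n + 1)) (Φ : (Fin (n + 1) → X) → ℂ) :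
    ∫ x, Φ x ∂(Measure.pi fun _ => ν) = ∫ z : X × (Fin n → X),
      Φ (j.insertNth z.1 z.2) ∂(ν.prod (Measure.pi fun _ => ν)) :=
  ((measurePreserving_piFinSuccAbove (fun _ : Fin (n + 1) => ν) j).symm.integral_comp' Φ).symm

theorem integrable_pi_succ {n : ℕ} (j : Fin (n + 1)) {Φ : (Fin (n + 1) → X) → ℂ}
    (h : Integrable (fun z : X × (Fin n → X) => Φ (j.insertNth z.1 z.2))
      (ν.prod (Measure.pi fun _ => ν))) : Integrable Φ (Measure.pi fun _ => ν) :=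
  ((measurePreserving_piFinSuccAbove (fun _ : Fin (n + 1) => ν) j).symm.integrable_comp_emb
    (MeasurableEquiv.measurableEmbedding _)).1 h

theorem integrable_prod_borderDet (k : Ker w) {n : ℕ} {ρ : X → X → ℂ}
    (hρ : Measurable fun z : X × X => ρ z.1 z.2) {v : X → X} (hv : Measurable v) {R : ℝ}
    (hR0 : 0 ≤ R) (hR : ∀ s t, ‖ρ s t‖ ≤ R * w.P s * w.P t) {c : X → ℂ} (hc : Measurable c)
    {C : ℝ} (hC : ∀ s, ‖c s‖ * w.P (v s) ≤ C * w.P s) :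
    Integrable (fun z : X × (Fin n → X) => c z.1 * borderDet (ρ z.1) k (v z.1) z.2)
      (ν.prod (Measure.pi fun _ => ν)) := by
  obtain ⟨K, hK0, hK⟩ := k.exists_bound
  refine ((w.sq.mul_prod (integrable_prod_weight w n)).const_mul
    (hadamardConst (n + 1) * K ^ n * R * C)).mono' (Measurable.aestronglyMeasurable ?_) ?_
  · exact (hc.comp measurable_fst).mul (k.measurable_borderDet
      (ρ := fun z : X × (Fin n → X) => ρ z.1)
      (hρ.comp ((measurable_fst.comp measurable_fst).prodMk measurable_snd))
      (hv.comp measurable_fst) measurable_snd)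
  · refine Eventually.of_forall fun z => ?_
    have h0 := hadamardConst_nonneg (n + 1)
    have h1 := k.norm_borderDet_le hK0 hK (mul_nonneg hR0 (w.nonneg z.1)) (hR z.1) (v z.1) z.2
    have h2 : 0 ≤ ∏ i, w.P (z.2 i) ^ 2 := Finset.prod_nonneg fun i _ => sq_nonneg _
    have h3 := w.nonneg z.1
    rw [norm_mul]
    calc ‖c z.1‖ * ‖borderDet (ρ z.1) k (v z.1) z.2‖
        ≤ ‖c z.1‖ * (hadamardConst (n + 1) * K ^ n * (R * w.P z.1 * w.P (v z.1)) *
          ∏ i, w.P (z.2 i) ^ 2) := by gcongr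
      _ = (hadamardConst (n + 1) * K ^ n * (R * w.P z.1) * ∏ i, w.P (z.2 i) ^ 2) *
          (‖c z.1‖ * w.P (v z.1)) := by ring
      _ ≤ (hadamardConst (n + 1) * K ^ n * (R * w.P z.1) * ∏ i, w.P (z.2 i) ^ 2) *
          (C * w.P z.1) := by
          have := hC z.1
          gcongr
      _ = _ := by ring

theorem borderInt_zero (ρ : X → ℂ) (k : Ker w) (v : X) : borderInt ρ k v 0 = ρ v := by
  simp [borderInt, borderDet, Measure.real]

theorem minorInt_zero (k : Ker w) : k.minorInt 0 = 1 := by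
  simp [minorInt, minorDet, Measure.real]

/-- This recursion is the source of Fredholm's identities: after integration, the `n + 1` terms of
the expansion that do not contain the corner coincide. -/
theorem borderInt_succ (k : Ker w) {ρ : X → ℂ} (hρ : Measurable ρ) {R : ℝ}
    (hR : ∀ s, ‖ρ s‖ ≤ R * w.P s) (v : X) (n : ℕ) :
    borderInt ρ k v (n + 1) = ρ v * k.minorInt (n + 1) -
      (n + 1) * ∫ s, ρ s * borderInt (k.1 s) k v n ∂ν := by
  obtain ⟨C, hC0, hC⟩ := k.exists_bound
  have hprod : Integrable (fun z : X × (Fin n → X) => ρ z.1 * borderDet (k.1 z.1) k v z.2)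
      (ν.prod (Measure.pi fun _ => ν)) := by
    refine k.integrable_prod_borderDet (ρ := k.1) (v := fun _ => v) k.measurable_uncurry
      measurable_const hC0 (fun s t => by rw [mul_assoc]; exact hC s t) hρ (C := R * w.P v)
      fun s => ?_
    calc ‖ρ s‖ * w.P v ≤ R * w.P s * w.P v := mul_le_mul_of_nonneg_right (hR s) (w.nonneg v)
      _ = _ := by ring
  -- With `s` for `x_j`, the expansion sign `(-1)^(j+1)` and the sign `(-1)^j` of the row cycle
  -- combine to `-1` for every `j`.
  have key : ∀ (j : Fin (n + 1)) (z : X × (Fin n → X)),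
      (-1) ^ ((j : ℕ) + 1) * (ρ ((j.insertNth z.1 z.2 : Fin (n + 1) → X) j) *
        (Matrix.of fun i l => k.1 ((j.insertNth z.1 z.2 : Fin (n + 1) → X) i)
          ((Fin.cons v ((j.insertNth z.1 z.2 : Fin (n + 1) → X) ∘ j.succAbove) :
            Fin (n + 1) → X) l)).det) = -(ρ z.1 * borderDet (k.1 z.1) k v z.2) := by
    intro j z
    have : (j.insertNth z.1 z.2 : Fin (n + 1) → X) ∘ j.succAbove = z.2 := by
      ext i
      simp
    rw [this, det_insertNth, Fin.insertNth_apply_same, pow_succ]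
    have h1 : ((-1 : ℂ) ^ (j : ℕ)) * (-1) ^ (j : ℕ) = 1 := by rw [← mul_pow]; simp
    linear_combination (-(ρ z.1 * borderDet (k.1 z.1) k v z.2)) * h1
  have hterm : ∀ j : Fin (n + 1), Integrable (fun x : Fin (n + 1) → X =>
      (-1) ^ ((j : ℕ) + 1) * (ρ (x j) * (Matrix.of fun i l => k.1 (x i)
        ((Fin.cons v (x ∘ j.succAbove) : Fin (n + 1) → X) l)).det)) (Measure.pi fun _ => ν) := by
    intro j
    refine integrable_pi_succ j ?_
    simp only [key]
    exact hprod.neg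
  unfold borderInt
  simp_rw [borderDet_succ]
  rw [integral_add ((k.integrable_minorDet _).const_mul _) (integrable_finsetSum _ fun j _ => hterm j),
    integral_const_mul, integral_finsetSum _ fun j _ => hterm j]
  have : ∀ j : Fin (n + 1), ∫ x : Fin (n + 1) → X,
      (-1) ^ ((j : ℕ) + 1) * (ρ (x j) * (Matrix.of fun i l => k.1 (x i)
        ((Fin.cons v (x ∘ j.succAbove) : Fin (n + 1) → X) l)).det) ∂(Measure.pi fun _ => ν) =
      -∫ s, ρ s * ∫ x : Fin n → X, borderDet (k.1 s) k v x ∂(Measure.pi fun _ => ν) ∂ν := by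
    intro j
    rw [integral_pi_succ j]
    simp only [key]
    rw [integral_neg, integral_prod _ hprod]
    simp only [integral_const_mul]
  simp_rw [this]
  simp [minorInt]
  ring

/-! ### The Fredholm determinant and the first minor -/

/-- The coefficient `(-1)ⁿ / n!`. -/
def altCoeff (n : ℕ) : ℂ := (-1) ^ n / (n.factorial : ℂ)

theorem norm_altCoeff (n : ℕ) : ‖altCoeff n‖ = 1 / (n.factorial : ℝ) := by
  simp [altCoeff]

theorem altCoeff_succ (n : ℕ) : altCoeff (n + 1) * (n + 1) = -altCoeff n := by
  have h1 : (n.factorial : ℂ) ≠ 0 := by exact_mod_cast n.factorial_ne_zero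
  have h2 : ((n : ℂ) + 1) ≠ 0 := by exact_mod_cast n.succ_ne_zero
  unfold altCoeff
  rw [Nat.factorial_succ]
  push_cast
  field_simp
  ring

/-- The Fredholm determinant `det(1 - k)`. -/
def fdet (k : Ker w) : ℂ := ∑' n, altCoeff n * k.minorInt n

/-- The Fredholm series of the bordered determinants. -/
def fborder (ρ : X → ℂ) (k : Ker w) (v : X) : ℂ := ∑' n, altCoeff n * borderInt ρ k v n

theorem norm_altCoeff_mul_minorInt_le (k : Ker w) {C : ℝ} (hC0 : 0 ≤ C)
    (hC : ∀ u v, ‖k.1 u v‖ ≤ C * (w.P u * w.P v)) (n : ℕ) :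
    ‖altCoeff n * k.minorInt n‖ ≤ hadamardConst n / n.factorial * (C * ∫ s, w.P s ^ 2 ∂ν) ^ n := by
  rw [norm_mul, norm_altCoeff]
  calc _ ≤ 1 / (n.factorial : ℝ) * (hadamardConst n * (C * ∫ s, w.P s ^ 2 ∂ν) ^ n) := by
        gcongr
        exact k.norm_minorInt_le hC0 hC n
    _ = _ := by ring

theorem norm_altCoeff_mul_borderInt_le (k : Ker w) {C : ℝ} (hC0 : 0 ≤ C)
    (hC : ∀ u v, ‖k.1 u v‖ ≤ C * (w.P u * w.P v)) {ρ : X → ℂ} {R : ℝ}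
    (hR0 : 0 ≤ R) (hR : ∀ s, ‖ρ s‖ ≤ R * w.P s) (v : X) (n : ℕ) :
    ‖altCoeff n * borderInt ρ k v n‖ ≤
      hadamardConst (n + 1) / n.factorial * (C * ∫ s, w.P s ^ 2 ∂ν) ^ n * (R * w.P v) := by
  rw [norm_mul, norm_altCoeff]
  calc _ ≤ 1 / (n.factorial : ℝ) *
        (hadamardConst (n + 1) * (C * ∫ s, w.P s ^ 2 ∂ν) ^ n * (R * w.P v)) := by
        gcongr
        exact k.norm_borderInt_le hC0 hC hR0 hR v n
    _ = _ := by ring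

theorem summable_minorInt (k : Ker w) : Summable fun n => altCoeff n * k.minorInt n := by
  obtain ⟨C, hC0, hC⟩ := k.exists_bound
  exact Summable.of_norm_bounded (summable_hadamardConst _ (mul_nonneg hC0 (integral_sq_nonneg w)))
    fun n => k.norm_altCoeff_mul_minorInt_le hC0 hC n

theorem summable_borderInt (k : Ker w) {ρ : X → ℂ} {R : ℝ} (hR0 : 0 ≤ R)
    (hR : ∀ s, ‖ρ s‖ ≤ R * w.P s) (v : X) : Summable fun n => altCoeff n * borderInt ρ k v n := by
  obtain ⟨C, hC0, hC⟩ := k.exists_bound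
  exact Summable.of_norm_bounded
    ((summable_hadamardConst_succ _ (mul_nonneg hC0 (integral_sq_nonneg w))).mul_right _)
    fun n => k.norm_altCoeff_mul_borderInt_le hC0 hC hR0 hR v n

/-- The constant which bounds the first Fredholm minor of a kernel bounded by `C P(u) P(v)`. -/
def minorConst (I C : ℝ) : ℝ := ∑' n : ℕ, hadamardConst (n + 1) / n.factorial * (C * I) ^ n

theorem norm_fborder_le (k : Ker w) {C : ℝ} (hC0 : 0 ≤ C)
    (hC : ∀ u v, ‖k.1 u v‖ ≤ C * (w.P u * w.P v)) {ρ : X → ℂ} {R : ℝ}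
    (hR0 : 0 ≤ R) (hR : ∀ s, ‖ρ s‖ ≤ R * w.P s) (v : X) :
    ‖fborder ρ k v‖ ≤ minorConst (∫ s, w.P s ^ 2 ∂ν) C * (R * w.P v) := by
  have h := (summable_hadamardConst_succ _ (mul_nonneg hC0 (integral_sq_nonneg w))).mul_right
    (R * w.P v)
  refine (tsum_of_norm_bounded h.hasSum
    fun n => k.norm_altCoeff_mul_borderInt_le hC0 hC hR0 hR v n).trans_eq ?_
  rw [tsum_mul_right, minorConst]

theorem measurable_fborder (k : Ker w) {Y : Type*} [MeasurableSpace Y] {ρ : Y → X → ℂ}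
    (hρ : Measurable fun z : Y × X => ρ z.1 z.2) {v : Y → X} (hv : Measurable v)
    (hs : ∀ y, Summable fun n => altCoeff n * borderInt (ρ y) k (v y) n) :
    Measurable fun y => fborder (ρ y) k (v y) := by
  refine measurable_of_tendsto_metrizable (f := fun N y =>
    ∑ n ∈ Finset.range N, altCoeff n * borderInt (ρ y) k (v y) n) (fun N => ?_) ?_
  · exact Finset.measurable_sum _ fun n _ => (k.measurable_borderInt hρ hv).const_mul _
  · exact tendsto_pi_nhds.2 fun y => (hs y).hasSum.tendsto_sum_nat

/-- The first Fredholm minor. -/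
def minor (k : Ker w) : Ker w := ⟨fun u v => fborder (k.1 u) k v, by
  obtain ⟨C, hC0, hC⟩ := k.exists_bound
  have hrow : ∀ u s, ‖k.1 u s‖ ≤ C * w.P u * w.P s := fun u s => by rw [mul_assoc]; exact hC u s
  constructor
  · exact k.measurable_fborder (ρ := fun z : X × X => k.1 z.1) (k.measurable_comp₂
      (measurable_fst.comp measurable_fst) measurable_snd) measurable_snd
      fun y => k.summable_borderInt (mul_nonneg hC0 (w.nonneg _)) (hrow y.1) y.2
  · refine ⟨minorConst (∫ s, w.P s ^ 2 ∂ν) C * C, fun u v => ?_⟩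
    refine (k.norm_fborder_le hC0 hC (mul_nonneg hC0 (w.nonneg u)) (hrow u) v).trans_eq ?_
    ring⟩

theorem minor_apply (k : Ker w) (u v : X) : k.minor.1 u v = fborder (k.1 u) k v := rfl

/-- The recursion `borderInt_succ` is summed with the coefficients `(-1)^n / n!`, the factor `n + 1`
being consumed by the factorial. The border row is left arbitrary for two uses: with rows of `k`
this becomes the resolvent identity, with rows of the derivative it becomes Jacobi's formula. -/
theorem fborder_eq (k : Ker w) {ρ : X → ℂ} (hρ : Measurable ρ) {R : ℝ} (hR0 : 0 ≤ R)
    (hR : ∀ s, ‖ρ s‖ ≤ R * w.P s) (v : X) :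
    fborder ρ k v = ρ v * k.fdet + ∫ s, ρ s * k.minor.1 s v ∂ν := by
  obtain ⟨C, hC0, hC⟩ := k.exists_bound
  have hrow : ∀ u s, ‖k.1 u s‖ ≤ C * w.P u * w.P s := fun u s => by rw [mul_assoc]; exact hC u s
  have h1 : ∫ s, ρ s * k.minor.1 s v ∂ν =
      ∑' n, altCoeff n * ∫ s, ρ s * borderInt (k.1 s) k v n ∂ν := by
    rw [tsum_mul_integral_eq (F := fun n s => ρ s * borderInt (k.1 s) k v n) (c := altCoeff)
      (b := fun n => hadamardConst (n + 1) * (C * ∫ s, w.P s ^ 2 ∂ν) ^ n * (R * C * w.P v))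
      (Q := fun s => w.P s ^ 2)]
    · refine integral_congr_ae (Eventually.of_forall fun s => ?_)
      simp only [minor_apply, fborder]
      rw [← tsum_mul_left]
      exact tsum_congr fun n => by ring
    · exact fun n => hρ.mul (k.measurable_borderInt k.measurable_uncurry measurable_const)
    · exact w.sq
    · intro n s
      rw [norm_mul]
      have h2 := k.norm_borderInt_le hC0 hC (mul_nonneg hC0 (w.nonneg s)) (hrow s) v n
      calc _ ≤ (R * w.P s) * (hadamardConst (n + 1) * (C * ∫ s, w.P s ^ 2 ∂ν) ^ n *
            (C * w.P s * w.P v)) :=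
            mul_le_mul (hR s) h2 (norm_nonneg _) (mul_nonneg hR0 (w.nonneg s))
        _ = _ := by ring
    · refine ((summable_hadamardConst_succ _ (mul_nonneg hC0 (integral_sq_nonneg w))).mul_right
        (R * C * w.P v)).congr fun n => ?_
      rw [norm_altCoeff]
      ring
  have hs1 := k.summable_borderInt hR0 hR v
  have hs2 := k.summable_minorInt
  -- By the recursion this series is a combination of the two preceding ones, so no new estimate is
  -- needed.
  have hs3 : Summable fun n => altCoeff n * ∫ s, ρ s * borderInt (k.1 s) k v n ∂ν := by
    have := ((summable_nat_add_iff 1).2 hs1).sub (((summable_nat_add_iff 1).2 hs2).mul_left (ρ v))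
    refine this.congr fun n => ?_
    rw [k.borderInt_succ hρ hR]
    linear_combination (-∫ s, ρ s * borderInt (k.1 s) k v n ∂ν) * altCoeff_succ n
  rw [h1, fborder, fdet, hs1.tsum_eq_zero_add, hs2.tsum_eq_zero_add, mul_add, add_assoc,
    ← tsum_mul_left, ← Summable.tsum_add (((summable_nat_add_iff 1).2 hs2).mul_left _) hs3,
    borderInt_zero, minorInt_zero]
  have h0 : altCoeff 0 = 1 := by simp [altCoeff]
  congr 1
  · rw [h0]; ring
  · refine tsum_congr fun n => ?_
    rw [k.borderInt_succ hρ hR]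
    linear_combination (-∫ s, ρ s * borderInt (k.1 s) k v n ∂ν) * altCoeff_succ n

theorem minor_eq (k : Ker w) : k.minor = k.fdet • k + k * k.minor := ext' fun u v => by
  obtain ⟨C, hC0, hC⟩ := k.exists_bound
  rw [minor_apply, k.fborder_eq (k.measurable_row u) (mul_nonneg hC0 (w.nonneg u))
    (fun s => by rw [mul_assoc]; exact hC u s)]
  simp only [add_apply, smul_apply, mul_apply, mul_comm]

/-- The transposed kernel. -/
def transpose (k : Ker w) : Ker w := ⟨fun u v => k.1 v u, by
  obtain ⟨C, hC0, hC⟩ := k.exists_bound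
  exact ⟨k.measurable_comp₂ measurable_snd measurable_fst, C, fun u v => by
    rw [mul_comm (w.P u)]; exact hC v u⟩⟩

theorem fdet_transpose (k : Ker w) : k.transpose.fdet = k.fdet := by
  unfold fdet minorInt minorDet
  congr 1; ext n; congr 2; ext x
  rw [← Matrix.det_transpose]
  rfl

theorem minor_transpose (k : Ker w) : k.transpose.minor = k.minor.transpose := ext' fun u v => by
  change fborder (k.transpose.1 u) k.transpose v = fborder (k.1 v) k u
  unfold fborder borderInt
  congr 1; ext n; congr 2; ext x
  rw [borderDet_row, borderDet_row, ← Matrix.det_transpose]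
  rfl

theorem transpose_mul (a b : Ker w) : (a * b).transpose = b.transpose * a.transpose :=
  ext' fun u v => by
    change ∫ s, a.1 v s * b.1 s u ∂ν = ∫ s, b.1 s u * a.1 v s ∂ν
    simp only [mul_comm]

/-- Transposition preserves the determinant, commutes with taking the minor and reverses products,
so this follows from `minor_eq` for the transposed kernel. -/
theorem minor_eq' (k : Ker w) : k.minor = k.fdet • k + k.minor * k := by
  have h := congrArg transpose k.transpose.minor_eq
  rw [minor_transpose, fdet_transpose] at h
  refine h.trans ?_
  change k.fdet • k + (k.transpose * k.minor.transpose).transpose = _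
  rw [transpose_mul]
  rfl

/-- The terms with `n ≥ 1` carry `q^n ≤ q`. Applied with `q = exp(-ηξ)`, this gives the limit `1` of
the determinant. -/
theorem fdet_sub_one_bound (k : Ker w) {C q : ℝ} (hC0 : 0 ≤ C) (hq0 : 0 ≤ q) (hq1 : q ≤ 1)
    (hC : ∀ u v, ‖k.1 u v‖ ≤ q * C * (w.P u * w.P v)) :
    ‖k.fdet - 1‖ ≤ q * ∑' n : ℕ, hadamardConst n / n.factorial * (C * ∫ s, w.P s ^ 2 ∂ν) ^ n := by
  have hI := integral_sq_nonneg w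
  have hs := summable_hadamardConst _ (mul_nonneg hC0 hI)
  have hs1 := (summable_nat_add_iff 1).2 hs
  rw [fdet, k.summable_minorInt.tsum_eq_zero_add, minorInt_zero]
  have h0 : altCoeff 0 = 1 := by simp [altCoeff]
  rw [h0, mul_one, add_sub_cancel_left]
  refine (tsum_of_norm_bounded (hs1.mul_left q).hasSum fun n => ?_).trans ?_
  · refine (k.norm_altCoeff_mul_minorInt_le (mul_nonneg hq0 hC0) hC (n + 1)).trans ?_
    have h1 : q ^ (n + 1) ≤ q := pow_le_of_le_one hq0 hq1 n.succ_ne_zero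
    have h2 := hadamardConst_nonneg (n + 1)
    rw [mul_assoc q, mul_pow q]
    calc _ ≤ hadamardConst (n + 1) / (n + 1).factorial *
          (q * (C * ∫ s, w.P s ^ 2 ∂ν) ^ (n + 1)) := by gcongr
      _ = _ := by ring
  · rw [tsum_mul_left]
    refine mul_le_mul_of_nonneg_left ?_ hq0
    rw [hs.tsum_eq_zero_add]
    have := hadamardConst_nonneg 0
    simp only [Nat.factorial_zero, Nat.cast_one, div_one, pow_zero, mul_one]
    linarith

end Ker

/-! ### Derivative of the Fredholm determinant with respect to a parameter -/

theorem det_updateRow_eq {n : ℕ} (M : Matrix (Fin n) (Fin n) ℂ) (i : Fin n) (r : Fin n → ℂ) :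
    (M.updateRow i r).det = ∑ σ : Equiv.Perm (Fin n), Equiv.Perm.sign σ •
      ((∏ j ∈ Finset.univ.erase i, M j (σ j)) * r (σ i)) := by
  rw [← Matrix.det_transpose, Matrix.det_apply]
  refine Finset.sum_congr rfl fun σ _ => ?_
  congr 1
  rw [← Finset.prod_erase_mul _ _ (Finset.mem_univ i)]
  simp only [Matrix.transpose_apply, Matrix.updateRow_self]
  congr 1
  refine Finset.prod_congr rfl fun j hj => ?_
  rw [Matrix.updateRow_ne (Finset.ne_of_mem_erase hj)]

/-- The product rule in the Leibniz formula, regrouped by the row that is differentiated. -/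
theorem hasDerivAt_det {n : ℕ} {M : ℝ → Matrix (Fin n) (Fin n) ℂ} {M' : Matrix (Fin n) (Fin n) ℂ}
    {ξ : ℝ} (h : ∀ i j, HasDerivAt (fun ξ => M ξ i j) (M' i j) ξ) :
    HasDerivAt (fun ξ => (M ξ).det) (∑ i, ((M ξ).updateRow i (M' i)).det) ξ := by
  have h1 : ∀ ξ, (M ξ).det = ∑ σ : Equiv.Perm (Fin n), Equiv.Perm.sign σ • ∏ j, M ξ j (σ j) := by
    intro ξ
    rw [← Matrix.det_transpose, Matrix.det_apply]
    rfl
  simp_rw [h1, det_updateRow_eq]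
  rw [Finset.sum_comm]
  refine HasDerivAt.fun_sum fun σ _ => ?_
  rw [← Finset.smul_sum]
  simp only [Units.smul_def, zsmul_eq_mul]
  refine HasDerivAt.const_mul _ ?_
  simpa using HasDerivAt.fun_finsetProd (u := Finset.univ) (fun j _ => h j (σ j))

namespace Ker

variable {X : Type*} [MeasurableSpace X] {ν : Measure X} {w : Weight ν}

/-- The determinant of `k(x_i, x_j)` with the row `i` taken from the kernel `l`. -/
def rowDet (l k : Ker w) {n : ℕ} (i : Fin n) (x : Fin n → X) : ℂ :=
  ((Matrix.of fun i j => k.1 (x i) (x j)).updateRow i fun j => l.1 (x i) (x j)).det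

theorem norm_rowDet_le (l k : Ker w) {C : ℝ} (hC0 : 0 ≤ C)
    (hl : ∀ u v, ‖l.1 u v‖ ≤ C * (w.P u * w.P v)) (hk : ∀ u v, ‖k.1 u v‖ ≤ C * (w.P u * w.P v))
    {n : ℕ} (i : Fin n) (x : Fin n → X) :
    ‖rowDet l k i x‖ ≤ hadamardConst n * C ^ n * ∏ i, w.P (x i) ^ 2 := by
  refine (norm_det_le _ (fun i => C * w.P (x i)) (fun j => w.P (x j))
    (fun i => mul_nonneg hC0 (w.nonneg _)) (fun j => w.nonneg _) fun a j => ?_).trans_eq ?_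
  · rw [mul_assoc]
    by_cases h : a = i
    · subst h
      rw [Matrix.updateRow_self]
      exact hl _ _
    · rw [Matrix.updateRow_ne h]
      exact hk _ _
  · rw [Finset.prod_mul_distrib, Finset.prod_pow]
    simp only [Finset.prod_const, Finset.card_univ, Fintype.card_fin]
    ring

theorem measurable_rowDet (l k : Ker w) {n : ℕ} (i : Fin n) :
    Measurable fun x : Fin n → X => rowDet l k i x := by
  refine measurable_det fun a j => ?_
  by_cases h : a = i
  · subst h
    simp only [Matrix.updateRow_self]
    exact l.measurable_comp₂ (measurable_pi_apply _) (measurable_pi_apply _)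
  · simp only [Matrix.updateRow_ne h]
    exact k.measurable_comp₂ (measurable_pi_apply _) (measurable_pi_apply _)

/-- Row `i` and column `i` move to the front together, so the two signs cancel. In particular the
integral does not depend on `i`. -/
theorem rowDet_insertNth (l k : Ker w) {n : ℕ} (i : Fin (n + 1)) (s : X) (x : Fin n → X) :
    rowDet l k i (i.insertNth s x : Fin (n + 1) → X) = borderDet (l.1 s) k s x := by
  unfold rowDet borderDet
  rw [← Matrix.det_submatrix_equiv_self i.cycleRange.symm]
  congr 1
  ext a b
  simp only [Matrix.submatrix_apply, Matrix.of_apply]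
  refine Fin.cases ?_ (fun a => ?_) a
  · rw [Fin.cycleRange_symm_zero, Matrix.updateRow_self, Fin.insertNth_apply_cycleRange_symm]
    simp
  · rw [Fin.cycleRange_symm_succ, Matrix.updateRow_ne (Fin.succAbove_ne i a), Matrix.of_apply,
      Fin.insertNth_apply_cycleRange_symm]
    simp

variable [SigmaFinite ν]

theorem integral_rowDet (l k : Ker w) {n : ℕ} (i : Fin (n + 1)) :
    ∫ x, rowDet l k i x ∂(Measure.pi fun _ => ν) = ∫ s, borderInt (l.1 s) k s n ∂ν := by
  obtain ⟨C, hC0, hC⟩ := l.exists_bound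
  have h : Integrable (fun z : X × (Fin n → X) => borderDet (l.1 z.1) k z.1 z.2)
      (ν.prod (Measure.pi fun _ => ν)) := by
    have := k.integrable_prod_borderDet (n := n) (ρ := l.1) (v := id) l.measurable_uncurry
      measurable_id hC0 (fun s t => by rw [mul_assoc]; exact hC s t) (c := fun _ => 1)
      measurable_const (C := 1) (by simp)
    simpa using this
  rw [integral_pi_succ i]
  simp only [rowDet_insertNth]
  rw [integral_prod _ h]
  rfl

theorem integral_fborder_diag (l k : Ker w) :
    ∑' n, altCoeff n * ∫ s, borderInt (l.1 s) k s n ∂ν = k.fdet * tr l + tr (l * k.minor) := by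
  obtain ⟨C, hC0, hC⟩ := k.exists_bound
  obtain ⟨D, hD0, hD⟩ := l.exists_bound
  have hrow : ∀ u s, ‖l.1 u s‖ ≤ D * w.P u * w.P s := fun u s => by rw [mul_assoc]; exact hD u s
  rw [tsum_mul_integral_eq (F := fun n s => borderInt (l.1 s) k s n) (c := altCoeff)
      (b := fun n => hadamardConst (n + 1) * (C * ∫ s, w.P s ^ 2 ∂ν) ^ n * D)
      (Q := fun s => w.P s ^ 2)]
  · have h : ∀ s, ∑' n, altCoeff n * borderInt (l.1 s) k s n =
        k.fdet * l.1 s s + (l * k.minor).1 s s := fun s => by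
      have := k.fborder_eq (l.measurable_row s) (mul_nonneg hD0 (w.nonneg s)) (hrow s) s
      rw [mul_comm k.fdet]
      exact this
    simp_rw [h]
    rw [integral_add (l.integrable_diag.const_mul _) (l * k.minor).integrable_diag,
      integral_const_mul]
    rfl
  · exact fun n => k.measurable_borderInt l.measurable_uncurry measurable_id
  · exact w.sq
  · intro n s
    refine (k.norm_borderInt_le hC0 hC (mul_nonneg hD0 (w.nonneg s)) (hrow s) s n).trans_eq ?_
    ring
  · refine ((summable_hadamardConst_succ _ (mul_nonneg hC0 (integral_sq_nonneg w))).mul_right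
      D).congr fun n => ?_
    rw [norm_altCoeff]
    ring

section Family

variable {k k' : ℝ → Ker w} {C : ℝ}

theorem hasDerivAt_minorInt (hC0 : 0 ≤ C)
    (hk : ∀ ξ, 0 < ξ → ∀ u v, ‖(k ξ).1 u v‖ ≤ C * (w.P u * w.P v))
    (hk' : ∀ ξ, 0 < ξ → ∀ u v, ‖(k' ξ).1 u v‖ ≤ C * (w.P u * w.P v))
    (hd : ∀ ξ, 0 < ξ → ∀ u v, HasDerivAt (fun ξ => (k ξ).1 u v) ((k' ξ).1 u v) ξ)
    {ξ : ℝ} (hξ : 0 < ξ) (n : ℕ) :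
    HasDerivAt (fun ξ => (k ξ).minorInt n)
      (∫ x, ∑ i : Fin n, rowDet (k' ξ) (k ξ) i x ∂(Measure.pi fun _ => ν)) ξ := by
  have hm : AEStronglyMeasurable (fun x => ∑ i : Fin n, rowDet (k' ξ) (k ξ) i x)
      (Measure.pi fun _ => ν) :=
    (Finset.measurable_sum _ fun i _ => measurable_rowDet _ _ i).aestronglyMeasurable
  have hm0 : ∀ᶠ ξ in 𝓝 ξ, AEStronglyMeasurable (fun x : Fin n → X => (k ξ).minorDet x)
      (Measure.pi fun _ => ν) :=
    Eventually.of_forall fun ξ => (k ξ).measurable_minorDet.aestronglyMeasurable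
  have hb : ∀ (x : Fin n → X), ∀ ξ ∈ Set.Ioi (0 : ℝ), ‖∑ i : Fin n, rowDet (k' ξ) (k ξ) i x‖ ≤
      (n : ℝ) * (hadamardConst n * C ^ n * ∏ i, w.P (x i) ^ 2) := fun x ξ hξ => by
    refine (norm_sum_le_of_le _ fun i _ =>
      norm_rowDet_le (k' ξ) (k ξ) hC0 (hk' ξ hξ) (hk ξ hξ) i x).trans_eq ?_
    simp
  have hdiff : ∀ (x : Fin n → X), ∀ ξ ∈ Set.Ioi (0 : ℝ), HasDerivAt (fun ξ => (k ξ).minorDet x)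
      (∑ i : Fin n, rowDet (k' ξ) (k ξ) i x) ξ := fun x ξ hξ =>
    hasDerivAt_det (M := fun ξ => Matrix.of fun i j => (k ξ).1 (x i) (x j))
      (M' := Matrix.of fun i j => (k' ξ).1 (x i) (x j)) fun i j => hd ξ hξ _ _
  have hint := ((integrable_prod_weight w n).const_mul (hadamardConst n * C ^ n)).const_mul (n : ℝ)
  exact (hasDerivAt_integral_of_dominated_loc_of_deriv_le (Ioi_mem_nhds hξ) hm0
    ((k ξ).integrable_minorDet n) hm (Eventually.of_forall hb) hint (Eventually.of_forall hdiff)).2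

theorem norm_integral_sum_rowDet_le (hC0 : 0 ≤ C) {l k : Ker w}
    (hl : ∀ u v, ‖l.1 u v‖ ≤ C * (w.P u * w.P v)) (hk : ∀ u v, ‖k.1 u v‖ ≤ C * (w.P u * w.P v))
    (n : ℕ) : ‖∫ x, ∑ i : Fin n, rowDet l k i x ∂(Measure.pi fun _ => ν)‖ ≤
      n * (hadamardConst n * (C * ∫ s, w.P s ^ 2 ∂ν) ^ n) := by
  refine (norm_integral_le_of_norm_le
    (((integrable_prod_weight w n).const_mul (hadamardConst n * C ^ n)).const_mul (n : ℝ))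
    (Eventually.of_forall fun x => ?_)).trans_eq ?_
  · refine (norm_sum_le_of_le _ fun i _ => norm_rowDet_le l k hC0 hl hk i x).trans_eq ?_
    simp
  · rw [integral_const_mul, integral_const_mul, integral_prod_weight, mul_pow]
    ring

/-- Jacobi's formula: where the determinant is nonzero, division by it turns the right side into
`-tr(k' (1 - k)⁻¹)`. -/
theorem hasDerivAt_fdet (hC0 : 0 ≤ C)
    (hk : ∀ ξ, 0 < ξ → ∀ u v, ‖(k ξ).1 u v‖ ≤ C * (w.P u * w.P v))
    (hk' : ∀ ξ, 0 < ξ → ∀ u v, ‖(k' ξ).1 u v‖ ≤ C * (w.P u * w.P v))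
    (hd : ∀ ξ, 0 < ξ → ∀ u v, HasDerivAt (fun ξ => (k ξ).1 u v) ((k' ξ).1 u v) ξ)
    {ξ : ℝ} (hξ : 0 < ξ) :
    HasDerivAt (fun ξ => (k ξ).fdet)
      (-((k ξ).fdet * tr (k' ξ) + tr (k' ξ * (k ξ).minor))) ξ := by
  have hI := mul_nonneg hC0 (integral_sq_nonneg w)
  -- The factor `n` counts the rows that can be differentiated; it is at most `2^n`.
  have hsum : Summable fun n : ℕ =>
      1 / (n.factorial : ℝ) * (n * (hadamardConst n * (C * ∫ s, w.P s ^ 2 ∂ν) ^ n)) := by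
    refine Summable.of_nonneg_of_le (fun n => ?_) (fun n => ?_)
      (summable_hadamardConst (2 * (C * ∫ s, w.P s ^ 2 ∂ν)) (mul_nonneg zero_le_two hI))
    · have := hadamardConst_nonneg n
      positivity
    · have h0 := hadamardConst_nonneg n
      have h2 : (n : ℝ) ≤ 2 ^ n := by exact_mod_cast (Nat.lt_two_pow_self (n := n)).le
      rw [mul_pow 2]
      calc _ ≤ 1 / (n.factorial : ℝ) *
            (2 ^ n * (hadamardConst n * (C * ∫ s, w.P s ^ 2 ∂ν) ^ n)) := by gcongr
        _ = _ := by ring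
  have h := hasDerivAt_tsum_of_isPreconnected (t := Set.Ioi (0 : ℝ)) (y₀ := ξ) (y := ξ)
    (g := fun n ξ => altCoeff n * (k ξ).minorInt n)
    (g' := fun n ξ => altCoeff n *
      ∫ x, ∑ i : Fin n, rowDet (k' ξ) (k ξ) i x ∂(Measure.pi fun _ => ν)) hsum isOpen_Ioi
    isPreconnected_Ioi (fun n y hy => (hasDerivAt_minorInt hC0 hk hk' hd hy n).const_mul _)
    (fun n y hy => ?_) hξ (k ξ).summable_minorInt hξ
  · refine h.congr_deriv ?_
    have hs : Summable fun n : ℕ => altCoeff n *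
        ∫ x, ∑ i : Fin n, rowDet (k' ξ) (k ξ) i x ∂(Measure.pi fun _ => ν) := by
      refine Summable.of_norm_bounded hsum fun n => ?_
      rw [norm_mul, norm_altCoeff]
      exact mul_le_mul_of_nonneg_left
        (norm_integral_sum_rowDet_le hC0 (hk' ξ hξ) (hk ξ hξ) n) (by positivity)
    -- The empty determinant has no row to differentiate. For size `n + 1` there are `n + 1` equal
    -- integrals, and `altCoeff_succ` removes this factor with a change of sign.
    rw [hs.tsum_eq_zero_add, ← integral_fborder_diag, ← tsum_neg]
    simp only [Finset.univ_eq_empty, Finset.sum_empty, integral_zero, mul_zero, zero_add]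
    refine tsum_congr fun n => ?_
    have hi : ∀ i ∈ (Finset.univ : Finset (Fin (n + 1))), Integrable
        (fun x => rowDet (k' ξ) (k ξ) i x) (Measure.pi fun _ => ν) := fun i _ =>
      ((integrable_prod_weight w (n + 1)).const_mul _).mono'
        (measurable_rowDet _ _ i).aestronglyMeasurable
        (Eventually.of_forall fun x => norm_rowDet_le _ _ hC0 (hk' ξ hξ) (hk ξ hξ) i x)
    rw [integral_finsetSum _ hi]
    simp only [integral_rowDet, Finset.sum_const, Finset.card_univ, Fintype.card_fin, nsmul_eq_mul]
    push_cast
    linear_combination (∫ s, borderInt ((k' ξ).1 s) (k ξ) s n ∂ν) * altCoeff_succ n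
  · rw [norm_mul, norm_altCoeff]
    exact mul_le_mul_of_nonneg_left
      (norm_integral_sum_rowDet_le hC0 (hk' y hy) (hk y hy) n) (by positivity)

theorem continuousOn_fdet (hC0 : 0 ≤ C)
    (hk : ∀ ξ, 0 ≤ ξ → ∀ u v, ‖(k ξ).1 u v‖ ≤ C * (w.P u * w.P v))
    (hc : ∀ u v, ContinuousOn (fun ξ => (k ξ).1 u v) (Set.Ici 0)) :
    ContinuousOn (fun ξ => (k ξ).fdet) (Set.Ici 0) := by
  have hI := mul_nonneg hC0 (integral_sq_nonneg w)
  refine continuousOn_tsum (fun n => ?_) (summable_hadamardConst _ hI)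
    fun n ξ hξ => (k ξ).norm_altCoeff_mul_minorInt_le hC0 (hk ξ hξ) n
  refine continuousOn_const.mul ?_
  refine continuousOn_of_dominated (F := fun ξ x => (k ξ).minorDet x)
    (bound := fun x => hadamardConst n * C ^ n * ∏ i, w.P (x i) ^ 2)
    (fun ξ _ => (k ξ).measurable_minorDet.aestronglyMeasurable)
    (fun ξ hξ => Eventually.of_forall fun x => (k ξ).norm_minorDet_le hC0 (hk ξ hξ) x)
    ((integrable_prod_weight w n).const_mul _) (Eventually.of_forall fun x => ?_)
  unfold minorDet
  simp only [Matrix.det_apply]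
  refine continuousOn_finsetSum _ fun σ _ => ContinuousOn.const_smul ?_ _
  exact continuousOn_finsetProd _ fun i _ => hc _ _

end Family

end Ker

/-! ### Integration of a logarithmic derivative -/

/-- With `L` the primitive of `D'/D`, the function `D exp(-L)` is constant. No global logarithm of
`D` is required: to the right of each `x` the quotient `D(y)/D(x)` stays near `1`, where the
principal logarithm is a primitive. As `D'/D` is only integrable, constancy is deduced from
continuity and a vanishing right derivative. -/
theorem eq_exp_neg_integral_logDeriv {D D' : ℝ → ℂ} (hc : ContinuousOn D (Set.Ici 0))
    (hd : ∀ ξ, 0 < ξ → HasDerivAt D (D' ξ) ξ) (hne : ∀ ξ, 0 ≤ ξ → D ξ ≠ 0)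
    (hint : IntegrableOn (fun ξ => D' ξ / D ξ) (Set.Ioi 0)) (hlim : Tendsto D atTop (𝓝 1)) :
    D 0 = Complex.exp (-∫ ξ in Set.Ioi (0 : ℝ), D' ξ / D ξ) := by
  have hii : ∀ a b, 0 ≤ a → a ≤ b → IntervalIntegrable (fun ξ => D' ξ / D ξ) volume a b := by
    intro a b ha hab
    rw [intervalIntegrable_iff_integrableOn_Ioc_of_le hab]
    exact hint.mono_set fun ξ hξ => lt_of_le_of_lt ha hξ.1
  let L : ℝ → ℂ := fun ξ => ∫ s in (0 : ℝ)..ξ, D' s / D s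
  let E : ℝ → ℂ := fun ξ => D ξ * Complex.exp (-L ξ)
  have hlocal : ∀ x, 0 ≤ x → ∀ᶠ y in 𝓝[Set.Ici x] x, E y = E x := by
    intro x hx
    have hcx : ContinuousWithinAt (fun y => D y / D x) (Set.Ici x) x :=
      ((hc x hx).mono (Set.Ici_subset_Ici.2 hx)).div_const _
    have hev : ∀ᶠ y in 𝓝[Set.Ici x] x, D y / D x ∈ Complex.slitPlane := by
      refine hcx.eventually_mem (Complex.isOpen_slitPlane.mem_nhds ?_)
      simp only [div_self (hne x hx)]
      exact Complex.one_mem_slitPlane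
    obtain ⟨ε, hε, hball⟩ := Metric.mem_nhdsWithin_iff.1 hev
    filter_upwards [inter_mem_nhdsWithin _ (Metric.ball_mem_nhds x hε)] with y hy
    have hxy : x ≤ y := hy.1
    have hslit : ∀ s ∈ Set.Icc x y, D s / D x ∈ Complex.slitPlane := by
      intro s hs
      refine hball ⟨?_, hs.1⟩
      have h1 := hy.2
      rw [Metric.mem_ball, Real.dist_eq, abs_of_nonneg (by linarith)] at h1
      rw [Metric.mem_ball, Real.dist_eq, abs_of_nonneg (by linarith [hs.1])]
      linarith [hs.2]
    have hFTC := intervalIntegral.integral_eq_sub_of_hasDerivAt_of_le hxy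
      (f := fun s => Complex.log (D s / D x)) (f' := fun s => D' s / D s)
      (fun s hs => ContinuousWithinAt.clog
        (((hc s (hx.trans hs.1)).mono fun r hr => hx.trans hr.1).div_const _) (hslit s hs))
      (fun s hs => by
        have hs0 : 0 < s := lt_of_le_of_lt hx hs.1
        have h := ((hd s hs0).div_const (D x)).clog_real (hslit s ⟨hs.1.le, hs.2.le⟩)
        refine h.congr_deriv ?_
        have h1 := hne x hx
        have h2 := hne s hs0.le
        field_simp) (hii x y hx hxy)
    simp only [div_self (hne x hx), Complex.log_one, sub_zero] at hFTC
    have hL : L y = L x + Complex.log (D y / D x) := by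
      rw [← hFTC]
      exact (intervalIntegral.integral_add_adjacent_intervals (hii 0 x le_rfl hx)
        (hii x y hx hxy)).symm
    simp only [E, hL]
    have h1 := hne x hx
    have h2 := hne y (hx.trans hxy)
    rw [neg_add, Complex.exp_add, Complex.exp_neg (Complex.log _),
      Complex.exp_log (div_ne_zero h2 h1)]
    field_simp
  have hLc : ContinuousOn L (Set.Ici 0) := by
    intro x hx
    have h1 : ContinuousOn L (Set.uIcc 0 (x + 1)) := by
      have hx1 : (0 : ℝ) ≤ x + 1 := by linarith [Set.mem_Ici.1 hx]
      refine intervalIntegral.continuousOn_primitive_interval ?_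
      rw [Set.uIcc_of_le hx1, integrableOn_Icc_iff_integrableOn_Ioc]
      exact hint.mono_set fun ξ hξ => hξ.1
    rw [Set.uIcc_of_le (by linarith [Set.mem_Ici.1 hx])] at h1
    refine (h1 x ⟨hx, by linarith⟩).mono_of_mem_nhdsWithin ?_
    filter_upwards [inter_mem_nhdsWithin _ (Iio_mem_nhds (show x < x + 1 by linarith))] with y hy
    exact ⟨hy.1, hy.2.le⟩
  have hEc : ContinuousOn E (Set.Ici 0) :=
    hc.mul (Complex.continuous_exp.comp_continuousOn hLc.neg)
  have hconst : ∀ T, 0 ≤ T → E T = E 0 := by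
    intro T hT
    refine constant_of_has_deriv_right_zero (a := 0) (b := T)
      (hEc.mono fun s hs => hs.1) (fun x hx => ?_) T ⟨hT, le_rfl⟩
    exact (hasDerivWithinAt_const x (Set.Ici x) (E x)).congr_of_eventuallyEq (hlocal x hx.1) rfl
  have hE0 : E 0 = D 0 := by simp [E, L]
  have hLlim : Tendsto L atTop (𝓝 (∫ ξ in Set.Ioi (0 : ℝ), D' ξ / D ξ)) :=
    intervalIntegral_tendsto_integral_Ioi 0 hint tendsto_id
  have hElim : Tendsto E atTop (𝓝 (1 * Complex.exp (-∫ ξ in Set.Ioi (0 : ℝ), D' ξ / D ξ))) :=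
    hlim.mul ((Complex.continuous_exp.tendsto _).comp hLlim.neg)
  have hE1 : Tendsto E atTop (𝓝 (D 0)) := by
    refine tendsto_const_nhds.congr' ?_
    filter_upwards [eventually_ge_atTop 0] with T hT
    rw [hconst T hT, hE0]
  rw [tendsto_nhds_unique hE1 hElim, one_mul]

/-- Near infinity `|D| > 1/2`; on the remaining compact interval the minimum is attained and
positive. -/
theorem exists_norm_lower_bound {D : ℝ → ℂ} (hc : ContinuousOn D (Set.Ici 0))
    (hne : ∀ ξ, 0 ≤ ξ → D ξ ≠ 0) (hlim : Tendsto D atTop (𝓝 1)) :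
    ∃ c, 0 < c ∧ ∀ ξ, 0 ≤ ξ → c ≤ ‖D ξ‖ := by
  have h1 : ∀ᶠ ξ in atTop, 1 / 2 < ‖D ξ‖ :=
    hlim.norm.eventually_const_lt (by simp; norm_num)
  obtain ⟨T, hT⟩ := eventually_atTop.1 h1
  obtain ⟨ξ₀, h0, hmin⟩ := isCompact_Icc.exists_isMinOn (s := Set.Icc (0 : ℝ) (max T 0))
    ⟨0, le_rfl, le_max_right _ _⟩ (hc.mono fun s hs => hs.1).norm
  refine ⟨min (1 / 2) ‖D ξ₀‖, lt_min (by norm_num) (norm_pos_iff.2 (hne _ h0.1)), fun ξ hξ => ?_⟩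
  rcases le_total ξ (max T 0) with h | h
  · exact (min_le_right _ _).trans (hmin ⟨hξ, h⟩)
  · exact (min_le_left _ _).trans (hT ξ ((le_max_left _ _).trans h)).le

theorem integrableOn_logDeriv {D D' : ℝ → ℂ} (hc : ContinuousOn D (Set.Ici 0))
    (hd : ∀ ξ, 0 < ξ → HasDerivAt D (D' ξ) ξ) (hne : ∀ ξ, 0 ≤ ξ → D ξ ≠ 0)
    (hlim : Tendsto D atTop (𝓝 1)) {K η : ℝ} (hη : 0 < η)
    (hb : ∀ ξ, 0 < ξ → ‖D' ξ‖ ≤ K * Real.exp (-η * ξ)) :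
    IntegrableOn (fun ξ => D' ξ / D ξ) (Set.Ioi 0) := by
  obtain ⟨c, hc0, hcb⟩ := exists_norm_lower_bound hc hne hlim
  have hexp : IntegrableOn (fun ξ => K / c * Real.exp (-η * ξ)) (Set.Ioi 0) :=
    (integrableOn_exp_mul_Ioi (neg_lt_zero.2 hη) 0).const_mul _
  refine Integrable.mono' hexp ?_ ?_
  · have h1 : AEStronglyMeasurable D' (volume.restrict (Set.Ioi 0)) := by
      -- Measurability of `D'` is not assumed; it comes from the agreement with `deriv D` on `(0,
      -- ∞)`.
      refine (stronglyMeasurable_deriv D).aestronglyMeasurable.congr ?_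
      exact (ae_restrict_mem measurableSet_Ioi).mono fun ξ hξ => (hd ξ hξ).deriv
    have h2 : ContinuousOn (fun ξ => (D ξ)⁻¹) (Set.Ioi 0) :=
      (hc.mono Set.Ioi_subset_Ici_self).inv₀ fun ξ hξ => hne ξ (Set.mem_Ioi.1 hξ).le
    simp only [div_eq_mul_inv]
    exact h1.mul (h2.aestronglyMeasurable measurableSet_Ioi)
  · refine (ae_restrict_mem measurableSet_Ioi).mono fun ξ hξ => ?_
    have h0 : 0 < ξ := hξ
    rw [norm_div, div_mul_eq_mul_div]
    have h1 := hcb ξ h0.le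
    have h2 := hb ξ h0
    exact div_le_div₀ ((norm_nonneg _).trans h2) h2 hc0 h1

namespace Ker

variable {X : Type*} [MeasurableSpace X] {ν : Measure X} {w : Weight ν}

/-! ### The resolvent of a kernel with off-diagonal block structure -/

section Algebra

variable [SFinite ν]

/-- If `a² = b² = 0` and `1 + R` is the inverse of `1 - a b`, then `1 + offResolvent a b R` is the
inverse of `1 - (a + b)`. -/
def offResolvent (a b R : Ker w) : Ker w := a + b + R + b * R + R * a + b * a + b * R * a

variable {a b R a' b' : Ker w}

/-- The inverse is `(1 + b)(1 + R)(1 + a)`, whose expansion is `1 + offResolvent a b R`. Block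
elimination shows this: `(1 - a - b)(1 + b) = 1 - a - ab` since `b² = 0`, then `(1 - ab - a)(1 + R)
= 1 - a` since `aR = 0`, and `(1 - a)(1 + a) = 1` since `a² = 0`. -/
theorem add_mul_offResolvent (ha : a * a = 0) (hb : b * b = 0) (hR : R = a * b + a * b * R) :
    (a + b) + (a + b) * offResolvent a b R = offResolvent a b R := by
  -- Every term of `R` begins with `a`.
  have haR : a * R = 0 := by
    rw [hR, mul_add, ← mul_assoc, ← mul_assoc, ha, ← mul_assoc, ha]
    simp
  have h1 : a * (b * R) = R - a * b := by
    rw [← mul_assoc, eq_sub_iff_add_eq, add_comm]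
    exact hR.symm
  have e1 : (a + b) * offResolvent a b R = a * a + a * b + a * R + a * (b * R) + a * R * a +
      a * b * a + a * (b * R) * a + (b * a + b * b + b * R + b * b * R + b * R * a + b * b * a +
      b * b * R * a) := by
    unfold offResolvent
    noncomm_ring
  rw [e1, ha, hb, haR, h1, sub_mul]
  unfold offResolvent
  simp only [zero_mul, add_zero, zero_add]
  abel

theorem offResolvent_mul_add (ha : a * a = 0) (hb : b * b = 0) (hR : R = a * b + R * (a * b)) :
    (a + b) + offResolvent a b R * (a + b) = offResolvent a b R := by
  have haR : R * b = 0 := by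
    rw [hR, add_mul, mul_assoc, mul_assoc, mul_assoc, hb]
    simp
  have h1 : R * a * b = R - a * b := by
    rw [mul_assoc, eq_sub_iff_add_eq, add_comm]
    exact hR.symm
  have e1 : offResolvent a b R * (a + b) = a * a + b * a + R * a + b * R * a + R * (a * a) +
      b * (a * a) + b * R * (a * a) + (a * b + b * b + R * b + b * (R * b) + R * a * b + b * a * b +
      b * (R * a * b)) := by
    unfold offResolvent
    noncomm_ring
  rw [e1, ha, hb, haR, h1, mul_sub]
  unfold offResolvent
  simp only [mul_zero, add_zero, zero_add, mul_assoc]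
  abel

/-- The infinitesimal form of `det(1 - ab) = det(1 - a - b)`. In the expansion of the right side
only `a'b`, `a'bR`, `b'a` and `b'Ra` survive: the other products vanish, some of them only under the
trace after a cyclic permutation. -/
theorem tr_derivative_eq (ha : a * a' = 0) (ha' : a' * a = 0) (hb : b * b' = 0) (hb' : b' * b = 0)
    (hR : R = a * b + a * b * R) (hR' : R = a * b + R * (a * b)) :
    tr (a' * b + a * b') + tr ((a' * b + a * b') * R) = tr ((a' + b') * offResolvent a b R) := by
  have h1 : a' * R = 0 := by
    rw [hR, mul_add, ← mul_assoc, ← mul_assoc, ha', ← mul_assoc, ha']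
    simp
  have h2 : R * b' = 0 := by
    rw [hR', add_mul, mul_assoc, mul_assoc, mul_assoc, hb]
    simp
  have e1 : (a' + b') * offResolvent a b R = a' * a + a' * b + a' * R + a' * (b * R) + a' * R * a +
      (a' * b) * a + (a' * b * R) * a + (b' * a + b' * b + b' * R + b' * b * R + b' * (R * a) +
      b' * b * a + b' * b * R * a) := by
    unfold offResolvent
    noncomm_ring
  have e2 : (a' * b + a * b') * R = a' * (b * R) + a * (b' * R) := by noncomm_ring
  rw [e1, e2]
  simp only [ha', hb', h1, zero_mul, add_zero, zero_add, tr_add]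
  rw [tr_mul_comm (a' * b) a, tr_mul_comm (a' * b * R) a, tr_mul_comm b' R, h2,
    tr_mul_comm a b', tr_mul_comm a (b' * R)]
  have e3 : a * (a' * b) = 0 := by rw [← mul_assoc, ha, zero_mul]
  have e4 : a * (a' * b * R) = 0 := by rw [← mul_assoc, e3, zero_mul]
  rw [e3, e4, tr_zero, mul_assoc]
  ring

/-- The operator inverse of `1 - a - b`. -/
theorem one_sub_op_mul {H Q : Ker w} (h : H + H * Q = Q) : (1 - H.op) * (1 + Q.op) = 1 := by
  have h1 : H.op + H.op * Q.op = Q.op := by rw [← op_mul, ← op_add, h]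
  calc (1 - H.op) * (1 + Q.op) = 1 + Q.op - (H.op + H.op * Q.op) := by noncomm_ring
    _ = 1 := by rw [h1]; abel

theorem mul_one_sub_op {H Q : Ker w} (h : H + Q * H = Q) : (1 + Q.op) * (1 - H.op) = 1 := by
  have h1 : H.op + Q.op * H.op = Q.op := by rw [← op_mul, ← op_add, h]
  calc (1 + Q.op) * (1 - H.op) = 1 + Q.op - (H.op + Q.op * H.op) := by noncomm_ring
    _ = 1 := by rw [h1]; abel

end Algebra

/-! ### Families of kernels -/

variable [SigmaFinite ν]

/-- The resolvent kernel `(1 - k)⁻¹ - 1`, for `det(1 - k) ≠ 0`. -/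
def resolvent (k : Ker w) : Ker w := k.fdet⁻¹ • k.minor

theorem resolvent_eq (k : Ker w) (h : k.fdet ≠ 0) : k.resolvent = k + k * k.resolvent := by
  unfold resolvent
  conv_lhs => rw [minor_eq]
  rw [smul_add, smul_smul, inv_mul_cancel₀ h, one_smul, mul_smul']

theorem resolvent_eq' (k : Ker w) (h : k.fdet ≠ 0) : k.resolvent = k + k.resolvent * k := by
  unfold resolvent
  conv_lhs => rw [minor_eq']
  rw [smul_add, smul_smul, inv_mul_cancel₀ h, one_smul, smul_mul]

theorem norm_mul_le (a b : Ker w) {A B : ℝ} (hA : ∀ u v, ‖a.1 u v‖ ≤ A * (w.P u * w.P v))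
    (hB : ∀ u v, ‖b.1 u v‖ ≤ B * (w.P u * w.P v)) (u v : X) :
    ‖(a * b).1 u v‖ ≤ A * B * (∫ s, w.P s ^ 2 ∂ν) * (w.P u * w.P v) := by
  rw [mul_apply]
  refine (norm_integral_le_of_norm_le (w.sq.const_mul (A * B * (w.P u * w.P v)))
    (Eventually.of_forall fun s => ?_)).trans_eq ?_
  · rw [norm_mul]
    calc _ ≤ (A * (w.P u * w.P s)) * (B * (w.P s * w.P v)) :=
          mul_le_mul (hA _ _) (hB _ _) (norm_nonneg _) ((norm_nonneg _).trans (hA _ _))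
      _ = _ := by ring
  · rw [integral_const_mul]
    ring

theorem norm_tr_le (a : Ker w) {A : ℝ} (hA : ∀ u v, ‖a.1 u v‖ ≤ A * (w.P u * w.P v)) :
    ‖tr a‖ ≤ A * ∫ s, w.P s ^ 2 ∂ν := by
  refine (norm_integral_le_of_norm_le (w.sq.const_mul A)
    (Eventually.of_forall fun s => ?_)).trans_eq (integral_const_mul _ _)
  rw [pow_two]
  exact hA s s

/-- A pair of families of kernels which depend differentiably on a parameter and decay
exponentially. -/
structure DecayingPair (a b a' b' : ℝ → Ker w) (C η : ℝ) : Prop where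
  C_nonneg : 0 ≤ C
  η_pos : 0 < η
  bound_a : ∀ ξ, 0 ≤ ξ → ∀ u v, ‖(a ξ).1 u v‖ ≤ C * Real.exp (-η * ξ) * (w.P u * w.P v)
  bound_b : ∀ ξ, 0 ≤ ξ → ∀ u v, ‖(b ξ).1 u v‖ ≤ C * Real.exp (-η * ξ) * (w.P u * w.P v)
  bound_a' : ∀ ξ, 0 ≤ ξ → ∀ u v, ‖(a' ξ).1 u v‖ ≤ C * Real.exp (-η * ξ) * (w.P u * w.P v)
  bound_b' : ∀ ξ, 0 ≤ ξ → ∀ u v, ‖(b' ξ).1 u v‖ ≤ C * Real.exp (-η * ξ) * (w.P u * w.P v)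
  cont_a : ∀ u v, ContinuousOn (fun ξ => (a ξ).1 u v) (Set.Ici 0)
  cont_b : ∀ u v, ContinuousOn (fun ξ => (b ξ).1 u v) (Set.Ici 0)
  deriv_a : ∀ ξ, 0 < ξ → ∀ u v, HasDerivAt (fun ξ => (a ξ).1 u v) ((a' ξ).1 u v) ξ
  deriv_b : ∀ ξ, 0 < ξ → ∀ u v, HasDerivAt (fun ξ => (b ξ).1 u v) ((b' ξ).1 u v) ξ

/-! ### Determinants of exponentially decaying families -/

namespace DecayingPair

variable {a b a' b' : ℝ → Ker w} {C η : ℝ} (h : DecayingPair a b a' b' C η)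

include h

theorem exp_le_one {ξ : ℝ} (hξ : 0 ≤ ξ) : Real.exp (-η * ξ) ≤ 1 :=
  Real.exp_le_one_iff.2 (by nlinarith [h.η_pos])

theorem bound_mul {c d : Ker w} {ξ : ℝ} (hξ : 0 ≤ ξ)
    (hc : ∀ u v, ‖c.1 u v‖ ≤ C * Real.exp (-η * ξ) * (w.P u * w.P v))
    (hd : ∀ u v, ‖d.1 u v‖ ≤ C * Real.exp (-η * ξ) * (w.P u * w.P v)) (u v : X) :
    ‖(c * d).1 u v‖ ≤
      Real.exp (-η * ξ) * (C * C * ∫ s, w.P s ^ 2 ∂ν) * (w.P u * w.P v) := by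
  refine (norm_mul_le c d hc hd u v).trans ?_
  have h1 := h.exp_le_one hξ
  have h2 := integral_sq_nonneg w
  have h3 := mul_nonneg (w.nonneg u) (w.nonneg v)
  have h4 := h.C_nonneg
  have h5 := Real.exp_pos (-η * ξ)
  calc _ = Real.exp (-η * ξ) * (Real.exp (-η * ξ) * (C * C * ∫ s, w.P s ^ 2 ∂ν)) *
        (w.P u * w.P v) := by ring
    _ ≤ Real.exp (-η * ξ) * (1 * (C * C * ∫ s, w.P s ^ 2 ∂ν)) * (w.P u * w.P v) := by gcongr
    _ = _ := by rw [one_mul]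

theorem bound_one {c : Ker w} {ξ : ℝ} (hξ : 0 ≤ ξ)
    (hc : ∀ u v, ‖c.1 u v‖ ≤ C * Real.exp (-η * ξ) * (w.P u * w.P v)) (u v : X) :
    ‖c.1 u v‖ ≤ C * (w.P u * w.P v) := by
  refine (hc u v).trans ?_
  have h3 := mul_nonneg (w.nonneg u) (w.nonneg v)
  have h4 := h.C_nonneg
  calc _ ≤ C * 1 * (w.P u * w.P v) := by
        gcongr
        exact h.exp_le_one hξ
    _ = _ := by rw [mul_one]

theorem norm_mul_integrand_le {c d : Ker w} {ξ : ℝ} (hξ : 0 ≤ ξ)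
    (hc : ∀ u v, ‖c.1 u v‖ ≤ C * Real.exp (-η * ξ) * (w.P u * w.P v))
    (hd : ∀ u v, ‖d.1 u v‖ ≤ C * Real.exp (-η * ξ) * (w.P u * w.P v)) (u v s : X) :
    ‖c.1 u s * d.1 s v‖ ≤ C * C * (w.P u * w.P v) * w.P s ^ 2 := by
  rw [norm_mul]
  have h1 := h.bound_one hξ hc u s
  calc _ ≤ (C * (w.P u * w.P s)) * (C * (w.P s * w.P v)) :=
        mul_le_mul h1 (h.bound_one hξ hd s v) (norm_nonneg _) ((norm_nonneg _).trans h1)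
    _ = _ := by ring

theorem continuousOn_mul (u v : X) : ContinuousOn (fun ξ => (a ξ * b ξ).1 u v) (Set.Ici 0) := by
  simp only [mul_apply]
  refine continuousOn_of_dominated (bound := fun s => C * C * (w.P u * w.P v) * w.P s ^ 2)
    (fun ξ _ => ((a ξ).integrable_mul (b ξ) u v).aestronglyMeasurable)
    (fun ξ hξ => Eventually.of_forall fun s => ?_) (w.sq.const_mul _)
    (Eventually.of_forall fun s => (h.cont_a u s).mul (h.cont_b s v))
  exact h.norm_mul_integrand_le hξ (h.bound_a ξ hξ) (h.bound_b ξ hξ) u v s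

theorem hasDerivAt_mul {ξ : ℝ} (hξ : 0 < ξ) (u v : X) :
    HasDerivAt (fun ξ => (a ξ * b ξ).1 u v) ((a' ξ * b ξ + a ξ * b' ξ).1 u v) ξ := by
  simp only [mul_apply, add_apply]
  rw [← integral_add ((a' ξ).integrable_mul (b ξ) u v) ((a ξ).integrable_mul (b' ξ) u v)]
  have hb : ∀ s, ∀ ξ ∈ Set.Ioi (0 : ℝ), ‖(a' ξ).1 u s * (b ξ).1 s v + (a ξ).1 u s * (b' ξ).1 s v‖ ≤
      2 * (C * C * (w.P u * w.P v)) * w.P s ^ 2 := fun s ξ hξ => by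
    have hξ' : 0 ≤ ξ := (Set.mem_Ioi.1 hξ).le
    refine (norm_add_le_of_le
      (h.norm_mul_integrand_le hξ' (h.bound_a' ξ hξ') (h.bound_b ξ hξ') u v s)
      (h.norm_mul_integrand_le hξ' (h.bound_a ξ hξ') (h.bound_b' ξ hξ') u v s)).trans_eq ?_
    ring
  have hm : ∀ᶠ ξ in 𝓝 ξ, AEStronglyMeasurable (fun s => (a ξ).1 u s * (b ξ).1 s v) ν :=
    Eventually.of_forall fun ξ => ((a ξ).integrable_mul (b ξ) u v).aestronglyMeasurable
  have hm' : AEStronglyMeasurable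
      (fun s => (a' ξ).1 u s * (b ξ).1 s v + (a ξ).1 u s * (b' ξ).1 s v) ν :=
    (((a' ξ).integrable_mul (b ξ) u v).add ((a ξ).integrable_mul (b' ξ) u v)).aestronglyMeasurable
  have hdiff : ∀ s, ∀ ξ ∈ Set.Ioi (0 : ℝ), HasDerivAt (fun ξ => (a ξ).1 u s * (b ξ).1 s v)
      ((a' ξ).1 u s * (b ξ).1 s v + (a ξ).1 u s * (b' ξ).1 s v) ξ := fun s ξ hξ =>
    (h.deriv_a ξ hξ u s).mul (h.deriv_b ξ hξ s v)
  exact (hasDerivAt_integral_of_dominated_loc_of_deriv_le (Ioi_mem_nhds hξ) hm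
    ((a ξ).integrable_mul (b ξ) u v) hm' (Eventually.of_forall hb) (w.sq.const_mul _)
    (Eventually.of_forall hdiff)).2

theorem bound_deriv {ξ : ℝ} (hξ : 0 ≤ ξ) (u v : X) :
    ‖(a' ξ * b ξ + a ξ * b' ξ).1 u v‖ ≤
      Real.exp (-η * ξ) * (2 * (C * C * ∫ s, w.P s ^ 2 ∂ν)) * (w.P u * w.P v) := by
  refine (norm_add_le_of_le (h.bound_mul hξ (h.bound_a' ξ hξ) (h.bound_b ξ hξ) u v)
    (h.bound_mul hξ (h.bound_a ξ hξ) (h.bound_b' ξ hξ) u v)).trans_eq ?_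
  ring

theorem bound_const {ξ : ℝ} (hξ : 0 ≤ ξ) {c : Ker w} {K : ℝ} (hK : 0 ≤ K)
    (hc : ∀ u v, ‖c.1 u v‖ ≤ Real.exp (-η * ξ) * K * (w.P u * w.P v)) (u v : X) :
    ‖c.1 u v‖ ≤ K * (w.P u * w.P v) := by
  refine (hc u v).trans ?_
  have h3 := mul_nonneg (w.nonneg u) (w.nonneg v)
  calc _ ≤ 1 * K * (w.P u * w.P v) := by
        gcongr
        exact h.exp_le_one hξ
    _ = _ := by rw [one_mul]

theorem const_nonneg : 0 ≤ C * C * ∫ s, w.P s ^ 2 ∂ν :=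
  mul_nonneg (mul_nonneg h.C_nonneg h.C_nonneg) (integral_sq_nonneg w)

theorem continuousOn_fdet_mul : ContinuousOn (fun ξ => (a ξ * b ξ).fdet) (Set.Ici 0) :=
  continuousOn_fdet h.const_nonneg (fun ξ hξ => h.bound_const hξ h.const_nonneg
    (h.bound_mul hξ (h.bound_a ξ hξ) (h.bound_b ξ hξ))) h.continuousOn_mul

theorem hasDerivAt_fdet_mul {ξ : ℝ} (hξ : 0 < ξ) :
    HasDerivAt (fun ξ => (a ξ * b ξ).fdet) (-((a ξ * b ξ).fdet * tr (a' ξ * b ξ + a ξ * b' ξ) +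
      tr ((a' ξ * b ξ + a ξ * b' ξ) * (a ξ * b ξ).minor))) ξ := by
  have hK := h.const_nonneg
  have hK2 : 0 ≤ 2 * (C * C * ∫ s, w.P s ^ 2 ∂ν) := by linarith
  refine hasDerivAt_fdet (k := fun ξ => a ξ * b ξ) (k' := fun ξ => a' ξ * b ξ + a ξ * b' ξ)
    hK2 (fun ξ hξ u v => ?_) (fun ξ hξ => h.bound_const hξ.le hK2 (h.bound_deriv hξ.le))
    (fun ξ hξ => h.hasDerivAt_mul hξ) hξ
  refine (h.bound_const hξ.le hK (h.bound_mul hξ.le (h.bound_a ξ hξ.le) (h.bound_b ξ hξ.le))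
    u v).trans ?_
  exact mul_le_mul_of_nonneg_right (by linarith) (mul_nonneg (w.nonneg u) (w.nonneg v))

theorem norm_fdet_sub_one_le {ξ : ℝ} (hξ : 0 ≤ ξ) : ‖(a ξ * b ξ).fdet - 1‖ ≤ Real.exp (-η * ξ) *
    ∑' n : ℕ, hadamardConst n / n.factorial *
      ((C * C * ∫ s, w.P s ^ 2 ∂ν) * ∫ s, w.P s ^ 2 ∂ν) ^ n :=
  fdet_sub_one_bound _ h.const_nonneg (Real.exp_pos _).le (h.exp_le_one hξ)
    (h.bound_mul hξ (h.bound_a ξ hξ) (h.bound_b ξ hξ))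

theorem tendsto_exp : Tendsto (fun ξ => Real.exp (-η * ξ)) atTop (𝓝 0) := by
  refine Real.tendsto_exp_atBot.comp ?_
  exact tendsto_id.const_mul_atTop_of_neg (neg_lt_zero.2 h.η_pos)

theorem tendsto_fdet : Tendsto (fun ξ => (a ξ * b ξ).fdet) atTop (𝓝 1) := by
  rw [tendsto_iff_norm_sub_tendsto_zero]
  have h1 := h.tendsto_exp.mul_const (∑' n : ℕ, hadamardConst n / n.factorial *
      ((C * C * ∫ s, w.P s ^ 2 ∂ν) * ∫ s, w.P s ^ 2 ∂ν) ^ n)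
  rw [zero_mul] at h1
  refine squeeze_zero' (Eventually.of_forall fun ξ => norm_nonneg _) ?_ h1
  filter_upwards [eventually_ge_atTop 0] with ξ hξ
  exact h.norm_fdet_sub_one_le hξ

theorem norm_minor_le {ξ : ℝ} (hξ : 0 ≤ ξ) (u v : X) : ‖(a ξ * b ξ).minor.1 u v‖ ≤
    minorConst (∫ s, w.P s ^ 2 ∂ν) (C * C * ∫ s, w.P s ^ 2 ∂ν) *
      (C * C * ∫ s, w.P s ^ 2 ∂ν) * (w.P u * w.P v) := by
  have hb := h.bound_const hξ h.const_nonneg (h.bound_mul hξ (h.bound_a ξ hξ) (h.bound_b ξ hξ))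
  rw [minor_apply]
  refine (norm_fborder_le _ h.const_nonneg hb (mul_nonneg h.const_nonneg (w.nonneg u))
    (fun s => by rw [mul_assoc]; exact hb u s) v).trans_eq ?_
  ring

theorem exists_bound_deriv_fdet : ∃ K, ∀ ξ, 0 < ξ →
    ‖-((a ξ * b ξ).fdet * tr (a' ξ * b ξ + a ξ * b' ξ) +
      tr ((a' ξ * b ξ + a ξ * b' ξ) * (a ξ * b ξ).minor))‖ ≤ K * Real.exp (-η * ξ) := by
  set I := ∫ s, w.P s ^ 2 ∂ν with hI
  set S := ∑' n : ℕ, hadamardConst n / n.factorial * ((C * C * I) * I) ^ n with hS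
  have hI0 : 0 ≤ I := integral_sq_nonneg w
  have hS0 : 0 ≤ S := tsum_nonneg fun n => by
    have := hadamardConst_nonneg n
    have := h.C_nonneg
    positivity
  refine ⟨(1 + S) * (2 * (C * C * I) * I) +
    (2 * (C * C * I)) * (minorConst I (C * C * I) * (C * C * I)) * I * I, fun ξ hξ => ?_⟩
  have he := Real.exp_pos (-η * ξ)
  rw [norm_neg]
  have h1 : ‖(a ξ * b ξ).fdet‖ ≤ 1 + S := by
    have h2 := h.norm_fdet_sub_one_le hξ.le
    have h3 := h.exp_le_one hξ.le
    calc ‖(a ξ * b ξ).fdet‖ = ‖1 + ((a ξ * b ξ).fdet - 1)‖ := by ring_nf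
      _ ≤ 1 + Real.exp (-η * ξ) * S := norm_add_le_of_le (by simp) h2
      _ ≤ 1 + 1 * S := by gcongr
      _ = 1 + S := by rw [one_mul]
  have h2 := norm_tr_le _ (h.bound_deriv hξ.le)
  have h3 := norm_tr_le _ (norm_mul_le _ _ (h.bound_deriv hξ.le) (h.norm_minor_le hξ.le))
  refine (norm_add_le_of_le ((norm_mul_le_of_le h1 h2)) h3).trans_eq ?_
  ring

/-- The Fredholm determinant of a decaying family is the exponential of the integral of the trace
of `H' (1 - H)⁻¹`, `H = a + b`. -/
theorem fdet_eq_exp (haa' : ∀ ξ, a ξ * a' ξ = 0) (ha'a : ∀ ξ, a' ξ * a ξ = 0)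
    (hbb' : ∀ ξ, b ξ * b' ξ = 0) (hb'b : ∀ ξ, b' ξ * b ξ = 0)
    (hne : ∀ ξ, 0 ≤ ξ → (a ξ * b ξ).fdet ≠ 0) :
    IntegrableOn (fun ξ => tr ((a' ξ + b' ξ) *
      offResolvent (a ξ) (b ξ) (a ξ * b ξ).resolvent)) (Set.Ioi 0) ∧
    (a 0 * b 0).fdet = Complex.exp (∫ ξ in Set.Ioi (0 : ℝ), tr ((a' ξ + b' ξ) *
      offResolvent (a ξ) (b ξ) (a ξ * b ξ).resolvent)) := by
  obtain ⟨K, hK⟩ := h.exists_bound_deriv_fdet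
  have hint := integrableOn_logDeriv h.continuousOn_fdet_mul (fun ξ hξ => h.hasDerivAt_fdet_mul hξ)
    hne h.tendsto_fdet h.η_pos hK
  have hexp := eq_exp_neg_integral_logDeriv h.continuousOn_fdet_mul
    (fun ξ hξ => h.hasDerivAt_fdet_mul hξ) hne hint h.tendsto_fdet
  -- Division by the determinant replaces the minor by the resolvent of `ab`; `tr_derivative_eq`
  -- then passes to the resolvent of `a + b`.
  have heq : ∀ ξ ∈ Set.Ioi (0 : ℝ), -((a ξ * b ξ).fdet * tr (a' ξ * b ξ + a ξ * b' ξ) +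
      tr ((a' ξ * b ξ + a ξ * b' ξ) * (a ξ * b ξ).minor)) / (a ξ * b ξ).fdet =
      -tr ((a' ξ + b' ξ) * offResolvent (a ξ) (b ξ) (a ξ * b ξ).resolvent) := by
    intro ξ hξ
    have h0 := hne ξ (Set.mem_Ioi.1 hξ).le
    rw [← tr_derivative_eq (haa' ξ) (ha'a ξ) (hbb' ξ) (hb'b ξ) (resolvent_eq _ h0)
      (resolvent_eq' _ h0), resolvent, mul_smul', tr_smul]
    field_simp
  constructor
  · have := (hint.congr_fun heq measurableSet_Ioi).neg
    refine this.congr_fun (fun ξ _ => ?_) measurableSet_Ioi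
    simp
  · rw [hexp, setIntegral_congr_fun measurableSet_Ioi heq, integral_neg, neg_neg]

end DecayingPair

end Ker

/-! ### Integrable kernels `∑ f_k(u) g_k(v) / (u - v)` depending on a parameter -/

/-- The weight `(1 + |u|)⁻⁴`. -/
def polyWeight {ν : Measure ℂ} (h : Integrable (fun u : ℂ => ((1 + ‖u‖) ^ 8)⁻¹) ν) : Weight ν where
  P u := ((1 + ‖u‖) ^ 4)⁻¹
  meas := by fun_prop
  nonneg u := by positivity
  sq := h.congr (Eventually.of_forall fun u => by
    simp only [← inv_pow, ← pow_mul])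

/-- Functions `f_k`, `g_k` that define an off-diagonal kernel `∑ f_k(u) g_k(v) / (u - v)`, together
with exponents `e` with which they depend on a parameter `ξ`. Modulo a gauge function `X`, the
exponent of `f_k` is `idx k * u` and that of `g_k` is `-idx k * u`. -/
structure LaxSystem (ι : Type*) (ν : Measure ℂ) where
  odd : ι → Bool
  idx : ι → ℂ
  τ : ℂ → ℂ
  f : ι → ℂ → ℂ
  g : ι → ℂ → ℂ
  e : ℂ → ℂ
  X : ℂ → ℂ
  C : ℝ
  η : ℝ
  meas_τ : Measurable τ
  meas_f : ∀ k, Measurable (f k)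
  meas_g : ∀ k, Measurable (g k)
  meas_e : Measurable e
  meas_X : Measurable X
  C_nonneg : 0 ≤ C
  η_pos : 0 < η
  τ_le : ∀ u, ‖τ u‖ ≤ C
  f_le : ∀ k u, ‖f k u‖ * (1 + ‖u‖) ^ 6 ≤ C
  g_le : ∀ k u, ‖g k u‖ * (1 + ‖u‖) ^ 6 ≤ C
  sep : ∀ k u v, f k u ≠ 0 → g k v ≠ 0 → 1 ≤ C * ((1 + ‖u‖) * (1 + ‖v‖)) * ‖u - v‖
  e_le : ∀ u, ‖e u‖ ≤ 1 + ‖u‖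
  X_le : ∀ u, ‖X u‖ ≤ C * (1 + ‖u‖)
  f_re : ∀ k u, f k u ≠ 0 → (e u).re ≤ -η
  g_re : ∀ k u, g k u ≠ 0 → (e u).re ≤ -η
  f_X : ∀ k u, f k u ≠ 0 → e u = idx k * u + X u
  g_X : ∀ k u, g k u ≠ 0 → e u = -(idx k * u) - X u
  orth : ∀ k l u, odd k = odd l → f k u * g l u = 0
  int : Integrable (fun u : ℂ => ((1 + ‖u‖) ^ 8)⁻¹) ν

/-- A factor `φ(u, v)` of at most linear growth in both variables. -/
structure Multiplier where
  φ : ℂ → ℂ → ℂ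
  meas : Measurable fun z : ℂ × ℂ => φ z.1 z.2
  M : ℝ
  M_nonneg : 0 ≤ M
  bound : ∀ u v, ‖φ u v‖ ≤ M * ((1 + ‖u‖) * (1 + ‖v‖))

namespace Multiplier

/-- The factor `1`. -/
def one : Multiplier where
  φ _ _ := 1
  meas := measurable_const
  M := 1
  M_nonneg := zero_le_one
  bound u v := by
    have := norm_nonneg u
    have := norm_nonneg v
    rw [norm_one]
    nlinarith [mul_nonneg (norm_nonneg u) (norm_nonneg v)]

/-- The factor `x(u)`. -/
def left (x : ℂ → ℂ) (hx : Measurable x) (C : ℝ) (hC0 : 0 ≤ C)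
    (hC : ∀ u, ‖x u‖ ≤ C * (1 + ‖u‖)) : Multiplier where
  φ u _ := x u
  meas := hx.comp measurable_fst
  M := C
  M_nonneg := hC0
  bound u v := by
    refine (hC u).trans ?_
    have := norm_nonneg v
    have : 0 ≤ C * (1 + ‖u‖) := by positivity
    nlinarith [mul_nonneg this (norm_nonneg v)]

/-- The factor `x(v)`. -/
def right (x : ℂ → ℂ) (hx : Measurable x) (C : ℝ) (hC0 : 0 ≤ C)
    (hC : ∀ u, ‖x u‖ ≤ C * (1 + ‖u‖)) : Multiplier where
  φ _ v := x v
  meas := hx.comp measurable_snd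
  M := C
  M_nonneg := hC0
  bound u v := by
    refine (hC v).trans ?_
    have : 0 ≤ C * (1 + ‖v‖) := by positivity
    nlinarith [mul_nonneg this (norm_nonneg u)]

end Multiplier

/-! ### The kernels of a Lax system and their bounds -/

namespace LaxSystem

variable {ι : Type*} {ν : Measure ℂ} (S : LaxSystem ι ν)

/-- The weight which bounds the kernels. -/
abbrev w : Weight ν := polyWeight S.int

/-- The functions `f_k` at the parameter `ξ` (at `0` if `ξ < 0`). -/
def fξ (ξ : ℝ) (k : ι) (u : ℂ) : ℂ := Complex.exp ((max ξ 0 : ℝ) * S.e u) * S.f k u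

/-- The functions `g_k` at the parameter `ξ` (at `0` if `ξ < 0`). -/
def gξ (ξ : ℝ) (k : ι) (u : ℂ) : ℂ := Complex.exp ((max ξ 0 : ℝ) * S.e u) * S.g k u

theorem meas_fξ (ξ : ℝ) (k : ι) : Measurable (S.fξ ξ k) :=
  (Complex.measurable_exp.comp (S.meas_e.const_mul _)).mul (S.meas_f k)

theorem meas_gξ (ξ : ℝ) (k : ι) : Measurable (S.gξ ξ k) :=
  (Complex.measurable_exp.comp (S.meas_e.const_mul _)).mul (S.meas_g k)

theorem norm_exp_mul_le {h : ℂ → ℂ} {u : ℂ} (h1 : ‖h u‖ * (1 + ‖u‖) ^ 6 ≤ S.C)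
    (h2 : h u ≠ 0 → (S.e u).re ≤ -S.η) (ξ : ℝ) :
    ‖Complex.exp ((max ξ 0 : ℝ) * S.e u) * h u‖ * (1 + ‖u‖) ^ 6 ≤
      S.C * Real.exp (-S.η * max ξ 0) := by
  by_cases h0 : h u = 0
  · have := S.C_nonneg
    rw [h0]
    simp only [mul_zero, norm_zero, zero_mul]
    positivity
  have h3 : ‖Complex.exp ((max ξ 0 : ℝ) * S.e u)‖ ≤ Real.exp (-S.η * max ξ 0) := by
    rw [Complex.norm_exp, Complex.re_ofReal_mul]
    refine Real.exp_le_exp.2 ?_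
    have := mul_le_mul_of_nonneg_left (h2 h0) (le_max_right ξ 0)
    linarith
  rw [norm_mul, mul_assoc, mul_comm S.C]
  exact mul_le_mul h3 h1 (by positivity) (Real.exp_pos _).le

theorem fξ_le (ξ : ℝ) (k : ι) (u : ℂ) :
    ‖S.fξ ξ k u‖ * (1 + ‖u‖) ^ 6 ≤ S.C * Real.exp (-S.η * max ξ 0) :=
  S.norm_exp_mul_le (S.f_le k u) (S.f_re k u) ξ

theorem gξ_le (ξ : ℝ) (k : ι) (u : ℂ) :
    ‖S.gξ ξ k u‖ * (1 + ‖u‖) ^ 6 ≤ S.C * Real.exp (-S.η * max ξ 0) :=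
  S.norm_exp_mul_le (S.g_le k u) (S.g_re k u) ξ

theorem fξ_ne_zero {ξ : ℝ} {k : ι} {u : ℂ} : S.fξ ξ k u ≠ 0 ↔ S.f k u ≠ 0 := by
  simp [fξ]

theorem gξ_ne_zero {ξ : ℝ} {k : ι} {u : ℂ} : S.gξ ξ k u ≠ 0 ↔ S.g k u ≠ 0 := by
  simp [gξ]

theorem orthξ (ξ : ℝ) {k l : ι} (u : ℂ) (h : S.odd k = S.odd l) : S.gξ ξ l u * S.fξ ξ k u = 0 := by
  have := S.orth k l u h
  unfold fξ gξ
  linear_combination Complex.exp ((max ξ 0 : ℝ) * S.e u) * Complex.exp ((max ξ 0 : ℝ) * S.e u) * this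

/-- The exponential decay rate of a kernel, up to a constant. -/
def decay (ξ : ℝ) : ℝ := Real.exp (-(2 * S.η) * max ξ 0)

theorem decay_pos (ξ : ℝ) : 0 < S.decay ξ := Real.exp_pos _

theorem norm_fg_le (ξ : ℝ) (k : ι) (u v : ℂ) :
    ‖S.fξ ξ k u * S.gξ ξ k v * S.τ v‖ * ((1 + ‖u‖) ^ 6 * (1 + ‖v‖) ^ 6) ≤
      S.C ^ 3 * S.decay ξ := by
  have h1 := S.fξ_le ξ k u
  have h2 := S.gξ_le ξ k v
  have h3 := S.τ_le v
  have h4 := S.C_nonneg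
  have h5 : S.decay ξ = Real.exp (-S.η * max ξ 0) * Real.exp (-S.η * max ξ 0) := by
    rw [decay, ← Real.exp_add]
    ring_nf
  rw [norm_mul, norm_mul, h5]
  calc _ = (‖S.fξ ξ k u‖ * (1 + ‖u‖) ^ 6) * (‖S.gξ ξ k v‖ * (1 + ‖v‖) ^ 6) * ‖S.τ v‖ := by ring
    _ ≤ (S.C * Real.exp (-S.η * max ξ 0)) * (S.C * Real.exp (-S.η * max ξ 0)) * S.C := by gcongr
    _ = _ := by ring

/-- Where the numerator is nonzero, `sep` bounds `1/|u - v|` at the price of one power in each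
variable; elsewhere nothing is to be shown. -/
theorem norm_div_le (ξ : ℝ) (k : ι) (u v : ℂ) :
    ‖S.fξ ξ k u * S.gξ ξ k v * S.τ v / (u - v)‖ * ((1 + ‖u‖) ^ 5 * (1 + ‖v‖) ^ 5) ≤
      S.C ^ 4 * S.decay ξ := by
  have hC := S.C_nonneg
  have hd := (S.decay_pos ξ).le
  by_cases h : S.f k u ≠ 0 ∧ S.g k v ≠ 0
  · have h1 := S.sep k u v h.1 h.2
    have h2 : 0 < ‖u - v‖ := by
      rcases (norm_nonneg (u - v)).eq_or_lt with h0 | h0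
      · rw [← h0] at h1
        norm_num at h1
      · exact h0
    have h3 : ‖u - v‖⁻¹ ≤ S.C * ((1 + ‖u‖) * (1 + ‖v‖)) := (inv_le_iff_one_le_mul₀ h2).2 h1
    rw [norm_div, div_eq_mul_inv]
    calc _ ≤ ‖S.fξ ξ k u * S.gξ ξ k v * S.τ v‖ * (S.C * ((1 + ‖u‖) * (1 + ‖v‖))) *
          ((1 + ‖u‖) ^ 5 * (1 + ‖v‖) ^ 5) := by gcongr
      _ = S.C * (‖S.fξ ξ k u * S.gξ ξ k v * S.τ v‖ * ((1 + ‖u‖) ^ 6 * (1 + ‖v‖) ^ 6)) := by ring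
      _ ≤ S.C * (S.C ^ 3 * S.decay ξ) := mul_le_mul_of_nonneg_left (S.norm_fg_le ξ k u v) hC
      _ = _ := by ring
  · have : S.fξ ξ k u * S.gξ ξ k v = 0 := by
      rcases not_and_or.1 h with h | h <;> rw [not_not] at h <;> simp [fξ, gξ, h]
    rw [this]
    simp only [zero_mul, zero_div, norm_zero]
    positivity

theorem w_P (u v : ℂ) : S.w.P u * S.w.P v = ((1 + ‖u‖) ^ 4 * (1 + ‖v‖) ^ 4)⁻¹ := by
  rw [mul_inv]
  rfl

/-- The function `φ(u, v) f_k(u) g_k(v) τ(v) / (u - v)`. -/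
def cauchyFun (m : Multiplier) (ξ : ℝ) (k : ι) (u v : ℂ) : ℂ :=
  m.φ u v * (S.fξ ξ k u * S.gξ ξ k v * S.τ v / (u - v))

theorem norm_cauchyFun_le (m : Multiplier) (ξ : ℝ) (k : ι) (u v : ℂ) :
    ‖S.cauchyFun m ξ k u v‖ ≤ m.M * S.C ^ 4 * S.decay ξ * (S.w.P u * S.w.P v) := by
  have h := S.norm_div_le ξ k u v
  have hm := m.bound u v
  have hM := m.M_nonneg
  rw [w_P, ← div_eq_mul_inv, le_div_iff₀ (by positivity), cauchyFun, norm_mul]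
  calc _ ≤ m.M * ((1 + ‖u‖) * (1 + ‖v‖)) * ‖S.fξ ξ k u * S.gξ ξ k v * S.τ v / (u - v)‖ *
        ((1 + ‖u‖) ^ 4 * (1 + ‖v‖) ^ 4) := by gcongr
    _ = m.M * (‖S.fξ ξ k u * S.gξ ξ k v * S.τ v / (u - v)‖ *
        ((1 + ‖u‖) ^ 5 * (1 + ‖v‖) ^ 5)) := by ring
    _ ≤ m.M * (S.C ^ 4 * S.decay ξ) := by gcongr
    _ = _ := by ring

/-- The kernel `φ(u, v) f_k(u) g_k(v) τ(v) / (u - v)`. -/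
def cauchy (m : Multiplier) (ξ : ℝ) (k : ι) : Ker S.w :=
  ⟨S.cauchyFun m ξ k, by
    refine ⟨?_, _, S.norm_cauchyFun_le m ξ k⟩
    exact m.meas.mul ((((((S.meas_fξ ξ k).comp measurable_fst).mul
      ((S.meas_gξ ξ k).comp measurable_snd))).mul (S.meas_τ.comp measurable_snd)).div
        (measurable_fst.sub measurable_snd))⟩

theorem cauchy_apply (m : Multiplier) (ξ : ℝ) (k : ι) (u v : ℂ) :
    (S.cauchy m ξ k).1 u v = m.φ u v * (S.fξ ξ k u * S.gξ ξ k v * S.τ v / (u - v)) := rfl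

/-- The kernel `f_k(u) g_k(v) τ(v)` of rank one. -/
def rankOne (ξ : ℝ) (k : ι) : Ker S.w :=
  ⟨fun u v => S.fξ ξ k u * S.gξ ξ k v * S.τ v, by
    refine ⟨?_, S.C ^ 3 * S.decay ξ, fun u v => ?_⟩
    · exact ((((S.meas_fξ ξ k).comp measurable_fst).mul
        ((S.meas_gξ ξ k).comp measurable_snd))).mul (S.meas_τ.comp measurable_snd)
    · have h := S.norm_fg_le ξ k u v
      rw [w_P, ← div_eq_mul_inv, le_div_iff₀ (by positivity)]
      refine le_trans ?_ h
      gcongr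
      · linarith [norm_nonneg u]
      · norm_num
      · linarith [norm_nonneg v]
      · norm_num⟩

theorem rankOne_apply (ξ : ℝ) (k : ι) (u v : ℂ) :
    (S.rankOne ξ k).1 u v = S.fξ ξ k u * S.gξ ξ k v * S.τ v := rfl

variable [Fintype ι]

/-- The sum of the kernels `φ(u, v) f_k(u) g_k(v) τ(v) / (u - v)` over the indices of one parity. -/
def part (o : Bool) (m : Multiplier) (ξ : ℝ) : Ker S.w :=
  ∑ k with S.odd k = o, S.cauchy m ξ k

theorem sum_apply {ι' : Type*} (s : Finset ι') (a : ι' → Ker S.w) (u v : ℂ) :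
    (∑ k ∈ s, a k).1 u v = ∑ k ∈ s, (a k).1 u v := by
  classical
  induction s using Finset.induction_on with
  | empty => simp
  | insert i s hi ih => rw [Finset.sum_insert hi, Finset.sum_insert hi, Ker.add_apply, ih]

theorem part_apply (o : Bool) (m : Multiplier) (ξ : ℝ) (u v : ℂ) :
    (S.part o m ξ).1 u v = ∑ k with S.odd k = o,
      m.φ u v * (S.fξ ξ k u * S.gξ ξ k v * S.τ v / (u - v)) := S.sum_apply _ _ _ _

theorem norm_part_le (o : Bool) (m : Multiplier) (ξ : ℝ) (u v : ℂ) :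
    ‖(S.part o m ξ).1 u v‖ ≤
      Fintype.card ι * (m.M * S.C ^ 4) * S.decay ξ * (S.w.P u * S.w.P v) := by
  have h0 : 0 ≤ m.M * S.C ^ 4 * S.decay ξ * (S.w.P u * S.w.P v) :=
    mul_nonneg (mul_nonneg (mul_nonneg m.M_nonneg (pow_nonneg S.C_nonneg 4)) (S.decay_pos ξ).le)
      (mul_nonneg (S.w.nonneg u) (S.w.nonneg v))
  rw [part_apply]
  refine (norm_sum_le_of_le _ fun k _ => S.norm_cauchyFun_le m ξ k u v).trans ?_
  rw [Finset.sum_const, nsmul_eq_mul]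
  calc _ ≤ (Fintype.card ι : ℝ) * (m.M * S.C ^ 4 * S.decay ξ * (S.w.P u * S.w.P v)) := by
        gcongr
        exact Finset.card_le_univ _
    _ = _ := by ring

/-- The multiplier `e(u) + e(v)`. -/
def eMul : Multiplier where
  φ u v := S.e u + S.e v
  meas := (S.meas_e.comp measurable_fst).add (S.meas_e.comp measurable_snd)
  M := 2
  M_nonneg := zero_le_two
  bound u v := by
    refine (norm_add_le_of_le (S.e_le u) (S.e_le v)).trans ?_
    nlinarith [mul_nonneg (norm_nonneg u) (norm_nonneg v), norm_nonneg u, norm_nonneg v]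

variable [SFinite ν]

/-- Already the integrand vanishes: `g_k` and `f_l` have no common support when `k` and `l` have the
same parity. The multipliers are arbitrary, so this also covers the products with the derivative
kernels. -/
theorem part_mul_part (o : Bool) (m m' : Multiplier) (ξ : ℝ) :
    S.part o m ξ * S.part o m' ξ = 0 := Ker.ext' fun u v => by
  rw [Ker.mul_apply, Ker.zero_apply]
  have : ∀ s, (S.part o m ξ).1 u s * (S.part o m' ξ).1 s v = 0 := by
    intro s
    rw [part_apply, part_apply, Finset.sum_mul_sum]
    refine Finset.sum_eq_zero fun k hk => Finset.sum_eq_zero fun l hl => ?_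
    have h := S.orthξ ξ (k := l) (l := k) s
      ((Finset.mem_filter.1 hl).2.trans (Finset.mem_filter.1 hk).2.symm)
    linear_combination m.φ u s * m'.φ s v * (S.fξ ξ k u * S.τ s / (u - s)) *
      (S.gξ ξ l v * S.τ v / (s - v)) * h
  simp [this]

theorem hasDerivAt_part (o : Bool) {ξ : ℝ} (hξ : 0 < ξ) (u v : ℂ) :
    HasDerivAt (fun ξ => (S.part o Multiplier.one ξ).1 u v) ((S.part o S.eMul ξ).1 u v) ξ := by
  simp only [part_apply]
  refine HasDerivAt.fun_sum fun k _ => ?_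
  have h1 : ∀ z : ℂ, HasDerivAt (fun ξ : ℝ => Complex.exp ((max ξ 0 : ℝ) * z))
      (Complex.exp ((max ξ 0 : ℝ) * z) * z) ξ := by
    intro z
    have h2 : HasDerivAt (fun ξ : ℝ => Complex.exp ((ξ : ℂ) * z)) (Complex.exp (ξ * z) * z) ξ := by
      have := ((Complex.ofRealCLM.hasDerivAt (x := ξ)).mul_const z).cexp
      simpa using this
    rw [max_eq_left hξ.le]
    refine h2.congr_of_eventuallyEq ?_
    filter_upwards [Ioi_mem_nhds hξ] with s hs
    rw [max_eq_left (Set.mem_Ioi.1 hs).le]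
  have h3 := ((((h1 (S.e u)).mul_const (S.f k u)).mul
    ((h1 (S.e v)).mul_const (S.g k v))).mul_const (S.τ v)).div_const (u - v)
  have h4 := h3.const_mul (Multiplier.one.φ u v)
  refine h4.congr_deriv ?_
  simp only [Multiplier.one, eMul, fξ, gξ]
  ring

theorem continuous_part (o : Bool) (m : Multiplier) (u v : ℂ) :
    Continuous (fun ξ => (S.part o m ξ).1 u v) := by
  simp only [part_apply]
  unfold fξ gξ
  fun_prop

/-- The common constant in the bounds of the kernels. -/
def kerConst : ℝ := Fintype.card ι * (2 * S.C ^ 4)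

theorem decayingPair : Ker.DecayingPair (S.part true Multiplier.one) (S.part false Multiplier.one)
    (S.part true S.eMul) (S.part false S.eMul) S.kerConst (2 * S.η) := by
  have hC := S.C_nonneg
  have key : ∀ (o : Bool) (m : Multiplier), m.M ≤ 2 → ∀ ξ, 0 ≤ ξ → ∀ u v,
      ‖(S.part o m ξ).1 u v‖ ≤ S.kerConst * Real.exp (-(2 * S.η) * ξ) * (S.w.P u * S.w.P v) := by
    intro o m hm ξ hξ u v
    refine (S.norm_part_le o m ξ u v).trans ?_
    have h3 := mul_nonneg (S.w.nonneg u) (S.w.nonneg v)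
    rw [decay, max_eq_left hξ, kerConst]
    gcongr
  have hone : Multiplier.one.M ≤ 2 := by simp [Multiplier.one]
  have htwo : S.eMul.M ≤ 2 := by simp [eMul]
  exact
  { C_nonneg := by unfold kerConst; positivity
    η_pos := by linarith [S.η_pos]
    bound_a := key _ _ hone
    bound_b := key _ _ hone
    bound_a' := key _ _ htwo
    bound_b' := key _ _ htwo
    cont_a := fun u v => (S.continuous_part _ _ u v).continuousOn
    cont_b := fun u v => (S.continuous_part _ _ u v).continuousOn
    deriv_a := fun ξ hξ => S.hasDerivAt_part _ hξ
    deriv_b := fun ξ hξ => S.hasDerivAt_part _ hξ }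

/-- The kernel `φ(u, v) ∑ f_k(u) g_k(v) τ(v) / (u - v)`. -/
def full (m : Multiplier) (ξ : ℝ) : Ker S.w := S.part true m ξ + S.part false m ξ

theorem full_eq_sum (m : Multiplier) (ξ : ℝ) : S.full m ξ = ∑ k, S.cauchy m ξ k := by
  unfold full part
  rw [← Finset.sum_filter_add_sum_filter_not Finset.univ (fun k => S.odd k = true)]
  simp

theorem full_apply (m : Multiplier) (ξ : ℝ) (u v : ℂ) : (S.full m ξ).1 u v =
    m.φ u v * ∑ k, S.fξ ξ k u * S.gξ ξ k v * S.τ v / (u - v) := by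
  rw [full_eq_sum, sum_apply, Finset.mul_sum]
  rfl

/-- The kernel whose Fredholm determinant is `D`. -/
def prodKer (ξ : ℝ) : Ker S.w := S.part true Multiplier.one ξ * S.part false Multiplier.one ξ

variable [SigmaFinite ν]

/-- The resolvent kernel `(1 - H)⁻¹ - 1`. -/
def resKer (ξ : ℝ) : Ker S.w :=
  Ker.offResolvent (S.part true Multiplier.one ξ) (S.part false Multiplier.one ξ)
    (S.prodKer ξ).resolvent

theorem sub_ne_zero_of_ne {ξ : ℝ} {k : ι} {u v : ℂ} (hf : S.fξ ξ k u * S.gξ ξ k v ≠ 0) :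
    u - v ≠ 0 := by
  have h1 := S.sep k u v (S.fξ_ne_zero.1 (left_ne_zero_of_mul hf))
    (S.gξ_ne_zero.1 (right_ne_zero_of_mul hf))
  intro h0
  rw [h0, norm_zero, mul_zero] at h1
  norm_num at h1

/-! ### Commutators of `H` with multiplication operators -/

section Resolvent

variable {ξ : ℝ} (h : (S.prodKer ξ).fdet ≠ 0)

include h

theorem resKer_eq : S.full Multiplier.one ξ + S.full Multiplier.one ξ * S.resKer ξ = S.resKer ξ :=
  Ker.add_mul_offResolvent (S.part_mul_part _ _ _ _) (S.part_mul_part _ _ _ _)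
    ((S.prodKer ξ).resolvent_eq h)

theorem resKer_eq' : S.full Multiplier.one ξ + S.resKer ξ * S.full Multiplier.one ξ = S.resKer ξ :=
  Ker.offResolvent_mul_add (S.part_mul_part _ _ _ _) (S.part_mul_part _ _ _ _)
    ((S.prodKer ξ).resolvent_eq' h)

/-- With `Q` the resolvent kernel, the diagonals of `(xH)Q` and `Q(Hx)` are `x(u)` times those of
`HQ` and `QH`, which agree because `H` commutes with `Q`. Hence `[x, H]` has trace zero against `Q`,
even for unbounded `x` of linear growth. -/
theorem tr_left_eq_tr_right (x : ℂ → ℂ) (hx : Measurable x) (C : ℝ) (hC0 : 0 ≤ C)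
    (hC : ∀ u, ‖x u‖ ≤ C * (1 + ‖u‖)) :
    Ker.tr (S.full (Multiplier.left x hx C hC0 hC) ξ * S.resKer ξ) =
      Ker.tr (S.full (Multiplier.right x hx C hC0 hC) ξ * S.resKer ξ) := by
  rw [Ker.tr_mul_comm (S.full (Multiplier.right x hx C hC0 hC) ξ)]
  have hcomm : S.full Multiplier.one ξ * S.resKer ξ = S.resKer ξ * S.full Multiplier.one ξ :=
    add_left_cancel ((S.resKer_eq h).trans (S.resKer_eq' h).symm)
  unfold Ker.tr
  congr 1
  ext u
  have h1 : (S.full (Multiplier.left x hx C hC0 hC) ξ * S.resKer ξ).1 u u =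
      x u * (S.full Multiplier.one ξ * S.resKer ξ).1 u u := by
    rw [Ker.mul_apply, Ker.mul_apply, ← integral_const_mul]
    congr 1
    ext s
    rw [full_apply, full_apply]
    simp only [Multiplier.left, Multiplier.one]
    ring
  have h2 : (S.resKer ξ * S.full (Multiplier.right x hx C hC0 hC) ξ).1 u u =
      x u * (S.resKer ξ * S.full Multiplier.one ξ).1 u u := by
    rw [Ker.mul_apply, Ker.mul_apply, ← integral_const_mul]
    congr 1
    ext s
    rw [full_apply, full_apply]
    simp only [Multiplier.right, Multiplier.one]
    ring
  rw [h1, h2, hcomm]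

/-- On the support of `f_k(u) g_k(v)` the numerator `e(u) + e(v)` equals `idx k (u - v) + X(u) -
X(v)`. The first part cancels the denominator and leaves a rank one kernel; the second is a
commutator with `X`. -/
theorem tr_full_eMul : Ker.tr (S.full S.eMul ξ * S.resKer ξ) =
    ∑ k, S.idx k * Ker.tr (S.rankOne ξ k * S.resKer ξ) := by
  have hdec : S.full S.eMul ξ = (∑ k, S.idx k • S.rankOne ξ k) +
      (S.full (Multiplier.left S.X S.meas_X S.C S.C_nonneg S.X_le) ξ -
        S.full (Multiplier.right S.X S.meas_X S.C S.C_nonneg S.X_le) ξ) := by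
    simp only [full_eq_sum, ← Finset.sum_sub_distrib, ← Finset.sum_add_distrib]
    refine Finset.sum_congr rfl fun k _ => Ker.ext' fun u v => ?_
    simp only [Ker.add_apply, Ker.sub_apply, Ker.smul_apply, cauchy_apply, rankOne_apply,
      Multiplier.left, Multiplier.right, eMul]
    by_cases h0 : S.fξ ξ k u * S.gξ ξ k v = 0
    · simp [h0]
    · have h1 := S.sub_ne_zero_of_ne h0
      rw [S.f_X k u (S.fξ_ne_zero.1 (left_ne_zero_of_mul h0)),
        S.g_X k v (S.gξ_ne_zero.1 (right_ne_zero_of_mul h0))]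
      field_simp
      ring
  rw [hdec, add_mul, sub_mul, Ker.tr_add, Ker.tr_sub, S.tr_left_eq_tr_right h, sub_self, add_zero,
    Finset.sum_mul, Ker.tr_sum]
  simp only [Ker.smul_mul, Ker.tr_smul]

/-- The sum of the rank one kernels is the commutator of multiplication by `u` with `H`. -/
theorem sum_tr_rankOne : ∑ k, Ker.tr (S.rankOne ξ k * S.resKer ξ) = 0 := by
  have hid : ∀ u : ℂ, ‖u‖ ≤ 1 * (1 + ‖u‖) := fun u => by linarith
  have hdec : ∑ k, S.rankOne ξ k =
      S.full (Multiplier.left (fun u => u) measurable_id 1 zero_le_one hid) ξ -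
        S.full (Multiplier.right (fun u => u) measurable_id 1 zero_le_one hid) ξ := by
    simp only [full_eq_sum, ← Finset.sum_sub_distrib]
    refine Finset.sum_congr rfl fun k _ => Ker.ext' fun u v => ?_
    simp only [Ker.sub_apply, cauchy_apply, rankOne_apply, Multiplier.left, Multiplier.right]
    by_cases h0 : S.fξ ξ k u * S.gξ ξ k v = 0
    · simp [h0]
    · have h1 := S.sub_ne_zero_of_ne h0
      field_simp
  rw [← Ker.tr_sum, ← Finset.sum_mul, hdec, sub_mul, Ker.tr_sub, S.tr_left_eq_tr_right h, sub_self]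

end Resolvent

/-- The Fredholm determinant of the product kernel is the exponential of the integrated traces. -/
theorem fdet_eq_exp (h : ∀ ξ, 0 ≤ ξ → (S.prodKer ξ).fdet ≠ 0) :
    IntegrableOn (fun ξ => ∑ k, S.idx k * Ker.tr (S.rankOne ξ k * S.resKer ξ)) (Set.Ioi 0) ∧
    (S.prodKer 0).fdet = Complex.exp
      (∫ ξ in Set.Ioi (0 : ℝ), ∑ k, S.idx k * Ker.tr (S.rankOne ξ k * S.resKer ξ)) := by
  have h1 := S.decayingPair.fdet_eq_exp (fun ξ => S.part_mul_part _ _ _ ξ)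
    (fun ξ => S.part_mul_part _ _ _ ξ) (fun ξ => S.part_mul_part _ _ _ ξ)
    (fun ξ => S.part_mul_part _ _ _ ξ) h
  have heq : ∀ ξ ∈ Set.Ioi (0 : ℝ), Ker.tr ((S.part true S.eMul ξ + S.part false S.eMul ξ) *
      Ker.offResolvent (S.part true Multiplier.one ξ) (S.part false Multiplier.one ξ)
        (S.part true Multiplier.one ξ * S.part false Multiplier.one ξ).resolvent) =
      ∑ k, S.idx k * Ker.tr (S.rankOne ξ k * S.resKer ξ) := fun ξ hξ =>
    S.tr_full_eMul (h ξ (Set.mem_Ioi.1 hξ).le)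
  exact ⟨h1.1.congr_fun heq measurableSet_Ioi, by
    rw [← setIntegral_congr_fun measurableSet_Ioi heq]; exact h1.2⟩

end LaxSystem

/-! ### The vectors `f` and `g` on the sets `Ω_{ℓ,j}` -/

/-- The sets `Ω_{ℓ,j}` are measurable, pairwise disjoint, contained in the appropriate half planes
and at positive distance from the imaginary axis. -/
structure Domains (S : Data) (m : ℕ) (η : ℝ) : Prop where
  η_pos : 0 < η
  meas₁ : ∀ j, MeasurableSet (S.Om₁ j)
  meas₂ : ∀ j, MeasurableSet (S.Om₂ j)
  label₁ : ∀ j z, z ∈ S.Om₁ j → 1 ≤ j ∧ j ≤ m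
  label₂ : ∀ j z, z ∈ S.Om₂ j → 1 ≤ j ∧ j ≤ m
  disj₁ : ∀ i j z, z ∈ S.Om₁ i → z ∈ S.Om₁ j → i = j
  disj₂ : ∀ i j z, z ∈ S.Om₂ i → z ∈ S.Om₂ j → i = j
  disj : ∀ i j z, z ∈ S.Om₁ i → z ∉ S.Om₂ j
  side₁_odd : ∀ j z, z ∈ S.Om₁ j → Odd j → z.re ≤ -η
  side₁_even : ∀ j z, z ∈ S.Om₁ j → ¬Odd j → η ≤ z.re
  side₂_odd : ∀ j z, z ∈ S.Om₂ j → Odd j → η ≤ z.re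
  side₂_even : ∀ j z, z ∈ S.Om₂ j → ¬Odd j → z.re ≤ -η

/-- The weight of an index of `Fin (m + 1)`; the last index has weight `0`. -/
def wIdx {m : ℕ} (k : Fin (m + 1)) : ℕ := if (k : ℕ) = m then 0 else k + 1

/-- The odd number in `{i - 1, i}`. -/
def oddOf (i : ℕ) : ℕ := if Odd i then i else i - 1

/-- The even number in `{i - 1, i}`. -/
def evenOf (i : ℕ) : ℕ := if Odd i then i - 1 else i

theorem odd_oddOf {i : ℕ} (hi : 1 ≤ i) : Odd (oddOf i) := by
  unfold oddOf
  split_ifs with h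
  · exact h
  · rw [Nat.not_odd_iff_even] at h
    exact Nat.Even.sub_odd hi h odd_one

theorem not_odd_evenOf (i : ℕ) : ¬Odd (evenOf i) := by
  unfold evenOf
  split_ifs with h
  · rw [Nat.not_odd_iff_even]
    exact Nat.Odd.sub_odd h odd_one
  · exact h

theorem oddOf_le (i : ℕ) : oddOf i ≤ i := by
  unfold oddOf
  split_ifs <;> omega

theorem evenOf_le (i : ℕ) : evenOf i ≤ i := by
  unfold evenOf
  split_ifs <;> omega

/-- The Kronecker factor of `K₁` says that `i` and `j` belong to the same pair among `{1,2}, {3,4},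
…`; for `K₂` the pairs are `{0,1}, {2,3}, …`. Each pair contributes one summand `f_k(u) g_k(v)`,
labelled by its odd, respectively even, member. -/
theorem oddOf_eq_iff {i j : ℕ} (hi : 1 ≤ i) (hj : 1 ≤ j) :
    oddOf i = oddOf j ↔ i = j ∨ (i : ℤ) = (j : ℤ) + (-1) ^ i := by
  unfold oddOf
  by_cases h1 : Odd i <;> by_cases h2 : Odd j
  · simp only [h1, h2, if_true, h1.neg_one_pow]
    obtain ⟨a, rfl⟩ := h1
    obtain ⟨b, rfl⟩ := h2
    omega
  · simp only [h1, h2, if_true, if_false, h1.neg_one_pow]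
    rw [Nat.not_odd_iff_even] at h2
    obtain ⟨a, rfl⟩ := h1
    obtain ⟨b, rfl⟩ := h2
    omega
  · simp only [h1, h2, if_true, if_false]
    rw [Nat.not_odd_iff_even] at h1
    rw [h1.neg_one_pow]
    obtain ⟨a, rfl⟩ := h1
    obtain ⟨b, rfl⟩ := h2
    omega
  · simp only [h1, h2, if_false]
    rw [Nat.not_odd_iff_even] at h1 h2
    rw [h1.neg_one_pow]
    obtain ⟨a, rfl⟩ := h1
    obtain ⟨b, rfl⟩ := h2
    omega

theorem evenOf_eq_iff {i j : ℕ} (hi : 1 ≤ i) (hj : 1 ≤ j) :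
    evenOf i = evenOf j ↔ i = j ∨ (i : ℤ) = (j : ℤ) - (-1) ^ i := by
  unfold evenOf
  by_cases h1 : Odd i <;> by_cases h2 : Odd j
  · simp only [h1, h2, if_true, h1.neg_one_pow]
    obtain ⟨a, rfl⟩ := h1
    obtain ⟨b, rfl⟩ := h2
    omega
  · simp only [h1, h2, if_true, if_false, h1.neg_one_pow]
    rw [Nat.not_odd_iff_even] at h2
    obtain ⟨a, rfl⟩ := h1
    obtain ⟨b, rfl⟩ := h2
    omega
  · simp only [h1, h2, if_true, if_false]
    rw [Nat.not_odd_iff_even] at h1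
    rw [h1.neg_one_pow]
    obtain ⟨a, rfl⟩ := h1
    obtain ⟨b, rfl⟩ := h2
    omega
  · simp only [h1, h2, if_false]
    rw [Nat.not_odd_iff_even] at h1 h2
    rw [h1.neg_one_pow]
    obtain ⟨a, rfl⟩ := h1
    obtain ⟨b, rfl⟩ := h2
    omega

/-- Only sets with equal or adjacent labels interact, so separation is needed for these alone. -/
theorem oddOf_eq_near {i j : ℕ} (h : oddOf i = oddOf j) (hi : 1 ≤ i) (hj : 1 ≤ j) :
    i = j ∨ i + 1 = j ∨ j + 1 = i := by
  unfold oddOf at h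
  split_ifs at h <;> omega

theorem evenOf_eq_near {i j : ℕ} (h : evenOf i = evenOf j) (hi : 1 ≤ i) (hj : 1 ≤ j) :
    i = j ∨ i + 1 = j ∨ j + 1 = i := by
  unfold evenOf at h
  split_ifs at h <;> omega

theorem wIdx_injective {m : ℕ} : Function.Injective (wIdx (m := m)) := by
  intro k l h
  unfold wIdx at h
  ext
  split_ifs at h <;> omega

theorem exists_wIdx_eq {m p : ℕ} (hp : p ≤ m) : ∃ k : Fin (m + 1), wIdx k = p := by
  rcases Nat.eq_zero_or_pos p with rfl | h
  · exact ⟨Fin.last m, by simp [wIdx]⟩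
  · refine ⟨⟨p - 1, by omega⟩, ?_⟩
    unfold wIdx
    simp only
    split_ifs <;> omega

section Values

variable {S : Data} {m : ℕ} {z : ℂ} {i : ℕ}

/-- At each point of the domains at most one component can be nonzero, the one of the pair
containing `i`. The last component is excluded because its label `0` is even. -/
theorem vecF_of_mem₁ (hi : 1 ≤ i) (h1 : ∀ j, z ∈ S.Om₁ j ↔ j = i)
    (h2 : ∀ j, z ∉ S.Om₂ j) (k : Fin (m + 1)) :
    vecF S k z = if wIdx k = oddOf i then S.A i z else 0 := by
  have hodd := odd_oddOf hi
  unfold vecF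
  by_cases hk : (k : ℕ) = m
  · have h0 : wIdx k ≠ oddOf i := by
      intro h
      rw [wIdx, if_pos hk] at h
      rw [← h] at hodd
      exact absurd hodd (by decide)
    rw [if_pos hk, if_neg h0, Set.indicator_of_notMem (h2 1)]
  · rw [if_neg hk, wIdx, if_neg hk]
    by_cases ho : Odd ((k : ℕ) + 1)
    · rw [if_pos ho]
      have hne : ¬Odd ((k : ℕ) + 2) := by
        rw [Nat.not_odd_iff_even]
        exact ho.add_one
      by_cases e1 : i = (k : ℕ) + 1
      · have h3 : z ∈ S.Om₁ ((k : ℕ) + 1) := (h1 _).2 e1.symm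
        have h4 : z ∉ S.Om₁ ((k : ℕ) + 2) := fun h => by have := (h1 _).1 h; omega
        rw [Set.indicator_of_mem h3, Set.indicator_of_notMem h4, e1, oddOf, if_pos ho, if_pos rfl,
          add_zero]
      · by_cases e2 : i = (k : ℕ) + 2
        · have h3 : z ∉ S.Om₁ ((k : ℕ) + 1) := fun h => by have := (h1 _).1 h; omega
          have h4 : z ∈ S.Om₁ ((k : ℕ) + 2) := (h1 _).2 e2.symm
          rw [Set.indicator_of_notMem h3, Set.indicator_of_mem h4, e2, oddOf, if_neg hne,
            if_pos (by omega), zero_add]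
        · have h3 : z ∉ S.Om₁ ((k : ℕ) + 1) := fun h => by have := (h1 _).1 h; omega
          have h4 : z ∉ S.Om₁ ((k : ℕ) + 2) := fun h => by have := (h1 _).1 h; omega
          rw [Set.indicator_of_notMem h3, Set.indicator_of_notMem h4, if_neg, add_zero]
          unfold oddOf
          split_ifs <;> omega
    · rw [if_neg ho, Set.indicator_of_notMem (h2 _), Set.indicator_of_notMem (h2 _), add_zero,
        if_neg]
      intro h
      rw [h] at ho
      exact ho hodd

theorem vecF_of_mem₂ (hi : 1 ≤ i) (him : i ≤ m) (h1 : ∀ j, z ∈ S.Om₂ j ↔ j = i)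
    (h2 : ∀ j, z ∉ S.Om₁ j) (k : Fin (m + 1)) :
    vecF S k z = if wIdx k = evenOf i then S.A i z else 0 := by
  have hodd := not_odd_evenOf i
  unfold vecF
  by_cases hk : (k : ℕ) = m
  · rw [if_pos hk, wIdx, if_pos hk]
    -- The pair of `i = 1` is `{0, 1}`, whose even member is represented by the last component.
    by_cases e1 : i = 1
    · subst e1
      rw [Set.indicator_of_mem ((h1 1).2 rfl), if_pos (by simp [evenOf])]
    · rw [Set.indicator_of_notMem fun h => e1 ((h1 1).1 h).symm, if_neg]
      unfold evenOf
      split_ifs <;> omega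
  · rw [if_neg hk, wIdx, if_neg hk]
    by_cases ho : Odd ((k : ℕ) + 1)
    · rw [if_pos ho, Set.indicator_of_notMem (h2 _), Set.indicator_of_notMem (h2 _), add_zero,
        if_neg]
      intro h
      rw [h] at ho
      exact hodd ho
    · rw [if_neg ho]
      have hne : Odd ((k : ℕ) + 2) := (Nat.not_odd_iff_even.1 ho).add_one
      by_cases e1 : i = (k : ℕ) + 1
      · have h3 : z ∈ S.Om₂ ((k : ℕ) + 1) := (h1 _).2 e1.symm
        have h4 : z ∉ S.Om₂ ((k : ℕ) + 2) := fun h => by have := (h1 _).1 h; omega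
        rw [Set.indicator_of_mem h3, Set.indicator_of_notMem h4, e1, evenOf, if_neg ho, if_pos rfl,
          add_zero]
      · by_cases e2 : i = (k : ℕ) + 2
        · have h3 : z ∉ S.Om₂ ((k : ℕ) + 1) := fun h => by have := (h1 _).1 h; omega
          have h4 : z ∈ S.Om₂ ((k : ℕ) + 2) := (h1 _).2 e2.symm
          rw [Set.indicator_of_notMem h3, Set.indicator_of_mem h4, e2, evenOf, if_pos hne,
            if_pos (by omega), zero_add]
        · have h3 : z ∉ S.Om₂ ((k : ℕ) + 1) := fun h => by have := (h1 _).1 h; omega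
          have h4 : z ∉ S.Om₂ ((k : ℕ) + 2) := fun h => by have := (h1 _).1 h; omega
          rw [Set.indicator_of_notMem h3, Set.indicator_of_notMem h4, if_neg, add_zero]
          unfold evenOf
          split_ifs <;> omega

theorem vecF_of_notMem (h1 : ∀ j, z ∉ S.Om₁ j) (h2 : ∀ j, z ∉ S.Om₂ j) (k : Fin (m + 1)) :
    vecF S k z = 0 := by
  unfold vecF
  split_ifs <;> simp [h1, h2]

/-- The data with `Ω₁`, `Ω₂` interchanged and `B` in place of `A`. -/
def swapData (S : Data) : Data where
  Om₁ := S.Om₂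
  Om₂ := S.Om₁
  ν := S.ν
  τ := S.τ
  A := S.B
  B := S.A

theorem vecG_eq (k : Fin (m + 1)) : vecG S k z = vecF (swapData S) k z := rfl

/-- The sign `+1` in the left and `-1` in the right half plane. -/
def sgn (z : ℂ) : ℂ := if z.re < 0 then 1 else -1

/-- The exponent of the symmetrized weight on `Ω_{ℓ,i}`. -/
def wexpo {m : ℕ} (x y t : Fin m → ℝ) (i : ℕ) (z : ℂ) : ℂ :=
  sgn z * (cubic x y t i z - cubic x y t (i - 1) z) / 2

/-- The symmetrized weight: `M_i^{1/2}` on `Ω_{1,i}` and `M_i^{-1/2}` on `Ω_{2,i}`. -/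
def wfun {m : ℕ} (x y t : Fin m → ℝ) (i : ℕ) (z : ℂ) : ℂ := Complex.exp (wexpo x y t i z)

/-- The last entry of `Δ` is `m_{m+1} = m_0 = 1`, so label `m + 1` can be replaced by `0`. -/
theorem mexp_wIdx (x y t : Fin m → ℝ) (k : Fin (m + 1)) :
    mexp x y t (k + 1) z = mexp x y t (wIdx k) z := by
  unfold wIdx
  split_ifs with h
  · simp [mexp, cubic, entry, h]
  · rfl

variable {η : ℝ} (hS : Domains S m η)

include hS

theorem Domains.mem₁_iff (h : z ∈ S.Om₁ i) (j : ℕ) : z ∈ S.Om₁ j ↔ j = i :=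
  ⟨fun hj => hS.disj₁ _ _ _ hj h, fun hj => hj ▸ h⟩

theorem Domains.mem₂_iff (h : z ∈ S.Om₂ i) (j : ℕ) : z ∈ S.Om₂ j ↔ j = i :=
  ⟨fun hj => hS.disj₂ _ _ _ hj h, fun hj => hj ▸ h⟩

theorem Domains.conjScalar_of_mem (h : z ∈ S.Om₁ i ∨ z ∈ S.Om₂ i) (x y t : Fin m → ℝ) :
    conjScalar S x y t z = Complex.exp (-(cubic x y t (i - 1) z + cubic x y t i z) / 2) := by
  have hi : i ∈ Finset.Icc 1 m := by
    rw [Finset.mem_Icc]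
    exact h.elim (hS.label₁ i z) (hS.label₂ i z)
  unfold conjScalar
  rw [Finset.sum_eq_single_of_mem i hi]
  · have h1 : (S.Om₁ i).indicator (fun _ => (1 : ℂ)) z + (S.Om₂ i).indicator (fun _ => 1) z = 1 := by
      rcases h with h | h
      · simp [h, hS.disj i i z h]
      · have : z ∉ S.Om₁ i := fun h' => hS.disj i i z h' h
        simp [h, this]
    rw [h1, mexpSqrt, mexpSqrt, ← Complex.exp_add, one_div, ← Complex.exp_neg]
    congr 1
    ring
  · intro j _ hj
    have h1 : z ∉ S.Om₁ j := by
      intro hj'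
      rcases h with h | h
      · exact hj (hS.disj₁ _ _ _ hj' h)
      · exact hS.disj _ _ _ hj' h
    have h2 : z ∉ S.Om₂ j := by
      intro hj'
      rcases h with h | h
      · exact hS.disj _ _ _ h hj'
      · exact hj (hS.disj₂ _ _ _ hj' h)
    simp [h1, h2]

theorem Domains.sgn₁ (h : z ∈ S.Om₁ i) : sgn z = if Odd i then 1 else -1 := by
  have := hS.η_pos
  unfold sgn
  by_cases ho : Odd i
  · rw [if_pos ho, if_pos]
    linarith [hS.side₁_odd i z h ho]
  · rw [if_neg ho, if_neg]
    linarith [hS.side₁_even i z h ho]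

theorem Domains.sgn₂ (h : z ∈ S.Om₂ i) : sgn z = if Odd i then -1 else 1 := by
  have := hS.η_pos
  unfold sgn
  by_cases ho : Odd i
  · rw [if_pos ho, if_neg]
    linarith [hS.side₂_odd i z h ho]
  · rw [if_neg ho, if_pos]
    linarith [hS.side₂_even i z h ho]

/-- On `Ω_{1,i}` the factor `cΔ` is `m_k / √(m_{i-1} m_i)` with `k` the odd one of `i - 1`, `i`,
that is `M_i^{1/2}`. The choice of `c` gives `f` and `g` the same weight on each set. -/
theorem Domains.vecf_of_mem₁ (h : z ∈ S.Om₁ i) (x y t : Fin m → ℝ) (k : Fin (m + 1)) :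
    vecf S x y t k z = if wIdx k = oddOf i then wfun x y t i z * S.A i z else 0 := by
  rw [vecf, hS.conjScalar_of_mem (Or.inl h), mexp_wIdx,
    vecF_of_mem₁ (hS.label₁ i z h).1 (hS.mem₁_iff h) (fun j => hS.disj i j z h)]
  split_ifs with hk
  · rw [hk, mexp, ← Complex.exp_add, wfun, wexpo, hS.sgn₁ h, oddOf]
    congr 2
    split_ifs <;> ring
  · rw [mul_zero]

theorem Domains.vecf_of_mem₂ (h : z ∈ S.Om₂ i) (x y t : Fin m → ℝ) (k : Fin (m + 1)) :
    vecf S x y t k z = if wIdx k = evenOf i then wfun x y t i z * S.A i z else 0 := by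
  rw [vecf, hS.conjScalar_of_mem (Or.inr h), mexp_wIdx,
    vecF_of_mem₂ (hS.label₂ i z h).1 (hS.label₂ i z h).2 (hS.mem₂_iff h)
      (fun j hj => hS.disj j i z hj h)]
  split_ifs with hk
  · rw [hk, mexp, ← Complex.exp_add, wfun, wexpo, hS.sgn₂ h, evenOf]
    congr 2
    split_ifs <;> ring
  · rw [mul_zero]

theorem Domains.vecg_of_mem₁ (h : z ∈ S.Om₁ i) (x y t : Fin m → ℝ) (k : Fin (m + 1)) :
    vecg S x y t k z = if wIdx k = evenOf i then wfun x y t i z * S.B i z else 0 := by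
  rw [vecg, hS.conjScalar_of_mem (Or.inl h), mexp_wIdx, vecG_eq,
    vecF_of_mem₂ (S := swapData S) (hS.label₁ i z h).1 (hS.label₁ i z h).2 (hS.mem₁_iff h)
      (fun j => hS.disj i j z h)]
  split_ifs with hk
  · rw [hk, mexp, ← Complex.exp_neg, ← Complex.exp_neg, ← Complex.exp_add, wfun, wexpo, hS.sgn₁ h,
      evenOf]
    congr 2
    split_ifs <;> ring
  · rw [mul_zero]

theorem Domains.vecg_of_mem₂ (h : z ∈ S.Om₂ i) (x y t : Fin m → ℝ) (k : Fin (m + 1)) :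
    vecg S x y t k z = if wIdx k = oddOf i then wfun x y t i z * S.B i z else 0 := by
  rw [vecg, hS.conjScalar_of_mem (Or.inr h), mexp_wIdx, vecG_eq,
    vecF_of_mem₁ (S := swapData S) (hS.label₂ i z h).1 (hS.mem₂_iff h)
      (fun j hj => hS.disj j i z hj h)]
  split_ifs with hk
  · rw [hk, mexp, ← Complex.exp_neg, ← Complex.exp_neg, ← Complex.exp_add, wfun, wexpo, hS.sgn₂ h,
      oddOf]
    congr 2
    split_ifs <;> ring
  · rw [mul_zero]

omit hS in
theorem vecf_of_notMem (h1 : ∀ j, z ∉ S.Om₁ j) (h2 : ∀ j, z ∉ S.Om₂ j) (x y t : Fin m → ℝ)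
    (k : Fin (m + 1)) : vecf S x y t k z = 0 := by
  rw [vecf, vecF_of_notMem h1 h2, mul_zero]

omit hS in
theorem vecg_of_notMem (h1 : ∀ j, z ∉ S.Om₁ j) (h2 : ∀ j, z ∉ S.Om₂ j) (x y t : Fin m → ℝ)
    (k : Fin (m + 1)) : vecg S x y t k z = 0 := by
  rw [vecg, vecG_eq, vecF_of_notMem (S := swapData S) h2 h1, mul_zero]

omit hS in
theorem exists_mem_or (S : Data) (z : ℂ) : (∃ i, z ∈ S.Om₁ i) ∨ (∃ i, z ∈ S.Om₂ i) ∨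
    ((∀ j, z ∉ S.Om₁ j) ∧ ∀ j, z ∉ S.Om₂ j) := by
  by_cases h1 : ∃ i, z ∈ S.Om₁ i
  · exact Or.inl h1
  · by_cases h2 : ∃ i, z ∈ S.Om₂ i
    · exact Or.inr (Or.inl h2)
    · push Not at h1 h2
      exact Or.inr (Or.inr ⟨h1, h2⟩)

end Values

/-! ### Admissible data and the associated integrable kernel -/

/-- Quantitative hypotheses on the data: the symmetrized weights decay, `A_j`, `B_j`, `τ` are
bounded, and neighbouring sets are separated up to polynomial factors. -/
structure Admissible (S : Data) {m : ℕ} (x y t : Fin m → ℝ) (C η : ℝ) : Prop where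
  dom : Domains S m η
  C_nonneg : 0 ≤ C
  meas_τ : Measurable S.τ
  meas_A₁ : ∀ j, Measurable ((S.Om₁ j).indicator (S.A j))
  meas_A₂ : ∀ j, Measurable ((S.Om₂ j).indicator (S.A j))
  meas_B₁ : ∀ j, Measurable ((S.Om₁ j).indicator (S.B j))
  meas_B₂ : ∀ j, Measurable ((S.Om₂ j).indicator (S.B j))
  τ_le : ∀ z, ‖S.τ z‖ ≤ C
  τ_ne : ∀ z, S.τ z ≠ 0
  A_le : ∀ j z, z ∈ S.Om₁ j ∨ z ∈ S.Om₂ j → ‖S.A j z‖ ≤ C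
  B_le : ∀ j z, z ∈ S.Om₁ j ∨ z ∈ S.Om₂ j → ‖S.B j z‖ ≤ C
  w_le : ∀ j z, z ∈ S.Om₁ j ∨ z ∈ S.Om₂ j → ‖wfun x y t j z‖ * (1 + ‖z‖) ^ 6 ≤ C
  sep : ∀ i j u v, u ∈ S.Om₁ i → v ∈ S.Om₂ j → (i = j ∨ i + 1 = j ∨ j + 1 = i) →
    1 ≤ C * ((1 + ‖u‖) * (1 + ‖v‖)) * ‖u - v‖
  int : Integrable (fun u : ℂ => ((1 + ‖u‖) ^ 8)⁻¹) S.ν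

/-- The gauge function, equal to `-(2j-1)u/2` on `Ω_{1,j} ∪ Ω_{2,j}`. -/
def gauge (S : Data) (m : ℕ) (u : ℂ) : ℂ :=
  ∑ j ∈ Finset.Icc 1 m, (S.Om₁ j ∪ S.Om₂ j).indicator (fun u => -((2 * j - 1) / 2 * u)) u

theorem Domains.gauge_of_mem {S : Data} {m : ℕ} {η : ℝ} (hS : Domains S m η) {i : ℕ} {z : ℂ}
    (h : z ∈ S.Om₁ i ∨ z ∈ S.Om₂ i) : gauge S m z = -((2 * i - 1) / 2 * z) := by
  have hi : i ∈ Finset.Icc 1 m := by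
    rw [Finset.mem_Icc]
    exact h.elim (hS.label₁ i z) (hS.label₂ i z)
  unfold gauge
  rw [Finset.sum_eq_single_of_mem i hi]
  · exact Set.indicator_of_mem (s := S.Om₁ i ∪ S.Om₂ i) h _
  · intro j _ hj
    refine Set.indicator_of_notMem (s := S.Om₁ j ∪ S.Om₂ j) ?_ _
    rintro (hj' | hj') <;> rcases h with h | h
    · exact hj (hS.disj₁ _ _ _ hj' h)
    · exact hS.disj _ _ _ hj' h
    · exact hS.disj _ _ _ h hj'
    · exact hj (hS.disj₂ _ _ _ hj' h)

theorem continuous_cubic {m : ℕ} (x y t : Fin m → ℝ) (j : ℕ) : Continuous (cubic x y t j) := by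
  unfold cubic
  fun_prop

theorem measurable_mexp {m : ℕ} (x y t : Fin m → ℝ) (j : ℕ) : Measurable (mexp x y t j) :=
  Complex.measurable_exp.comp (continuous_cubic x y t j).measurable

theorem measurable_sgn : Measurable sgn :=
  Measurable.ite (measurableSet_lt Complex.measurable_re measurable_const) measurable_const
    measurable_const

theorem norm_sgn (z : ℂ) : ‖sgn z‖ = 1 := by
  unfold sgn
  split_ifs <;> simp

theorem norm_gauge_le (S : Data) {m : ℕ} {η : ℝ} (hS : Domains S m η) (z : ℂ) :
    ‖gauge S m z‖ ≤ m * (1 + ‖z‖) := by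
  have key : ∀ i, (z ∈ S.Om₁ i ∨ z ∈ S.Om₂ i) → ‖gauge S m z‖ ≤ m * (1 + ‖z‖) := by
    intro i h
    have hi : 1 ≤ i ∧ i ≤ m := h.elim (hS.label₁ i z) (hS.label₂ i z)
    rw [hS.gauge_of_mem h, norm_neg, norm_mul]
    have h1 : ‖((2 * (i : ℂ) - 1) / 2)‖ ≤ m := by
      have h2 : ((2 * (i : ℂ) - 1) / 2) = (((2 * (i : ℝ) - 1) / 2 : ℝ) : ℂ) := by push_cast; rfl
      have h3 : (1 : ℝ) ≤ i := by exact_mod_cast hi.1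
      have h4 : (i : ℝ) ≤ m := by exact_mod_cast hi.2
      rw [h2, Complex.norm_real, Real.norm_of_nonneg (by linarith)]
      linarith
    have := norm_nonneg z
    gcongr
    linarith
  rcases exists_mem_or S z with ⟨i, h⟩ | ⟨i, h⟩ | ⟨h1, h2⟩
  · exact key i (Or.inl h)
  · exact key i (Or.inr h)
  · have : gauge S m z = 0 := by
      unfold gauge
      refine Finset.sum_eq_zero fun j _ => Set.indicator_of_notMem ?_ _
      rintro (h | h)
      · exact h1 _ h
      · exact h2 _ h
    rw [this, norm_zero]
    positivity

/-- The increments of the direction `(1, …, m)` are all `1`, including the first one because the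
missing entry with label `0` is zero. Hence the added exponent does not depend on `i`. -/
theorem wexpo_shift {m : ℕ} (x y t : Fin m → ℝ) {i : ℕ} {z : ℂ} (hi : 1 ≤ i ∧ i ≤ m) (ξ : ℝ) :
    wexpo (shiftHeights x ξ) y t i z = ξ * (sgn z * z / 2) + wexpo x y t i z := by
  have h : ∀ j, j ≤ m → entry (shiftHeights x ξ) j = entry x j + ξ * j := by
    intro j hj
    unfold entry shiftHeights
    split_ifs with h
    · rw [Fin.val_mk, Nat.cast_sub h.1]
      ring
    · have : j = 0 := by omega
      simp [this]
  unfold wexpo cubic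
  rw [h i hi.2, h (i - 1) (by omega)]
  push_cast [hi.1]
  ring

namespace Admissible

variable {S : Data} {m : ℕ} {x y t : Fin m → ℝ} {C η : ℝ} (hS : Admissible S x y t C η)

include hS

theorem measurable_conjScalar (x y t : Fin m → ℝ) : Measurable (conjScalar S x y t) := by
  unfold conjScalar mexpSqrt
  refine Finset.measurable_fun_sum _ fun j _ => ?_
  have h1 := (continuous_cubic x y t j).measurable
  have h2 := (continuous_cubic x y t (j - 1)).measurable
  have h3 : Measurable ((S.Om₁ j).indicator fun _ => (1 : ℂ)) :=
    measurable_const.indicator (hS.dom.meas₁ j)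
  have h4 : Measurable ((S.Om₂ j).indicator fun _ => (1 : ℂ)) :=
    measurable_const.indicator (hS.dom.meas₂ j)
  fun_prop

theorem measurable_vecf (x y t : Fin m → ℝ) (k : Fin (m + 1)) : Measurable (vecf S x y t k) := by
  refine ((hS.measurable_conjScalar x y t).mul (measurable_mexp x y t _)).mul ?_
  unfold vecF
  split_ifs
  · exact hS.meas_A₂ 1
  · exact (hS.meas_A₁ _).add (hS.meas_A₁ _)
  · exact (hS.meas_A₂ _).add (hS.meas_A₂ _)

theorem measurable_vecg (x y t : Fin m → ℝ) (k : Fin (m + 1)) : Measurable (vecg S x y t k) := by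
  refine ((hS.measurable_conjScalar x y t).inv.mul (measurable_mexp x y t _).inv).mul ?_
  unfold vecG
  split_ifs
  · exact hS.meas_B₁ 1
  · exact (hS.meas_B₂ _).add (hS.meas_B₂ _)
  · exact (hS.meas_B₁ _).add (hS.meas_B₁ _)

/-- Where `f_k` does not vanish. -/
theorem vecf_ne_zero {x y t : Fin m → ℝ} {k : Fin (m + 1)} {z : ℂ} (h : vecf S x y t k z ≠ 0) :
    (∃ i, z ∈ S.Om₁ i ∧ wIdx k = oddOf i) ∨ ∃ i, z ∈ S.Om₂ i ∧ wIdx k = evenOf i := by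
  rcases exists_mem_or S z with ⟨i, hi⟩ | ⟨i, hi⟩ | ⟨h1, h2⟩
  · rw [hS.dom.vecf_of_mem₁ hi] at h
    exact Or.inl ⟨i, hi, by by_contra h'; exact h (if_neg h')⟩
  · rw [hS.dom.vecf_of_mem₂ hi] at h
    exact Or.inr ⟨i, hi, by by_contra h'; exact h (if_neg h')⟩
  · exact absurd (vecf_of_notMem h1 h2 x y t k) h

theorem vecg_ne_zero {x y t : Fin m → ℝ} {k : Fin (m + 1)} {z : ℂ} (h : vecg S x y t k z ≠ 0) :
    (∃ i, z ∈ S.Om₁ i ∧ wIdx k = evenOf i) ∨ ∃ i, z ∈ S.Om₂ i ∧ wIdx k = oddOf i := by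
  rcases exists_mem_or S z with ⟨i, hi⟩ | ⟨i, hi⟩ | ⟨h1, h2⟩
  · rw [hS.dom.vecg_of_mem₁ hi] at h
    exact Or.inl ⟨i, hi, by by_contra h'; exact h (if_neg h')⟩
  · rw [hS.dom.vecg_of_mem₂ hi] at h
    exact Or.inr ⟨i, hi, by by_contra h'; exact h (if_neg h')⟩
  · exact absurd (vecg_of_notMem h1 h2 x y t k) h

theorem norm_wfun_mul_le {b : ℂ} {i : ℕ} {z : ℂ} (h : z ∈ S.Om₁ i ∨ z ∈ S.Om₂ i) (hb : ‖b‖ ≤ C)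
    {p : Prop} [Decidable p] :
    ‖if p then wfun x y t i z * b else 0‖ * (1 + ‖z‖) ^ 6 ≤ C * C := by
  have hC := hS.C_nonneg
  split_ifs
  · have h1 := hS.w_le i z h
    rw [norm_mul]
    calc _ = (‖wfun x y t i z‖ * (1 + ‖z‖) ^ 6) * ‖b‖ := by ring
      _ ≤ C * C := mul_le_mul h1 hb (norm_nonneg _) hC
  · simp only [norm_zero, zero_mul]
    positivity

theorem vecf_le (k : Fin (m + 1)) (z : ℂ) : ‖vecf S x y t k z‖ * (1 + ‖z‖) ^ 6 ≤ C * C := by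
  have hC := hS.C_nonneg
  rcases exists_mem_or S z with ⟨i, hi⟩ | ⟨i, hi⟩ | ⟨h1, h2⟩
  · rw [hS.dom.vecf_of_mem₁ hi]
    exact hS.norm_wfun_mul_le (Or.inl hi) (hS.A_le i z (Or.inl hi))
  · rw [hS.dom.vecf_of_mem₂ hi]
    exact hS.norm_wfun_mul_le (Or.inr hi) (hS.A_le i z (Or.inr hi))
  · rw [vecf_of_notMem h1 h2, norm_zero, zero_mul]
    positivity

theorem vecg_le (k : Fin (m + 1)) (z : ℂ) : ‖vecg S x y t k z‖ * (1 + ‖z‖) ^ 6 ≤ C * C := by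
  have hC := hS.C_nonneg
  rcases exists_mem_or S z with ⟨i, hi⟩ | ⟨i, hi⟩ | ⟨h1, h2⟩
  · rw [hS.dom.vecg_of_mem₁ hi]
    exact hS.norm_wfun_mul_le (Or.inl hi) (hS.B_le i z (Or.inl hi))
  · rw [hS.dom.vecg_of_mem₂ hi]
    exact hS.norm_wfun_mul_le (Or.inr hi) (hS.B_le i z (Or.inr hi))
  · rw [vecg_of_notMem h1 h2, norm_zero, zero_mul]
    positivity

theorem re_sgn_mul_le {i : ℕ} {z : ℂ} (h : z ∈ S.Om₁ i ∨ z ∈ S.Om₂ i) :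
    (sgn z * z / 2).re ≤ -(η / 2) := by
  have hη := hS.dom.η_pos
  have key : (z.re < 0 → z.re ≤ -η) ∧ (¬z.re < 0 → η ≤ z.re) := by
    by_cases ho : Odd i <;> rcases h with h | h
    · have := hS.dom.side₁_odd i z h ho
      exact ⟨fun _ => this, fun h' => by linarith⟩
    · have := hS.dom.side₂_odd i z h ho
      exact ⟨fun h' => by linarith, fun _ => this⟩
    · have := hS.dom.side₁_even i z h ho
      exact ⟨fun h' => by linarith, fun _ => this⟩
    · have := hS.dom.side₂_even i z h ho
      exact ⟨fun _ => this, fun h' => by linarith⟩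
  unfold sgn
  split_ifs with h0
  · have := key.1 h0
    simp only [one_mul, Complex.div_ofNat_re]
    linarith
  · have := key.2 h0
    simp only [neg_mul, one_mul, Complex.div_ofNat_re, Complex.neg_re]
    linarith

/-- The integrable kernel `H` with its dependence on the shift of the heights. -/
def system : LaxSystem (Fin (m + 1)) S.ν where
  odd k := decide (Odd (wIdx k))
  idx k := wIdx k
  τ := S.τ
  f := vecf S x y t
  g := vecg S x y t
  e z := sgn z * z / 2
  X := gauge S m
  -- The summand `C * C` bounds a weight times `A` or `B`, `C` bounds the density and the separation
  -- constant, and `m` bounds the slope of the gauge. The rate is `η / 2` because the exponent is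
  -- half of `±z`.
  C := C * C + C + m
  η := η / 2
  meas_τ := hS.meas_τ
  meas_f := hS.measurable_vecf x y t
  meas_g := hS.measurable_vecg x y t
  meas_e := (measurable_sgn.mul measurable_id).div_const 2
  meas_X := by
    unfold gauge
    refine Finset.measurable_fun_sum _ fun j _ => Measurable.indicator (by fun_prop) ?_
    exact (hS.dom.meas₁ j).union (hS.dom.meas₂ j)
  C_nonneg := by
    have := hS.C_nonneg
    positivity
  η_pos := half_pos hS.dom.η_pos
  τ_le u := by
    have := hS.C_nonneg
    refine (hS.τ_le u).trans ?_
    have : 0 ≤ C * C + m := by positivity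
    linarith
  f_le k u := by
    have := hS.C_nonneg
    refine (hS.vecf_le k u).trans ?_
    have : 0 ≤ C + m := by positivity
    linarith
  g_le k u := by
    have := hS.C_nonneg
    refine (hS.vecg_le k u).trans ?_
    have : 0 ≤ C + m := by positivity
    linarith
  sep k u v hu hv := by
    have hC := hS.C_nonneg
    have hle : ∀ r : ℝ, 0 ≤ r → C * r ≤ (C * C + C + m) * r := fun r hr => by
      refine mul_le_mul_of_nonneg_right ?_ hr
      have : 0 ≤ C * C + m := by positivity
      linarith
    have h : 1 ≤ C * (((1 + ‖u‖) * (1 + ‖v‖)) * ‖u - v‖) := by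
      rw [← mul_assoc]
      -- If both points lie in `Ω₁` or both in `Ω₂`, the label of `k` would be odd and even. In the
      -- mixed cases the labels of the sets are equal or adjacent.
      rcases hS.vecf_ne_zero hu with ⟨i, hi, hki⟩ | ⟨i, hi, hki⟩ <;>
        rcases hS.vecg_ne_zero hv with ⟨j, hj, hkj⟩ | ⟨j, hj, hkj⟩
      · have h1 := odd_oddOf (hS.dom.label₁ i u hi).1
        rw [← hki, hkj] at h1
        exact absurd h1 (not_odd_evenOf j)
      · exact hS.sep i j u v hi hj (oddOf_eq_near (hki.symm.trans hkj)
          (hS.dom.label₁ i u hi).1 (hS.dom.label₂ j v hj).1)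
      · rw [norm_sub_rev, mul_comm (1 + ‖u‖)]
        exact hS.sep j i v u hj hi (evenOf_eq_near (hkj.symm.trans hki)
          (hS.dom.label₁ j v hj).1 (hS.dom.label₂ i u hi).1)
      · have h1 := odd_oddOf (hS.dom.label₂ j v hj).1
        rw [← hkj, hki] at h1
        exact absurd h1 (not_odd_evenOf i)
    rw [mul_assoc]
    exact h.trans (hle _ (by positivity))
  e_le u := by
    have := norm_nonneg u
    rw [norm_div, norm_mul, norm_sgn, Complex.norm_ofNat]
    linarith
  X_le u := by
    refine (norm_gauge_le S hS.dom u).trans ?_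
    have := hS.C_nonneg
    have h1 : (m : ℝ) ≤ C * C + C + m := by
      have : 0 ≤ C * C + C := by positivity
      linarith
    gcongr
  f_re k u hu := by
    rcases hS.vecf_ne_zero hu with ⟨i, hi, -⟩ | ⟨i, hi, -⟩
    · exact hS.re_sgn_mul_le (Or.inl hi)
    · exact hS.re_sgn_mul_le (Or.inr hi)
  g_re k u hu := by
    rcases hS.vecg_ne_zero hu with ⟨i, hi, -⟩ | ⟨i, hi, -⟩
    · exact hS.re_sgn_mul_le (Or.inl hi)
    · exact hS.re_sgn_mul_le (Or.inr hi)
  -- The slope `(2i - 1)/2` of the gauge is the midpoint of `i - 1` and `i`. Subtracting it from the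
  -- label of `k`, which is one of these two numbers, leaves `1/2` or `-1/2` in agreement with the
  -- sign of `e`.
  f_X k u hu := by
    rcases hS.vecf_ne_zero hu with ⟨i, hi, hk⟩ | ⟨i, hi, hk⟩
    · have h1 := (hS.dom.label₁ i u hi).1
      rw [hS.dom.gauge_of_mem (Or.inl hi), hS.dom.sgn₁ hi, hk, oddOf]
      split_ifs
      · ring
      · push_cast [h1]; ring
    · have h1 := (hS.dom.label₂ i u hi).1
      rw [hS.dom.gauge_of_mem (Or.inr hi), hS.dom.sgn₂ hi, hk, evenOf]
      split_ifs
      · push_cast [h1]; ring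
      · ring
  g_X k u hu := by
    rcases hS.vecg_ne_zero hu with ⟨i, hi, hk⟩ | ⟨i, hi, hk⟩
    · have h1 := (hS.dom.label₁ i u hi).1
      rw [hS.dom.gauge_of_mem (Or.inl hi), hS.dom.sgn₁ hi, hk, evenOf]
      split_ifs
      · push_cast [h1]; ring
      · ring
    · have h1 := (hS.dom.label₂ i u hi).1
      rw [hS.dom.gauge_of_mem (Or.inr hi), hS.dom.sgn₂ hi, hk, oddOf]
      split_ifs
      · ring
      · push_cast [h1]; ring
  orth k l u hkl := by
    rw [decide_eq_decide] at hkl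
    by_contra h
    rcases hS.vecf_ne_zero (left_ne_zero_of_mul h) with ⟨i, hi, hki⟩ | ⟨i, hi, hki⟩ <;>
      rcases hS.vecg_ne_zero (right_ne_zero_of_mul h) with ⟨j, hj, hkj⟩ | ⟨j, hj, hkj⟩
    · rw [hki, hkj] at hkl
      exact not_odd_evenOf j (hkl.1 (odd_oddOf (hS.dom.label₁ i u hi).1))
    · exact hS.dom.disj _ _ _ hi hj
    · exact hS.dom.disj _ _ _ hj hi
    · rw [hki, hkj] at hkl
      exact not_odd_evenOf i (hkl.2 (odd_oddOf (hS.dom.label₂ j u hj).1))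
  int := hS.int

theorem fξ_eq {ξ : ℝ} (hξ : 0 ≤ ξ) (k : Fin (m + 1)) (z : ℂ) :
    hS.system.fξ ξ k z = vecf S (shiftHeights x ξ) y t k z := by
  unfold LaxSystem.fξ
  rw [max_eq_left hξ]
  change Complex.exp (ξ * (sgn z * z / 2)) * vecf S x y t k z = _
  rcases exists_mem_or S z with ⟨i, hi⟩ | ⟨i, hi⟩ | ⟨h1, h2⟩
  · rw [hS.dom.vecf_of_mem₁ hi, hS.dom.vecf_of_mem₁ hi, wfun, wfun,
      wexpo_shift x y t (hS.dom.label₁ i z hi), Complex.exp_add]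
    split_ifs <;> ring
  · rw [hS.dom.vecf_of_mem₂ hi, hS.dom.vecf_of_mem₂ hi, wfun, wfun,
      wexpo_shift x y t (hS.dom.label₂ i z hi), Complex.exp_add]
    split_ifs <;> ring
  · rw [vecf_of_notMem h1 h2, vecf_of_notMem h1 h2, mul_zero]

theorem gξ_eq {ξ : ℝ} (hξ : 0 ≤ ξ) (k : Fin (m + 1)) (z : ℂ) :
    hS.system.gξ ξ k z = vecg S (shiftHeights x ξ) y t k z := by
  unfold LaxSystem.gξ
  rw [max_eq_left hξ]
  change Complex.exp (ξ * (sgn z * z / 2)) * vecg S x y t k z = _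
  rcases exists_mem_or S z with ⟨i, hi⟩ | ⟨i, hi⟩ | ⟨h1, h2⟩
  · rw [hS.dom.vecg_of_mem₁ hi, hS.dom.vecg_of_mem₁ hi, wfun, wfun,
      wexpo_shift x y t (hS.dom.label₁ i z hi), Complex.exp_add]
    split_ifs <;> ring
  · rw [hS.dom.vecg_of_mem₂ hi, hS.dom.vecg_of_mem₂ hi, wfun, wfun,
      wexpo_shift x y t (hS.dom.label₂ i z hi), Complex.exp_add]
    split_ifs <;> ring
  · rw [vecg_of_notMem h1 h2, vecg_of_notMem h1 h2, mul_zero]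

end Admissible

/-! ### The kernels of `K₁`, `K₂` and `K₁ K₂` after conjugation -/

theorem sum_ite_wIdx {m p : ℕ} (hp : p ≤ m) (P : Fin (m + 1) → Prop) [DecidablePred P]
    (hP : ∀ k, wIdx k = p → P k) (q : ℕ) (a b c : ℂ) :
    ∑ k with P k, (if wIdx k = p then a else 0) * (if wIdx k = q then b else 0) * c =
      if p = q then a * b * c else 0 := by
  obtain ⟨k₀, hk₀⟩ := exists_wIdx_eq hp
  rw [Finset.sum_eq_single_of_mem k₀ (Finset.mem_filter.2 ⟨Finset.mem_univ _, hP k₀ hk₀⟩)]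
  · rw [if_pos hk₀, hk₀]
    split_ifs <;> ring
  · intro k _ hk
    rw [if_neg (fun h => hk (wIdx_injective (h.trans hk₀.symm))), zero_mul, zero_mul]

theorem mratio_eq {m : ℕ} (x y t : Fin m → ℝ) (i : ℕ) (z : ℂ) : mratio x y t i z =
    Complex.exp ((if Odd i then 1 else -1) * (cubic x y t i z - cubic x y t (i - 1) z)) := by
  unfold mratio mexp
  split_ifs
  · rw [← Complex.exp_sub]; congr 1; ring
  · rw [← Complex.exp_sub]; congr 1; ring

theorem delta_add_delta {a b c : Prop} [Decidable a] [Decidable b] [Decidable c]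
    (h : c ↔ a ∨ b) (hab : ¬(a ∧ b)) :
    ((if a then 1 else 0) + (if b then 1 else 0) : ℂ) = if c then 1 else 0 := by
  by_cases ha : a <;> by_cases hb : b <;> simp_all

/-- The function with which the kernels are conjugated: `M_i^{1/2}` on `Ω_{1,i}` and `M_i^{-1/2}` on
`Ω_{2,i}`. -/
def conjFun (S : Data) {m : ℕ} (x y t : Fin m → ℝ) (z : ℂ) : ℂ :=
  Complex.exp (∑ j ∈ Finset.Icc 1 m, (S.Om₁ j ∪ S.Om₂ j).indicator (wexpo x y t j) z)

theorem conjFun_ne_zero (S : Data) {m : ℕ} (x y t : Fin m → ℝ) (z : ℂ) :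
    conjFun S x y t z ≠ 0 := Complex.exp_ne_zero _

namespace Domains

variable {S : Data} {m : ℕ} {η : ℝ} (hS : Domains S m η) {x y t : Fin m → ℝ}

include hS

theorem conjFun_of_mem {i : ℕ} {z : ℂ} (h : z ∈ S.Om₁ i ∨ z ∈ S.Om₂ i) :
    conjFun S x y t z = wfun x y t i z := by
  have hi : i ∈ Finset.Icc 1 m := by
    rw [Finset.mem_Icc]
    exact h.elim (hS.label₁ i z) (hS.label₂ i z)
  unfold conjFun wfun
  rw [Finset.sum_eq_single_of_mem i hi]
  · rw [Set.indicator_of_mem (s := S.Om₁ i ∪ S.Om₂ i) h]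
  · intro j _ hj
    refine Set.indicator_of_notMem (s := S.Om₁ j ∪ S.Om₂ j) ?_ _
    rintro (hj' | hj') <;> rcases h with h | h
    · exact hj (hS.disj₁ _ _ _ hj' h)
    · exact hS.disj _ _ _ hj' h
    · exact hS.disj _ _ _ h hj'
    · exact hj (hS.disj₂ _ _ _ hj' h)

theorem mratio_of_mem₁ {i : ℕ} {z : ℂ} (h : z ∈ S.Om₁ i) :
    mratio x y t i z = wfun x y t i z * wfun x y t i z := by
  rw [mratio_eq, wfun, ← Complex.exp_add, wexpo, hS.sgn₁ h]
  congr 1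
  ring

theorem inv_mratio_of_mem₂ {i : ℕ} {z : ℂ} (h : z ∈ S.Om₂ i) :
    (mratio x y t i z)⁻¹ = wfun x y t i z * wfun x y t i z := by
  rw [mratio_eq, wfun, ← Complex.exp_add, ← Complex.exp_neg, wexpo, hS.sgn₂ h]
  congr 1
  split_ifs <;> ring

/-- On `Ω_{1,i}` one has `M_i = w_i²`: one factor belongs to `f`, the other is the conjugation. The
factor `w_j(w)` in `g` is undone by the inverse conjugation. Off the domains both sides vanish. -/
theorem kerK₁_eq (u w : ℂ) : kerK₁ S x y t u w = conjFun S x y t u *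
    (∑ k : Fin (m + 1) with Odd (wIdx k), vecf S x y t k u * vecg S x y t k w * (u - w)⁻¹) *
      (conjFun S x y t w)⁻¹ := by
  by_cases hu : ∃ i, u ∈ S.Om₁ i
  · obtain ⟨i, hi⟩ := hu
    by_cases hw : ∃ j, w ∈ S.Om₂ j
    · obtain ⟨j, hj⟩ := hw
      have hil := hS.label₁ i u hi
      have hjl := hS.label₂ j w hj
      simp only [hS.vecf_of_mem₁ hi, hS.vecg_of_mem₂ hj]
      rw [sum_ite_wIdx ((oddOf_le i).trans hil.2) _ (fun k hk => hk ▸ odd_oddOf hil.1),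
        kerK₁, Finset.sum_eq_single_of_mem i (Finset.mem_Icc.2 hil),
        Finset.sum_eq_single_of_mem j (Finset.mem_Icc.2 hjl),
        delta_add_delta (oddOf_eq_iff hil.1 hjl.1), Set.indicator_of_mem hi,
        Set.indicator_of_mem hj, hS.mratio_of_mem₁ hi, hS.conjFun_of_mem (Or.inl hi),
        hS.conjFun_of_mem (Or.inr hj)]
      · have := Complex.exp_ne_zero (wexpo x y t j w)
        have : wfun x y t j w ≠ 0 := this
        split_ifs
        · field_simp
        · simp
      · rintro ⟨rfl, h⟩
        rcases neg_one_pow_eq_or ℤ i with h' | h' <;> omega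
      · intro j' _ hj'
        rw [Set.indicator_of_notMem fun h => hj' (hS.disj₂ _ _ _ h hj), mul_zero, zero_div]
      · intro i' _ hi'
        refine Finset.sum_eq_zero fun j' _ => ?_
        rw [Set.indicator_of_notMem fun h => hi' (hS.disj₁ _ _ _ h hi)]
        simp
    · push Not at hw
      rw [Finset.sum_eq_zero, mul_zero, zero_mul]
      · refine Finset.sum_eq_zero fun i' _ => Finset.sum_eq_zero fun j' _ => ?_
        rw [Set.indicator_of_notMem (hw j')]
        simp
      · intro k hk
        have hk := (Finset.mem_filter.1 hk).2
        have : vecg S x y t k w = 0 := by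
          rcases exists_mem_or S w with ⟨j, hj⟩ | ⟨j, hj⟩ | ⟨h1, h2⟩
          · rw [hS.vecg_of_mem₁ hj, if_neg fun h : wIdx k = evenOf j => not_odd_evenOf j (h ▸ hk)]
          · exact absurd hj (hw j)
          · exact vecg_of_notMem h1 h2 x y t k
        rw [this, mul_zero, zero_mul]
  · push Not at hu
    rw [Finset.sum_eq_zero, mul_zero, zero_mul]
    · refine Finset.sum_eq_zero fun i' _ => Finset.sum_eq_zero fun j' _ => ?_
      rw [Set.indicator_of_notMem (hu i')]
      simp
    · intro k hk
      have hk := (Finset.mem_filter.1 hk).2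
      have : vecf S x y t k u = 0 := by
        rcases exists_mem_or S u with ⟨j, hj⟩ | ⟨j, hj⟩ | ⟨h1, h2⟩
        · exact absurd hj (hu j)
        · rw [hS.vecf_of_mem₂ hj, if_neg fun h : wIdx k = evenOf j => not_odd_evenOf j (h ▸ hk)]
        · exact vecf_of_notMem h1 h2 x y t k
      rw [this, zero_mul, zero_mul]

theorem kerK₂_eq (u w : ℂ) : kerK₂ S x y t u w = conjFun S x y t u *
    (∑ k : Fin (m + 1) with ¬Odd (wIdx k), vecf S x y t k u * vecg S x y t k w * (u - w)⁻¹) *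
      (conjFun S x y t w)⁻¹ := by
  by_cases hu : ∃ i, u ∈ S.Om₂ i
  · obtain ⟨i, hi⟩ := hu
    by_cases hw : ∃ j, w ∈ S.Om₁ j
    · obtain ⟨j, hj⟩ := hw
      have hil := hS.label₂ i u hi
      have hjl := hS.label₁ j w hj
      simp only [hS.vecf_of_mem₂ hi, hS.vecg_of_mem₁ hj]
      rw [sum_ite_wIdx ((evenOf_le i).trans hil.2) _ (fun k hk => hk ▸ not_odd_evenOf i),
        kerK₂, Finset.sum_eq_single_of_mem i (Finset.mem_Icc.2 hil),
        Finset.sum_eq_single_of_mem j (Finset.mem_Icc.2 hjl),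
        delta_add_delta (evenOf_eq_iff hil.1 hjl.1), Set.indicator_of_mem hi,
        Set.indicator_of_mem hj, hS.inv_mratio_of_mem₂ hi, hS.conjFun_of_mem (Or.inr hi),
        hS.conjFun_of_mem (Or.inl hj)]
      · have := Complex.exp_ne_zero (wexpo x y t j w)
        have : wfun x y t j w ≠ 0 := this
        split_ifs
        · field_simp
        · simp
      · rintro ⟨rfl, h⟩
        rcases neg_one_pow_eq_or ℤ i with h' | h' <;> omega
      · intro j' _ hj'
        rw [Set.indicator_of_notMem fun h => hj' (hS.disj₁ _ _ _ h hj), mul_zero, zero_div]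
      · intro i' _ hi'
        refine Finset.sum_eq_zero fun j' _ => ?_
        rw [Set.indicator_of_notMem fun h => hi' (hS.disj₂ _ _ _ h hi)]
        simp
    · push Not at hw
      rw [Finset.sum_eq_zero, mul_zero, zero_mul]
      · refine Finset.sum_eq_zero fun i' _ => Finset.sum_eq_zero fun j' _ => ?_
        rw [Set.indicator_of_notMem (hw j')]
        simp
      · intro k hk
        have hk := (Finset.mem_filter.1 hk).2
        have : vecg S x y t k w = 0 := by
          rcases exists_mem_or S w with ⟨j, hj⟩ | ⟨j, hj⟩ | ⟨h1, h2⟩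
          · exact absurd hj (hw j)
          · rw [hS.vecg_of_mem₂ hj, if_neg]
            exact fun h => hk (h ▸ odd_oddOf (hS.label₂ j w hj).1)
          · exact vecg_of_notMem h1 h2 x y t k
        rw [this, mul_zero, zero_mul]
  · push Not at hu
    rw [Finset.sum_eq_zero, mul_zero, zero_mul]
    · refine Finset.sum_eq_zero fun i' _ => Finset.sum_eq_zero fun j' _ => ?_
      rw [Set.indicator_of_notMem (hu i')]
      simp
    · intro k hk
      have hk := (Finset.mem_filter.1 hk).2
      have : vecf S x y t k u = 0 := by
        rcases exists_mem_or S u with ⟨j, hj⟩ | ⟨j, hj⟩ | ⟨h1, h2⟩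
        · rw [hS.vecf_of_mem₁ hj, if_neg]
          exact fun h => hk (h ▸ odd_oddOf (hS.label₁ j u hj).1)
        · exact absurd hj (hu j)
        · exact vecf_of_notMem h1 h2 x y t k
      rw [this, zero_mul, zero_mul]

end Domains

/-- The choice made in `opH` is therefore irrelevant. -/
theorem HasKernel.unique {S : Data} {k : ℂ → ℂ → ℂ} {T T' : Lp ℂ 2 S.ν →L[ℂ] Lp ℂ 2 S.ν}
    (h : HasKernel S k T) (h' : HasKernel S k T') : T = T' := by
  ext1 φ
  refine Lp.ext ?_
  filter_upwards [h φ, h' φ] with u h1 h2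
  rw [h1.2, h2.2]

theorem trace_qBlock {m : ℕ} (s : Finset (Fin m)) (Y : Matrix (Fin (m + 1)) (Fin (m + 1)) ℂ) :
    (qBlock s Y).trace = ∑ i ∈ s, Y i.castSucc i.castSucc := by
  unfold Matrix.trace qBlock
  have := Finset.sum_coe_sort (s.map Fin.castSuccEmb) (fun k => Y k k)
  rw [Finset.sum_map] at this
  exact this

theorem trace_sBlock {m : ℕ} (s : Finset (Fin m)) (Y : Matrix (Fin (m + 1)) (Fin (m + 1)) ℂ) :
    (sBlock s Y).trace = Y.trace - (qBlock s Y).trace := by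
  have h1 : (sBlock s Y).trace = ∑ k with k ∉ s.map Fin.castSuccEmb, Y k k :=
    (Finset.sum_subtype (f := fun k => Y k k) _ (by simp) ).symm
  have h2 : (qBlock s Y).trace = ∑ k with k ∈ s.map Fin.castSuccEmb, Y k k :=
    (Finset.sum_subtype (f := fun k => Y k k) _ (by simp) ).symm
  rw [h1, h2, Matrix.trace,
    ← Finset.sum_filter_add_sum_filter_not Finset.univ (· ∈ s.map Fin.castSuccEmb)]
  simp [Matrix.diag]

/-- The diagonal entry with label `k ≤ m` occurs in the blocks `i = 1, …, k`, and the one with label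
`m + 1` in none of them. These multiplicities are the slopes `idx` of the Lax system. -/
theorem sum_trace_qBlock {m : ℕ} (Y : Matrix (Fin (m + 1)) (Fin (m + 1)) ℂ) :
    ∑ i : Fin m, (qBlock (Finset.Ici i) Y).trace = ∑ k, (wIdx k : ℂ) * Y k k := by
  simp only [trace_qBlock]
  rw [Fin.sum_univ_castSucc]
  have h0 : wIdx (Fin.last m) = 0 := by simp [wIdx]
  rw [h0, Nat.cast_zero, zero_mul, add_zero]
  have h1 : ∀ i : Fin m, ∑ j ∈ Finset.Ici i, Y j.castSucc j.castSucc =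
      ∑ j, if i ≤ j then Y j.castSucc j.castSucc else 0 := fun i => by
    rw [← Finset.sum_filter]
    congr 1
    ext j
    simp
  simp only [h1]
  rw [Finset.sum_comm]
  refine Finset.sum_congr rfl fun j _ => ?_
  rw [← Finset.sum_filter, Finset.sum_const, nsmul_eq_mul]
  have h2 : (Finset.univ.filter fun i => i ≤ j) = Finset.Iic j := by ext i; simp
  rw [h2, Fin.card_Iic]
  have h3 : wIdx j.castSucc = (j : ℕ) + 1 := by
    have := j.2
    simp [wIdx]
    omega
  rw [h3]

/-- The integrand is bounded below on compact sets, so these have finite measure. -/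
theorem sigmaFinite_of_integrable {ν : Measure ℂ}
    (h : Integrable (fun u : ℂ => ((1 + ‖u‖) ^ 8)⁻¹) ν) : SigmaFinite ν := by
  have : IsFiniteMeasureOnCompacts ν := by
    refine ⟨fun K hK => ?_⟩
    obtain ⟨R, hR⟩ := hK.isBounded.exists_norm_le
    have h1 := h.measure_ge_lt_top (ε := ((1 + max R 0) ^ 8)⁻¹) (by positivity)
    refine (measure_mono fun u hu => ?_).trans_lt h1
    have : ‖u‖ ≤ max R 0 := (hR u hu).trans (le_max_left _ _)
    simp only [Set.mem_ofPred_eq]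
    gcongr
  infer_instance

namespace Admissible

variable {S : Data} {m : ℕ} {x y t : Fin m → ℝ} {C η : ℝ} (hS : Admissible S x y t C η)

include hS

/-! ### Identification of `D`, `H` and `Y₁` with the kernels of the Lax system -/

section Shift

variable {ξ : ℝ} (hξ : 0 ≤ ξ)

include hξ

theorem kerK₁_mul_τ (u w : ℂ) : kerK₁ S (shiftHeights x ξ) y t u w * S.τ w =
    conjFun S (shiftHeights x ξ) y t u * (hS.system.part true Multiplier.one ξ).1 u w *
      (conjFun S (shiftHeights x ξ) y t w)⁻¹ := by
  rw [hS.dom.kerK₁_eq, LaxSystem.part_apply]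
  simp only [hS.fξ_eq hξ, hS.gξ_eq hξ]
  have h1 : ∀ k, hS.system.odd k = decide (Odd (wIdx k)) := fun k => rfl
  have h2 : hS.system.τ = S.τ := rfl
  have h3 : ∀ a b, Multiplier.one.φ a b = 1 := fun _ _ => rfl
  simp only [h1, h2, h3, decide_eq_true_eq, Finset.mul_sum, Finset.sum_mul]
  exact Finset.sum_congr rfl fun k _ => by ring

theorem kerK₂_mul_τ (u w : ℂ) : kerK₂ S (shiftHeights x ξ) y t u w * S.τ w =
    conjFun S (shiftHeights x ξ) y t u * (hS.system.part false Multiplier.one ξ).1 u w *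
      (conjFun S (shiftHeights x ξ) y t w)⁻¹ := by
  rw [hS.dom.kerK₂_eq, LaxSystem.part_apply]
  simp only [hS.fξ_eq hξ, hS.gξ_eq hξ]
  have h1 : ∀ k, hS.system.odd k = decide (Odd (wIdx k)) := fun k => rfl
  have h2 : hS.system.τ = S.τ := rfl
  have h3 : ∀ a b, Multiplier.one.φ a b = 1 := fun _ _ => rfl
  simp only [h1, h2, h3, decide_eq_false_iff_not, Finset.mul_sum, Finset.sum_mul]
  exact Finset.sum_congr rfl fun k _ => by ring

theorem part_true_eq_zero_left {u : ℂ} (hu : u ∉ omega₁ S) (w : ℂ) :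
    (hS.system.part true Multiplier.one ξ).1 u w = 0 := by
  rw [LaxSystem.part_apply]
  refine Finset.sum_eq_zero fun k hk => ?_
  have hk' : Odd (wIdx k) := of_decide_eq_true (Finset.mem_filter.1 hk).2
  have : vecf S (shiftHeights x ξ) y t k u = 0 := by
    by_contra h
    rcases hS.vecf_ne_zero h with ⟨i, hi, -⟩ | ⟨i, hi, h2⟩
    · exact hu (Set.mem_iUnion.2 ⟨i, hi⟩)
    · exact not_odd_evenOf i (h2 ▸ hk')
  rw [hS.fξ_eq hξ, this]
  simp

theorem part_true_eq_zero_right (u : ℂ) {w : ℂ} (hw : w ∉ omega₂ S) :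
    (hS.system.part true Multiplier.one ξ).1 u w = 0 := by
  rw [LaxSystem.part_apply]
  refine Finset.sum_eq_zero fun k hk => ?_
  have hk' : Odd (wIdx k) := of_decide_eq_true (Finset.mem_filter.1 hk).2
  have : vecg S (shiftHeights x ξ) y t k w = 0 := by
    by_contra h
    rcases hS.vecg_ne_zero h with ⟨i, hi, h2⟩ | ⟨i, hi, -⟩
    · exact not_odd_evenOf i (h2 ▸ hk')
    · exact hw (Set.mem_iUnion.2 ⟨i, hi⟩)
  rw [hS.gξ_eq hξ, this]
  simp

theorem kerK₁_mul_kerK₂ (u v w : ℂ) : kerK₁ S (shiftHeights x ξ) y t u w *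
      kerK₂ S (shiftHeights x ξ) y t w v * S.τ w =
    ((hS.system.part true Multiplier.one ξ).1 u w * (hS.system.part false Multiplier.one ξ).1 w v) *
      (conjFun S (shiftHeights x ξ) y t u * (conjFun S (shiftHeights x ξ) y t v)⁻¹ *
        (S.τ v)⁻¹) := by
  have h1 := hS.kerK₁_mul_τ hξ u w
  have h2 := hS.kerK₂_mul_τ hξ w v
  have h3 := hS.τ_ne v
  have h4 := conjFun_ne_zero S (shiftHeights x ξ) y t w
  -- Kernels in the ring contain the density of their second variable, whereas `K₂` does not; the
  -- surplus `τ(v)` is divided out.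
  rw [← eq_mul_inv_iff_mul_eq₀ h3] at h2
  rw [mul_right_comm, h1, h2]
  field_simp

theorem kerK_mul_τ [SFinite S.ν] (u v : ℂ) : kerK S (shiftHeights x ξ) y t u v * S.τ v =
    conjFun S (shiftHeights x ξ) y t u * (hS.system.prodKer ξ).1 u v *
      (conjFun S (shiftHeights x ξ) y t v)⁻¹ := by
  have h3 := hS.τ_ne v
  unfold kerK LaxSystem.prodKer
  simp only [hS.kerK₁_mul_kerK₂ hξ]
  rw [integral_mul_const, Ker.mul_apply, setIntegral_eq_integral_of_forall_compl_eq_zero]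
  · field_simp
  · intro w hw
    rw [hS.part_true_eq_zero_right hξ u hw, zero_mul]

/-- The densities are distributed over the columns. The conjugating factors multiply row `i` and
divide column `i`, so they cancel in the determinant. -/
theorem fredIntegrand_eq [SFinite S.ν] (n : ℕ) (u : Fin n → ℂ) :
    fredIntegrand S (shiftHeights x ξ) y t n u = (hS.system.prodKer ξ).minorDet u := by
  unfold fredIntegrand Ker.minorDet
  have h1 := Matrix.det_mul_row (fun j => S.τ (u j))
    (Matrix.of fun i j => kerK S (shiftHeights x ξ) y t (u i) (u j))
  rw [mul_comm, ← h1]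
  have h2 : (Matrix.of fun i j => S.τ (u j) *
      (Matrix.of fun i j => kerK S (shiftHeights x ξ) y t (u i) (u j)) i j) =
      Matrix.of fun i j => conjFun S (shiftHeights x ξ) y t (u i) *
        (Matrix.of fun i j => (conjFun S (shiftHeights x ξ) y t (u j))⁻¹ *
          (Matrix.of fun i j => (hS.system.prodKer ξ).1 (u i) (u j)) i j) i j := by
    ext i j
    simp only [Matrix.of_apply]
    rw [mul_comm, hS.kerK_mul_τ hξ]
    ring
  rw [h2, Matrix.det_mul_column, Matrix.det_mul_row, ← mul_assoc, ← Finset.prod_mul_distrib,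
    Finset.prod_eq_one, one_mul]
  intro i _
  exact mul_inv_cancel₀ (conjFun_ne_zero S _ y t (u i))

/-- A variable outside `Ω₁` produces a zero row. Integrals over `Ω₁ⁿ` may therefore be extended to
the whole space, as the abstract theory requires. -/
theorem minorDet_eq_zero [SFinite S.ν] {n : ℕ} {u : Fin n → ℂ}
    (hu : u ∉ Set.univ.pi fun _ => omega₁ S) : (hS.system.prodKer ξ).minorDet u = 0 := by
  rw [Set.mem_univ_pi] at hu
  push Not at hu
  obtain ⟨i, hi⟩ := hu
  refine Matrix.det_eq_zero_of_row_eq_zero i fun j => ?_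
  rw [Matrix.of_apply, LaxSystem.prodKer, Ker.mul_apply]
  simp [hS.part_true_eq_zero_left hξ hi]

theorem integral_fredIntegrand [SigmaFinite S.ν] (n : ℕ) :
    ∫ u, fredIntegrand S (shiftHeights x ξ) y t n u ∂fredMeasure S n =
      (hS.system.prodKer ξ).minorInt n := by
  unfold fredMeasure Ker.minorInt
  simp only [hS.fredIntegrand_eq hξ]
  rw [← Measure.restrict_pi_pi, setIntegral_eq_integral_of_forall_compl_eq_zero]
  exact fun u hu => hS.minorDet_eq_zero hξ hu

theorem fredDet_eq [SigmaFinite S.ν] :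
    fredDet S (shiftHeights x ξ) y t = (hS.system.prodKer ξ).fdet := by
  unfold fredDet Ker.fdet
  simp only [hS.integral_fredIntegrand hξ]
  rfl

theorem kerH_mul_τ [SFinite S.ν] (u v : ℂ) : kerH S (shiftHeights x ξ) y t u v * S.τ v =
    (hS.system.full Multiplier.one ξ).1 u v := by
  rw [LaxSystem.full_apply]
  have h2 : hS.system.τ = S.τ := rfl
  have h3 : ∀ a b, Multiplier.one.φ a b = 1 := fun _ _ => rfl
  simp only [hS.fξ_eq hξ, hS.gξ_eq hξ, h2, h3]
  unfold kerH
  by_cases h : u = v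
  · simp [h]
  · rw [if_neg h, Finset.sum_div, Finset.sum_mul, one_mul]
    exact Finset.sum_congr rfl fun k _ => by ring

theorem hasKernel [SFinite S.ν] : HasKernel S (kerH S (shiftHeights x ξ) y t)
    (hS.system.full Multiplier.one ξ).op := by
  intro φ
  filter_upwards [(hS.system.full Multiplier.one ξ).coeFn_op φ] with u hu
  have h : ∀ v, kerH S (shiftHeights x ξ) y t u v * φ v * S.τ v =
      (hS.system.full Multiplier.one ξ).1 u v * φ v := fun v => by
    rw [← hS.kerH_mul_τ hξ]; ring
  simp only [h]
  exact ⟨Ker.integrable_row_mul _ u φ, hu⟩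

theorem opH_eq [SFinite S.ν] :
    opH S (shiftHeights x ξ) y t = (hS.system.full Multiplier.one ξ).op := by
  have h : ∃ T, HasKernel S (kerH S (shiftHeights x ξ) y t) T := ⟨_, hS.hasKernel hξ⟩
  rw [opH, dif_pos h]
  exact h.choose_spec.unique (hS.hasKernel hξ)

omit hξ in
/-- A bound for `f_k` and `g_k` by a constant multiple of the weight. -/
theorem norm_le_weight {r : ℝ} {u : ℂ} (hr : 0 ≤ r) (h : r * (1 + ‖u‖) ^ 6 ≤
    hS.system.C * Real.exp (-hS.system.η * max ξ 0)) : r ≤ hS.system.C * hS.system.w.P u := by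
  have h1 : Real.exp (-hS.system.η * max ξ 0) ≤ 1 := by
    rw [Real.exp_le_one_iff]
    have := mul_nonneg hS.system.η_pos.le (le_max_right ξ 0)
    linarith
  change r ≤ hS.system.C * ((1 + ‖u‖) ^ 4)⁻¹
  rw [← div_eq_mul_inv, le_div_iff₀ (by positivity)]
  calc r * (1 + ‖u‖) ^ 4 ≤ r * (1 + ‖u‖) ^ 6 := by
        gcongr
        · linarith [norm_nonneg u]
        · norm_num
    _ ≤ hS.system.C * 1 := h.trans (mul_le_mul_of_nonneg_left h1 hS.system.C_nonneg)
    _ = _ := mul_one _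

theorem norm_vecf_le (k : Fin (m + 1)) (u : ℂ) : ‖vecf S (shiftHeights x ξ) y t k u‖ ≤
    hS.system.C * hS.system.w.P u := by
  rw [← hS.fξ_eq hξ]
  exact hS.norm_le_weight (norm_nonneg _) (hS.system.fξ_le ξ k u)

theorem norm_vecg_le (k : Fin (m + 1)) (u : ℂ) : ‖vecg S (shiftHeights x ξ) y t k u‖ ≤
    hS.system.C * hS.system.w.P u := by
  rw [← hS.gξ_eq hξ]
  exact hS.norm_le_weight (norm_nonneg _) (hS.system.gξ_le ξ k u)

omit hξ in
theorem weight_le_one (u : ℂ) : hS.system.w.P u ≤ 1 := by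
  change ((1 + ‖u‖) ^ 4)⁻¹ ≤ 1
  exact inv_le_one_of_one_le₀ (one_le_pow₀ (by linarith [norm_nonneg u]))

theorem memLp_vecf [SFinite S.ν] (k : Fin (m + 1)) : MemLp (vecf S (shiftHeights x ξ) y t k) 2 S.ν :=
  Ker.memLp_of_le (w := hS.system.w) (hS.measurable_vecf _ y t k) _ (hS.norm_vecf_le hξ k)

variable [SigmaFinite S.ν] (h0 : (hS.system.prodKer ξ).fdet ≠ 0)

include h0

/-- The inverse of `1 - H`. -/
theorem one_sub_op_mul : (1 - opH S (shiftHeights x ξ) y t) * (1 + (hS.system.resKer ξ).op) = 1 := by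
  rw [hS.opH_eq hξ]
  exact Ker.one_sub_op_mul (hS.system.resKer_eq h0)

theorem mul_one_sub_op : (1 + (hS.system.resKer ξ).op) * (1 - opH S (shiftHeights x ξ) y t) = 1 := by
  rw [hS.opH_eq hξ]
  exact Ker.mul_one_sub_op (hS.system.resKer_eq' h0)

theorem wellDefined : WellDefined S (shiftHeights x ξ) y t where
  kernel u v := by
    simp only [hS.kerK₁_mul_kerK₂ hξ]
    exact ((Ker.integrable_mul _ _ u v).mul_const _).integrableOn
  term n := by
    unfold fredMeasure
    rw [← Measure.restrict_pi_pi]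
    refine Integrable.integrableOn (Integrable.congr ((hS.system.prodKer ξ).integrable_minorDet n)
      (Eventually.of_forall fun u => ?_))
    exact (hS.fredIntegrand_eq hξ n u).symm
  series := by
    obtain ⟨C', hC0, hC⟩ := (hS.system.prodKer ξ).exists_bound
    refine Summable.of_nonneg_of_le (fun n => ?_) (fun n => ?_)
      (summable_hadamardConst _ (mul_nonneg hC0 (Ker.integral_sq_nonneg hS.system.w)))
    · exact mul_nonneg (by positivity) (integral_nonneg fun _ => norm_nonneg _)
    · have h1 : ∫ u, ‖fredIntegrand S (shiftHeights x ξ) y t n u‖ ∂fredMeasure S n ≤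
          hadamardConst n * (C' * ∫ s, hS.system.w.P s ^ 2 ∂S.ν) ^ n := by
        unfold fredMeasure
        simp only [hS.fredIntegrand_eq hξ]
        rw [← Measure.restrict_pi_pi]
        refine (setIntegral_le_integral ((hS.system.prodKer ξ).integrable_minorDet n).norm
          (Eventually.of_forall fun _ => norm_nonneg _)).trans ?_
        exact (hS.system.prodKer ξ).integral_norm_minorDet_le hC0 hC n
      calc _ ≤ 1 / (n.factorial : ℝ) *
            (hadamardConst n * (C' * ∫ s, hS.system.w.P s ^ 2 ∂S.ν) ^ n) := by gcongr
        _ = _ := by ring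
  f_two := hS.memLp_vecf hξ
  f_top k := memLp_top_of_bound (hS.measurable_vecf _ y t k).aestronglyMeasurable hS.system.C
    (Eventually.of_forall fun u => (hS.norm_vecf_le hξ k u).trans
      (mul_le_of_le_one_right hS.system.C_nonneg (hS.weight_le_one u)))
  g_two k :=
    Ker.memLp_of_le (w := hS.system.w) (hS.measurable_vecg _ y t k) _ (hS.norm_vecg_le hξ k)
  g_top k := memLp_top_of_bound (hS.measurable_vecg _ y t k).aestronglyMeasurable hS.system.C
    (Eventually.of_forall fun u => (hS.norm_vecg_le hξ k u).trans
      (mul_le_of_le_one_right hS.system.C_nonneg (hS.weight_le_one u)))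
  bounded := by
    rw [hS.opH_eq hξ]
    exact hS.hasKernel hξ
  invertible := ⟨⟨_, _, hS.one_sub_op_mul hξ h0, hS.mul_one_sub_op hξ h0⟩, rfl⟩

/-- Since `f_k g_k = 0` pointwise, the identity in `(1 - H)⁻¹ = 1 + Q` does not contribute on the
diagonal of `Y₁`. -/
theorem matY₁_diag (k : Fin (m + 1)) : matY₁ S (shiftHeights x ξ) y t k k =
    Ker.tr (hS.system.rankOne ξ k * hS.system.resKer ξ) := by
  have hinv : Ring.inverse (1 - opH S (shiftHeights x ξ) y t) = 1 + (hS.system.resKer ξ).op :=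
    Ring.inverse_unit ⟨_, _, hS.one_sub_op_mul hξ h0, hS.mul_one_sub_op hξ h0⟩
  rw [Ker.tr_mul_comm, matY₁, Matrix.of_apply, hinv, toL2, dif_pos (hS.memLp_vecf hξ k)]
  set φ := (hS.memLp_vecf hξ k).toLp (vecf S (shiftHeights x ξ) y t k) with hφ
  have hφ' : φ =ᵐ[S.ν] vecf S (shiftHeights x ξ) y t k := (hS.memLp_vecf hξ k).coeFn_toLp
  refine integral_congr_ae ?_
  filter_upwards [hφ', (hS.system.resKer ξ).coeFn_op φ, Lp.coeFn_add φ ((hS.system.resKer ξ).op φ)]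
    with s h1 h2 h3
  have h4 : (1 + (hS.system.resKer ξ).op) φ = φ + (hS.system.resKer ξ).op φ := rfl
  have h5 := hS.system.orthξ ξ (k := k) (l := k) s rfl
  rw [hS.fξ_eq hξ, hS.gξ_eq hξ] at h5
  have h6 : ∫ v, (hS.system.resKer ξ).1 s v * φ v ∂S.ν =
      ∫ v, (hS.system.resKer ξ).1 s v * vecf S (shiftHeights x ξ) y t k v ∂S.ν := by
    refine integral_congr_ae ?_
    filter_upwards [hφ'] with v hv
    rw [hv]
  have h7 : hS.system.τ = S.τ := rfl
  rw [h4, h3, Pi.add_apply, h1, h2, h6, Ker.mul_apply]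
  simp only [LaxSystem.rankOne_apply, hS.fξ_eq hξ, hS.gξ_eq hξ, h7]
  have h8 : ∀ v, (hS.system.resKer ξ).1 s v * (vecf S (shiftHeights x ξ) y t k v *
      vecg S (shiftHeights x ξ) y t k s * S.τ s) = ((hS.system.resKer ξ).1 s v *
        vecf S (shiftHeights x ξ) y t k v) * (vecg S (shiftHeights x ξ) y t k s * S.τ s) :=
    fun v => by ring
  simp only [h8]
  rw [integral_mul_const]
  linear_combination S.τ s * h5

theorem sum_trace_qBlock :
    ∑ i : Fin m, (qBlock (Finset.Ici i) (matY₁ S (shiftHeights x ξ) y t)).trace =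
      ∑ k, hS.system.idx k * Ker.tr (hS.system.rankOne ξ k * hS.system.resKer ξ) := by
  rw [KPZDet.sum_trace_qBlock]
  exact Finset.sum_congr rfl fun k _ => by rw [hS.matY₁_diag hξ h0]; rfl

/-- Complementary diagonal blocks have traces adding up to `Tr Y₁`, which vanishes by
`LaxSystem.sum_tr_rankOne`. -/
theorem sum_trace_sBlock :
    ∑ i : Fin m, (sBlock (Finset.Ici i) (matY₁ S (shiftHeights x ξ) y t)).trace =
      -∑ i : Fin m, (qBlock (Finset.Ici i) (matY₁ S (shiftHeights x ξ) y t)).trace := by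
  have h1 : (matY₁ S (shiftHeights x ξ) y t).trace = 0 := by
    rw [← hS.system.sum_tr_rankOne h0]
    exact Finset.sum_congr rfl fun k _ => hS.matY₁_diag hξ h0 k
  rw [← Finset.sum_neg_distrib]
  exact Finset.sum_congr rfl fun i _ => by rw [trace_sBlock, h1, zero_sub]

end Shift

/-- The trace formula for admissible data. -/
theorem fredDet_eq_exp
    (hD : ∀ ξ : ℝ, 0 ≤ ξ → fredDet S (shiftHeights x ξ) y t ≠ 0) :
    (∀ ξ : ℝ, 0 ≤ ξ → WellDefined S (shiftHeights x ξ) y t) ∧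
    IntegrableOn (fun ξ : ℝ => ∑ i : Fin m,
      (qBlock (Finset.Ici i) (matY₁ S (shiftHeights x ξ) y t)).trace) (Set.Ioi 0) ∧
    IntegrableOn (fun ξ : ℝ => ∑ i : Fin m,
      (sBlock (Finset.Ici i) (matY₁ S (shiftHeights x ξ) y t)).trace) (Set.Ioi 0) ∧
    fredDet S x y t = Complex.exp (∫ ξ in Set.Ioi (0 : ℝ), ∑ i : Fin m,
      (qBlock (Finset.Ici i) (matY₁ S (shiftHeights x ξ) y t)).trace) ∧
    fredDet S x y t = Complex.exp (-∫ ξ in Set.Ioi (0 : ℝ), ∑ i : Fin m,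
      (sBlock (Finset.Ici i) (matY₁ S (shiftHeights x ξ) y t)).trace) := by
  have := sigmaFinite_of_integrable hS.int
  have hD' : ∀ ξ : ℝ, 0 ≤ ξ → (hS.system.prodKer ξ).fdet ≠ 0 := fun ξ hξ => by
    rw [← hS.fredDet_eq hξ]
    exact hD ξ hξ
  obtain ⟨h1, h2⟩ := hS.system.fdet_eq_exp hD'
  have hq : Set.EqOn (fun ξ : ℝ => ∑ i : Fin m,
      (qBlock (Finset.Ici i) (matY₁ S (shiftHeights x ξ) y t)).trace) (fun ξ => ∑ k,
        hS.system.idx k * Ker.tr (hS.system.rankOne ξ k * hS.system.resKer ξ)) (Set.Ioi 0) :=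
    fun ξ hξ => hS.sum_trace_qBlock (Set.mem_Ioi.1 hξ).le (hD' ξ (Set.mem_Ioi.1 hξ).le)
  have hs : Set.EqOn (fun ξ : ℝ => ∑ i : Fin m,
      (sBlock (Finset.Ici i) (matY₁ S (shiftHeights x ξ) y t)).trace) (fun ξ => -∑ i : Fin m,
      (qBlock (Finset.Ici i) (matY₁ S (shiftHeights x ξ) y t)).trace) (Set.Ioi 0) :=
    fun ξ hξ => hS.sum_trace_sBlock (Set.mem_Ioi.1 hξ).le (hD' ξ (Set.mem_Ioi.1 hξ).le)
  have h3 := h1.congr_fun hq.symm measurableSet_Ioi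
  have h4 : fredDet S x y t = Complex.exp (∫ ξ in Set.Ioi (0 : ℝ), ∑ i : Fin m,
      (qBlock (Finset.Ici i) (matY₁ S (shiftHeights x ξ) y t)).trace) := by
    have hx : shiftHeights x 0 = x := by ext i; simp [shiftHeights]
    rw [setIntegral_congr_fun measurableSet_Ioi hq, ← h2, ← hS.fredDet_eq le_rfl, hx]
  refine ⟨fun ξ hξ => hS.wellDefined hξ (hD' ξ hξ), h3,
    IntegrableOn.congr_fun h3.neg hs.symm measurableSet_Ioi, h4, ?_⟩
  rw [setIntegral_congr_fun measurableSet_Ioi hs, integral_neg, neg_neg]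
  exact h4

end Admissible

/-! ### Decay of the cubic exponentials along a curve going to infinity -/

/-- After division by `‖z‖³` the translation and the lower order terms disappear. -/
theorem tendsto_cubic_div {l : Filter ℝ} {z : ℝ → ℂ} {ω : ℂ}
    (hz : Tendsto (fun r => ‖z r‖) l atTop) (hω : Tendsto (fun r => z r / ‖z r‖) l (𝓝 ω))
    (s T Y X : ℂ) :
    Tendsto (fun r => (T * (z r + s) ^ 3 + Y * (z r + s) ^ 2 + X * (z r + s)) / (‖z r‖ : ℂ) ^ 3)
      l (𝓝 (T * ω ^ 3)) := by
  have h0 : Tendsto (fun r => (‖z r‖ : ℂ)⁻¹) l (𝓝 0) := by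
    have := (Complex.continuous_ofReal.tendsto 0).comp (tendsto_inv_atTop_zero.comp hz)
    simpa [Function.comp_def] using this
  have h1 : Tendsto (fun r => z r / ‖z r‖ + s * (‖z r‖ : ℂ)⁻¹) l (𝓝 ω) := by
    simpa using hω.add (h0.const_mul s)
  have h2 := (((h1.pow 3).const_mul T).add (((h1.pow 2).mul h0).const_mul Y)).add
    ((h1.mul (h0.pow 2)).const_mul X)
  simp only [mul_zero, add_zero, zero_pow two_ne_zero] at h2
  refine h2.congr' ?_
  filter_upwards [hz.eventually_gt_atTop 0] with r hr
  have : (‖z r‖ : ℂ) ≠ 0 := by exact_mod_cast hr.ne'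
  field_simp

theorem tendsto_quadratic_div {l : Filter ℝ} {z : ℝ → ℂ} {ω : ℂ}
    (hz : Tendsto (fun r => ‖z r‖) l atTop) (hω : Tendsto (fun r => z r / ‖z r‖) l (𝓝 ω))
    (s Y X : ℂ) :
    Tendsto (fun r => (Y * (z r + s) ^ 2 + X * (z r + s)) / (‖z r‖ : ℂ) ^ 2) l (𝓝 (Y * ω ^ 2)) := by
  have h0 : Tendsto (fun r => (‖z r‖ : ℂ)⁻¹) l (𝓝 0) := by
    have := (Complex.continuous_ofReal.tendsto 0).comp (tendsto_inv_atTop_zero.comp hz)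
    simpa [Function.comp_def] using this
  have h1 : Tendsto (fun r => z r / ‖z r‖ + s * (‖z r‖ : ℂ)⁻¹) l (𝓝 ω) := by
    simpa using hω.add (h0.const_mul s)
  have h2 := ((h1.pow 2).const_mul Y).add ((h1.mul h0).const_mul X)
  simp only [mul_zero, add_zero] at h2
  refine h2.congr' ?_
  filter_upwards [hz.eventually_gt_atTop 0] with r hr
  have : (‖z r‖ : ℂ) ≠ 0 := by exact_mod_cast hr.ne'
  field_simp

theorem pow_six_mul_exp_neg_le {κ N : ℝ} (hκ : 0 < κ) (hN : 0 ≤ N) :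
    N ^ 6 * Real.exp (-(κ * N)) ≤ 720 / κ ^ 6 := by
  have h1 := Real.pow_div_factorial_le_exp (κ * N) (by positivity) 6
  have h2 : (Nat.factorial 6 : ℝ) = 720 := by norm_num [Nat.factorial]
  rw [h2, div_le_iff₀ (by norm_num), mul_pow] at h1
  rw [Real.exp_neg, ← div_eq_mul_inv, div_le_div_iff₀ (Real.exp_pos _) (by positivity)]
  linarith

/-- Eventually `Re p ≤ -κ‖z‖^n ≤ -κ‖z‖` with `κ = -Re L / 2`, and an exponential in `‖z‖` dominates
the sixth power. The factor `3` bounds `1 + ‖z + s‖` by `3‖z‖` once `‖z‖` exceeds `1` and `‖s‖`. -/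
theorem eventually_exp_mul_le {l : Filter ℝ} {z p : ℝ → ℂ} {L : ℂ} {n : ℕ} (hn : n ≠ 0)
    (hz : Tendsto (fun r => ‖z r‖) l atTop) (s : ℂ)
    (hp : Tendsto (fun r => p r / (‖z r‖ : ℂ) ^ n) l (𝓝 L)) (hL : L.re < 0) :
    ∃ M, ∀ᶠ r in l, Real.exp (p r).re * (1 + ‖z r + s‖) ^ 6 ≤ M := by
  set κ := -L.re / 2 with hκ
  have hκ0 : 0 < κ := by linarith
  refine ⟨3 ^ 6 * (720 / κ ^ 6), ?_⟩
  have h1 : ∀ᶠ r in l, (p r / (‖z r‖ : ℂ) ^ n).re < -κ :=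
    ((Complex.continuous_re.tendsto L).comp hp).eventually_lt_const (by linarith)
  filter_upwards [h1, hz.eventually_ge_atTop 1, hz.eventually_ge_atTop ‖s‖] with r h2 h3 h4
  have h5 : (p r).re ≤ -(κ * ‖z r‖) := by
    rw [← Complex.ofReal_pow, Complex.div_ofReal_re, div_lt_iff₀ (by positivity)] at h2
    have h6 : ‖z r‖ ≤ ‖z r‖ ^ n := le_self_pow₀ h3 hn
    nlinarith [mul_le_mul_of_nonneg_left h6 hκ0.le]
  have h6 : 1 + ‖z r + s‖ ≤ 3 * ‖z r‖ := by
    have := norm_add_le (z r) s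
    linarith
  calc Real.exp (p r).re * (1 + ‖z r + s‖) ^ 6
      ≤ Real.exp (-(κ * ‖z r‖)) * (3 * ‖z r‖) ^ 6 := by gcongr
    _ = 3 ^ 6 * (‖z r‖ ^ 6 * Real.exp (-(κ * ‖z r‖))) := by ring
    _ ≤ _ := by
      have := pow_six_mul_exp_neg_le hκ0 (norm_nonneg (z r))
      gcongr

theorem exists_le_of_eventually_cocompact {h : ℝ → ℝ} (hc : Continuous h) {M : ℝ}
    (hM : ∀ᶠ r in cocompact ℝ, h r ≤ M) : ∃ C, ∀ r, h r ≤ C := by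
  obtain ⟨K, hK, hKM⟩ := mem_cocompact.1 hM
  obtain ⟨B, hB⟩ := (hK.image hc).bddAbove
  refine ⟨max M B, fun r => ?_⟩
  by_cases hr : r ∈ K
  · exact (hB ⟨r, hr, rfl⟩).trans (le_max_right _ _)
  · exact (hKM hr : h r ≤ M).trans (le_max_left _ _)

/-! ### Geometry of the contours and decay along them -/

namespace Contours

variable {m : ℕ} {σ : ℝ} (Γ : Contours m σ)

/-- The parametrization of the base graph. -/
def pt (r : ℝ) : ℂ := (Γ.φ r : ℂ) + r * Complex.I

theorem pt_im (r : ℝ) : (Γ.pt r).im = r := by simp [pt]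

theorem pt_re (r : ℝ) : (Γ.pt r).re = Γ.φ r := by simp [pt]

theorem continuous_φ : Continuous Γ.φ := Γ.lipschitz.continuous

theorem continuous_pt : Continuous Γ.pt := by
  have := Γ.continuous_φ
  unfold pt
  fun_prop

theorem mem_graph {s : ℝ} {z : ℂ} (hz : z ∈ Γ.graph s) : z = Γ.pt z.im + s := by
  have hz' : z.re = Γ.φ z.im + s := hz
  apply Complex.ext
  · rw [Complex.add_re, Γ.pt_re, Complex.ofReal_re]; exact hz'
  · rw [Complex.add_im, Γ.pt_im, Complex.ofReal_im, add_zero]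

theorem abs_le_norm_pt (r s : ℝ) : |r| ≤ ‖Γ.pt r + s‖ := by
  have := Complex.abs_im_le_norm (Γ.pt r + s)
  rwa [Complex.add_im, Γ.pt_im, Complex.ofReal_im, add_zero] at this

theorem tendsto_norm_pt_cocompact : Tendsto (fun r => ‖Γ.pt r‖) (cocompact ℝ) atTop := by
  refine tendsto_atTop_mono (fun r => ?_) (tendsto_norm_cocompact_atTop (E := ℝ))
  simpa using Γ.abs_le_norm_pt r 0

/-- The two directions of the contour at infinity lie in the open half plane with `σ Re z > 0` and
in the sectors of decay of the cubic exponentials. -/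
structure Good (quad : Prop) : Prop where
  sign : σ = 1 ∨ σ = -1
  re_bot : 0 < σ * Real.cos Γ.θbot
  re_top : 0 < σ * Real.cos Γ.θtop
  cube_bot : σ * Real.cos (3 * Γ.θbot) < 0
  cube_top : σ * Real.cos (3 * Γ.θtop) < 0
  sq_bot : quad → 0 < σ * Real.cos (2 * Γ.θbot)
  sq_top : quad → 0 < σ * Real.cos (2 * Γ.θtop)

theorem exp_pow_re (θ : ℝ) (n : ℕ) : (Complex.exp (θ * Complex.I) ^ n).re = Real.cos (n * θ) := by
  rw [← Complex.exp_nat_mul, ← mul_assoc, ← Complex.ofReal_natCast, ← Complex.ofReal_mul,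
    Complex.exp_ofReal_mul_I_re]

variable {Γ} {quad : Prop} (hΓ : Γ.Good quad)

include hΓ

theorem Good.tendsto_re_atTop (s : ℝ) :
    Tendsto (fun r => σ * (Γ.φ r + s)) (cocompact ℝ) atTop := by
  have key : ∀ (l : Filter ℝ) (θ : ℝ), l ≤ cocompact ℝ → 0 < σ * Real.cos θ →
      Tendsto (fun r : ℝ => Γ.pt r / ‖Γ.pt r‖) l (𝓝 (Complex.exp (θ * Complex.I))) →
      Tendsto (fun r => σ * (Γ.φ r + s)) l atTop := by
    intro l θ hl hθ h
    have h1 := ((Complex.continuous_re.tendsto _).comp h).const_mul σ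
    rw [Complex.exp_ofReal_mul_I_re] at h1
    have h2 := Γ.tendsto_norm_pt_cocompact.mono_left hl
    have h3 := tendsto_atTop_add_const_right l (σ * s) (h2.atTop_mul_pos hθ h1)
    refine h3.congr' ?_
    filter_upwards [h2.eventually_gt_atTop 0] with r hr
    simp only [Function.comp_apply, Complex.div_ofReal_re, Γ.pt_re]
    field_simp
  rw [_root_.cocompact_eq_atBot_atTop, tendsto_sup]
  constructor
  · exact key _ _ (by rw [_root_.cocompact_eq_atBot_atTop]; exact le_sup_left) hΓ.re_bot Γ.tendsto_bot
  · exact key _ _ (by rw [_root_.cocompact_eq_atBot_atTop]; exact le_sup_right) hΓ.re_top Γ.tendsto_top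

/-- A positive continuous function tending to infinity at both ends attains a positive minimum. -/
theorem Good.exists_re_ge (s : ℝ) (hs : ∀ r, 0 < σ * (Γ.φ r + s)) :
    ∃ η, 0 < η ∧ ∀ z ∈ Γ.graph s, η ≤ σ * z.re := by
  have hc : Continuous fun r => σ * (Γ.φ r + s) := by
    have := Γ.continuous_φ
    fun_prop
  obtain ⟨r₀, h⟩ := hc.exists_forall_le (hΓ.tendsto_re_atTop s)
  refine ⟨_, hs r₀, fun z hz => ?_⟩
  have hz' : z.re = Γ.φ z.im + s := hz
  rw [hz']
  exact h z.im

/-- For `T < 0` the cubic term decays in the given sectors. For `T = 0`, the case of equal times,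
the quadratic term has to decay; this is the reason for the smaller sectors. -/
theorem Good.exists_exp_mul_le (s T Y X : ℝ) (hT : T ≤ 0) (hY : T = 0 → quad ∧ 0 < Y) :
    ∃ M, ∀ z ∈ Γ.graph s, Real.exp ((-σ / 2 * (T * z ^ 3 + Y * z ^ 2 + X * z) : ℂ)).re *
      (1 + ‖z‖) ^ 6 ≤ M := by
  have key : ∀ (l : Filter ℝ) (θ : ℝ), l ≤ cocompact ℝ → σ * Real.cos (3 * θ) < 0 →
      (quad → 0 < σ * Real.cos (2 * θ)) →
      Tendsto (fun r : ℝ => Γ.pt r / ‖Γ.pt r‖) l (𝓝 (Complex.exp (θ * Complex.I))) →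
      ∃ M, ∀ᶠ r in l, Real.exp ((-σ / 2 * (T * (Γ.pt r + s) ^ 3 + Y * (Γ.pt r + s) ^ 2 +
        X * (Γ.pt r + s)) : ℂ)).re * (1 + ‖Γ.pt r + s‖) ^ 6 ≤ M := by
    intro l θ hl h3 h2 h
    have hz := Γ.tendsto_norm_pt_cocompact.mono_left hl
    rcases hT.lt_or_eq with hT | hT
    · refine eventually_exp_mul_le three_ne_zero hz s (L := -σ / 2 * (T * Complex.exp (θ * Complex.I) ^ 3)) ?_ ?_
      · simpa only [mul_div_assoc] using
          (tendsto_cubic_div hz h s T Y X).const_mul (-σ / 2 : ℂ)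
      · have : (-σ / 2 * (T * Complex.exp (θ * Complex.I) ^ 3) : ℂ) =
            ((-σ / 2 * T : ℝ) : ℂ) * Complex.exp (θ * Complex.I) ^ 3 := by push_cast; ring
        rw [this, Complex.re_ofReal_mul, exp_pow_re]
        push_cast
        nlinarith
    · obtain ⟨hq, hY⟩ := hY hT
      have h2 := h2 hq
      refine eventually_exp_mul_le two_ne_zero hz s (L := -σ / 2 * (Y * Complex.exp (θ * Complex.I) ^ 2)) ?_ ?_
      · simpa only [mul_div_assoc, hT, Complex.ofReal_zero, zero_mul, zero_add] using
          (tendsto_quadratic_div hz h s Y X).const_mul (-σ / 2 : ℂ)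
      · have : (-σ / 2 * (Y * Complex.exp (θ * Complex.I) ^ 2) : ℂ) =
            ((-σ / 2 * Y : ℝ) : ℂ) * Complex.exp (θ * Complex.I) ^ 2 := by push_cast; ring
        rw [this, Complex.re_ofReal_mul, exp_pow_re]
        push_cast
        nlinarith
  obtain ⟨M₁, h₁⟩ := key _ _ (by rw [_root_.cocompact_eq_atBot_atTop]; exact le_sup_left)
    hΓ.cube_bot hΓ.sq_bot Γ.tendsto_bot
  obtain ⟨M₂, h₂⟩ := key _ _ (by rw [_root_.cocompact_eq_atBot_atTop]; exact le_sup_right)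
    hΓ.cube_top hΓ.sq_top Γ.tendsto_top
  have hc : ∀ z : ℝ → ℂ, Continuous z → Continuous fun r => Real.exp ((-σ / 2 * (T * (z r + s) ^ 3 +
      Y * (z r + s) ^ 2 + X * (z r + s)) : ℂ)).re * (1 + ‖z r + s‖) ^ 6 := fun z hz => by fun_prop
  obtain ⟨M, hM⟩ := exists_le_of_eventually_cocompact (M := max M₁ M₂)
    (h := fun r => Real.exp ((-σ / 2 * (T * (Γ.pt r + s) ^ 3 + Y * (Γ.pt r + s) ^ 2 +
        X * (Γ.pt r + s)) : ℂ)).re * (1 + ‖Γ.pt r + s‖) ^ 6)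
    (hc _ Γ.continuous_pt)
    (by
      rw [_root_.cocompact_eq_atBot_atTop, eventually_sup]
      exact ⟨h₁.mono fun r hr => hr.trans (le_max_left _ _),
        h₂.mono fun r hr => hr.trans (le_max_right _ _)⟩)
  refine ⟨M, fun z hz => ?_⟩
  rw [Γ.mem_graph hz]
  exact hM z.im

omit hΓ

variable (Γ)

theorem isClosed_graph (s : ℝ) : IsClosed (Γ.graph s) := by
  have := Γ.continuous_φ
  have := Complex.continuous_im
  have := Complex.continuous_re
  unfold graph
  exact isClosed_eq (by fun_prop) (by fun_prop)

theorem measurableSet_Gam (j : ℕ) : MeasurableSet (Γ.Gam j) :=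
  ((Γ.isClosed_graph _).union (Γ.isClosed_graph _)).measurableSet

/-- The Lipschitz condition prevents two translates of the graph from approaching each other, even
at infinity. -/
theorem abs_sub_le {s s' : ℝ} {u v : ℂ} (hu : u ∈ Γ.graph s) (hv : v ∈ Γ.graph s') :
    |s - s'| ≤ (1 + Γ.K) * ‖u - v‖ := by
  have hu' : u.re = Γ.φ u.im + s := hu
  have hv' : v.re = Γ.φ v.im + s' := hv
  have h1 := Γ.lipschitz.dist_le_mul u.im v.im
  rw [Real.dist_eq, Real.dist_eq] at h1
  have h2 : |u.re - v.re| ≤ ‖u - v‖ := by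
    rw [← Complex.sub_re]; exact Complex.abs_re_le_norm _
  have h3 : |u.im - v.im| ≤ ‖u - v‖ := by
    rw [← Complex.sub_im]; exact Complex.abs_im_le_norm _
  have h4 : s - s' = (u.re - v.re) - (Γ.φ u.im - Γ.φ v.im) := by rw [hu', hv']; ring
  rw [h4]
  calc _ ≤ |u.re - v.re| + |Γ.φ u.im - Γ.φ v.im| := abs_sub _ _
    _ ≤ ‖u - v‖ + Γ.K * ‖u - v‖ := by
      have := mul_le_mul_of_nonneg_left h3 Γ.K.2
      exact add_le_add h2 (h1.trans this)
    _ = _ := by ring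

/-- The translates with different labels are different. -/
theorem shift_ne {i j : ℕ} (hi : 1 ≤ i) (hij : i < j) (hj : j ≤ m) {s s' : ℝ}
    (hs : s = Γ.plus i ∨ s = Γ.minus i) (hs' : s' = Γ.plus j ∨ s' = Γ.minus j) : s ≠ s' := by
  have hp : ∀ k, 1 ≤ k → k ≤ m → σ * Γ.plus k ≤ σ * Γ.plus 1 := fun k hk hkm => by
    rcases hk.eq_or_lt with rfl | hk
    · exact le_rfl
    · exact (Γ.plus_lt 1 k le_rfl hk hkm).le
  have hm : ∀ k, 1 ≤ k → k ≤ m → σ * Γ.plus 1 ≤ σ * Γ.minus k := fun k hk hkm => by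
    rw [Γ.plus_one]
    rcases hk.eq_or_lt with rfl | hk
    · exact le_rfl
    · exact (Γ.minus_lt 1 k le_rfl hk hkm).le
  have hj1 : 1 < j := by omega
  have h1 := Γ.plus_lt 1 j le_rfl hj1 hj
  have h2 := Γ.minus_lt 1 j le_rfl hj1 hj
  rw [← Γ.plus_one] at h2
  intro h
  rcases hs with hs | hs <;> rcases hs' with hs' | hs' <;> rw [hs, hs'] at h
  · exact (Γ.plus_lt i j hi hij hj).ne (by rw [h])
  · exact ((hp i hi (by omega)).trans_lt h2).ne (by rw [h])
  · exact (h1.trans_le (hm i hi (by omega))).ne (by rw [h])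
  · exact (Γ.minus_lt i j hi hij hj).ne (by rw [h])

/-- Contours with different labels are at positive distance. -/
theorem exists_sep {i j : ℕ} (hi : 1 ≤ i) (hij : i < j) (hj : j ≤ m) :
    ∀ᶠ B in atTop, ∀ u ∈ Γ.Gam i, ∀ v ∈ Γ.Gam j, 1 ≤ B * ‖u - v‖ := by
  have key : ∀ s s', (s = Γ.plus i ∨ s = Γ.minus i) → (s' = Γ.plus j ∨ s' = Γ.minus j) →
      ∀ᶠ B in atTop, ∀ u ∈ Γ.graph s, ∀ v ∈ Γ.graph s', 1 ≤ B * ‖u - v‖ := by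
    intro s s' hs hs'
    have h0 : 0 < |s - s'| := abs_pos.2 (sub_ne_zero.2 (Γ.shift_ne hi hij hj hs hs'))
    filter_upwards [eventually_ge_atTop ((1 + Γ.K) / |s - s'|)] with B hB u hu v hv
    have h1 := Γ.abs_sub_le hu hv
    calc (1 : ℝ) = |s - s'| / |s - s'| := (div_self h0.ne').symm
      _ ≤ (1 + Γ.K) * ‖u - v‖ / |s - s'| := by gcongr
      _ = (1 + Γ.K) / |s - s'| * ‖u - v‖ := by ring
      _ ≤ _ := by gcongr
  filter_upwards [key _ _ (Or.inl rfl) (Or.inl rfl), key _ _ (Or.inl rfl) (Or.inr rfl),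
    key _ _ (Or.inr rfl) (Or.inl rfl), key _ _ (Or.inr rfl) (Or.inr rfl)] with B h1 h2 h3 h4 u hu v hv
  rcases hu with hu | hu <;> rcases hv with hv | hv
  · exact h1 u hu v hv
  · exact h2 u hu v hv
  · exact h3 u hu v hv
  · exact h4 u hu v hv

theorem disjoint_Gam {i j : ℕ} (hi : 1 ≤ i ∧ i ≤ m) (hj : 1 ≤ j ∧ j ≤ m) {z : ℂ}
    (hzi : z ∈ Γ.Gam i) (hzj : z ∈ Γ.Gam j) : i = j := by
  rcases lt_trichotomy i j with h | h | h
  · obtain ⟨B, hB⟩ := (Γ.exists_sep hi.1 h hj.2).exists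
    have := hB z hzi z hzj
    norm_num at this
  · exact h
  · obtain ⟨B, hB⟩ := (Γ.exists_sep hj.1 h hi.2).exists
    have := hB z hzj z hzi
    norm_num at this

/-- The modulus of a point is at least its imaginary part `r` in absolute value, so comparison with
`1/(1 + r²)` suffices. -/
theorem integrable_graphMeasure (s : ℝ) :
    Integrable (fun u : ℂ => ((1 + ‖u‖) ^ 8)⁻¹) (Γ.graphMeasure s) := by
  have hφ := Γ.continuous_φ
  have hc : Continuous fun r : ℝ => ((Γ.φ r + s : ℝ) : ℂ) + r * Complex.I := by fun_prop
  have hm : Measurable fun u : ℂ => ((1 + ‖u‖) ^ 8)⁻¹ := by fun_prop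
  unfold graphMeasure
  rw [integrable_map_measure hm.aestronglyMeasurable hc.measurable.aemeasurable]
  refine integrable_inv_one_add_sq.mono' (hm.comp hc.measurable).aestronglyMeasurable
    (Eventually.of_forall fun r => ?_)
  have h1 : |r| ≤ ‖((Γ.φ r + s : ℝ) : ℂ) + r * Complex.I‖ := by
    have := Complex.abs_im_le_norm (((Γ.φ r + s : ℝ) : ℂ) + r * Complex.I)
    simpa using this
  simp only [Function.comp_apply]
  rw [Real.norm_of_nonneg (by positivity)]
  gcongr
  calc 1 + r ^ 2 ≤ (1 + |r|) ^ 2 := by nlinarith [sq_abs r, abs_nonneg r]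
    _ ≤ (1 + |r|) ^ 8 := pow_le_pow_right₀ (by linarith [abs_nonneg r]) (by norm_num)
    _ ≤ _ := by gcongr

theorem integrable_measure : Integrable (fun u : ℂ => ((1 + ‖u‖) ^ 8)⁻¹) Γ.measure := by
  unfold measure
  rw [integrable_add_measure, integrable_finsetSum_measure, integrable_finsetSum_measure]
  exact ⟨fun _ _ => Γ.integrable_graphMeasure _, fun _ _ => Γ.integrable_graphMeasure _⟩

end Contours

/-! ### The data of the KPZ fixed point are admissible -/

theorem cos_pos_of_shift {θ : ℝ} (n : ℕ) (h1 : -(Real.pi / 2) + n * (2 * Real.pi) < θ)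
    (h2 : θ < Real.pi / 2 + n * (2 * Real.pi)) : 0 < Real.cos θ := by
  rw [← Real.cos_sub_nat_mul_two_pi θ n]
  exact Real.cos_pos_of_mem_Ioo ⟨by linarith, by linarith⟩

theorem cos_neg_of_shift {θ : ℝ} (n : ℕ) (h1 : Real.pi / 2 + n * (2 * Real.pi) < θ)
    (h2 : θ < 3 * Real.pi / 2 + n * (2 * Real.pi)) : Real.cos θ < 0 := by
  rw [← Real.cos_sub_nat_mul_two_pi θ n]
  exact Real.cos_neg_of_pi_div_two_lt_of_lt (by linarith) (by linarith)

theorem entry_of_mem {m : ℕ} {α : Type*} [Zero α] (v : Fin m → α) {j : ℕ} (h : 1 ≤ j ∧ j ≤ m) :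
    entry v j = v ⟨j - 1, by omega⟩ := dif_pos h

theorem entry_zero {m : ℕ} {α : Type*} [Zero α] (v : Fin m → α) : entry v 0 = 0 :=
  dif_neg (by omega)

/-- The leading coefficient of the exponent of `m_j / m_{j-1}` is not positive; if it vanishes,
there are equal times. -/
theorem entry_sub_entry_le {m : ℕ} {y t : Fin m → ℝ} (ht : ∀ i, t i < 0)
    (hty : ∀ i j, i < j → t j ≤ t i ∧ (t i = t j → y i < y j)) {j : ℕ} (hj : 1 ≤ j ∧ j ≤ m) :
    entry t j - entry t (j - 1) ≤ 0 ∧ (entry t j - entry t (j - 1) = 0 →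
      (∃ i j, i < j ∧ t i = t j) ∧ 0 < entry y j - entry y (j - 1)) := by
  rcases hj.1.eq_or_lt with rfl | h1
  -- The predecessor of `t_1` is the default value `0`, so the difference is `t_1 < 0` and the
  -- equality case cannot occur.
  · have := ht ⟨0, by omega⟩
    rw [show entry t (1 - 1) = 0 from entry_zero t, entry_of_mem t hj, sub_zero]
    exact ⟨this.le, fun h => absurd h this.ne⟩
  · have hj' : 1 ≤ j - 1 ∧ j - 1 ≤ m := by omega
    rw [entry_of_mem t hj, entry_of_mem t hj', entry_of_mem y hj, entry_of_mem y hj']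
    have hlt : (⟨j - 1 - 1, by omega⟩ : Fin m) < ⟨j - 1, by omega⟩ := by
      rw [Fin.mk_lt_mk]
      omega
    obtain ⟨h2, h3⟩ := hty _ _ hlt
    exact ⟨by linarith, fun h => ⟨⟨_, _, hlt, by linarith⟩, by linarith [h3 (by linarith)]⟩⟩

namespace Contours

variable {m : ℕ} {σ : ℝ} {Γ : Contours m σ} {quad : Prop} (hΓ : Γ.Good quad)

include hΓ

/-- Stating an estimate for all large constants allows finitely many of them to be satisfied by one
common constant. -/
theorem Good.eventually_re : ∀ᶠ B in atTop, ∀ j ∈ Finset.Icc 1 m, ∀ z ∈ Γ.Gam j,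
    1 ≤ B * (σ * z.re) := by
  rw [eventually_all_finset]
  intro j hj
  rw [Finset.mem_Icc] at hj
  obtain ⟨η, h0, h⟩ := hΓ.exists_re_ge (Γ.plus j) fun r => (Γ.half_plane j r hj.1 hj.2).1
  obtain ⟨η', h0', h'⟩ := hΓ.exists_re_ge (Γ.minus j) fun r => (Γ.half_plane j r hj.1 hj.2).2
  filter_upwards [eventually_ge_atTop η⁻¹, eventually_ge_atTop η'⁻¹] with B h1 h2 z hz
  rcases hz with hz | hz
  · have := mul_le_mul h1 (h z hz) h0.le ((inv_pos.2 h0).le.trans h1)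
    rwa [inv_mul_cancel₀ h0.ne'] at this
  · have := mul_le_mul h2 (h' z hz) h0'.le ((inv_pos.2 h0').le.trans h2)
    rwa [inv_mul_cancel₀ h0'.ne'] at this

theorem Good.re_pos {j : ℕ} (hj : 1 ≤ j ∧ j ≤ m) {z : ℂ} (hz : z ∈ Γ.Gam j) : 0 < σ * z.re := by
  obtain ⟨B, hB, hB0⟩ := (hΓ.eventually_re.and (eventually_gt_atTop 0)).exists
  exact pos_of_mul_pos_right (zero_lt_one.trans_le (hB j (Finset.mem_Icc.2 hj) z hz)) hB0.le

theorem Good.sgn_eq {j : ℕ} (hj : 1 ≤ j ∧ j ≤ m) {z : ℂ} (hz : z ∈ Γ.Gam j) : sgn z = -σ := by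
  have := hΓ.re_pos hj hz
  unfold sgn
  rcases hΓ.sign with h | h <;> rw [h] at this ⊢
  · rw [if_neg (by linarith)]; simp
  · rw [if_pos (by linarith)]; simp

theorem Good.eventually_wfun_le {x y t : Fin m → ℝ}
    (hty : ∀ j, 1 ≤ j ∧ j ≤ m → entry t j - entry t (j - 1) ≤ 0 ∧
      (entry t j - entry t (j - 1) = 0 → quad ∧ 0 < entry y j - entry y (j - 1))) :
    ∀ᶠ B in atTop, ∀ j ∈ Finset.Icc 1 m, ∀ z ∈ Γ.Gam j,
      ‖wfun x y t j z‖ * (1 + ‖z‖) ^ 6 ≤ B := by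
  rw [eventually_all_finset]
  intro j hj
  rw [Finset.mem_Icc] at hj
  obtain ⟨h1, h2⟩ := hty j hj
  obtain ⟨M, hM⟩ := hΓ.exists_exp_mul_le (Γ.plus j) _ _ (entry x j - entry x (j - 1)) h1 h2
  obtain ⟨M', hM'⟩ := hΓ.exists_exp_mul_le (Γ.minus j) _ _ (entry x j - entry x (j - 1)) h1 h2
  filter_upwards [eventually_ge_atTop M, eventually_ge_atTop M'] with B hB hB' z hz
  have h3 : wexpo x y t j z = (-σ / 2 * ((entry t j - entry t (j - 1) : ℝ) * z ^ 3 +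
      (entry y j - entry y (j - 1) : ℝ) * z ^ 2 + (entry x j - entry x (j - 1) : ℝ) * z) : ℂ) := by
    rw [wexpo, hΓ.sgn_eq hj hz, cubic, cubic]
    push_cast
    ring
  rw [wfun, Complex.norm_exp, h3]
  rcases hz with hz | hz
  · exact (hM z hz).trans hB
  · exact (hM' z hz).trans hB'

omit hΓ

variable (Γ)

theorem eventually_sep : ∀ᶠ B in atTop, ∀ i ∈ Finset.Icc 1 m, ∀ j ∈ Finset.Icc 1 m, i < j →
    ∀ u ∈ Γ.Gam i, ∀ v ∈ Γ.Gam j, 1 ≤ B * ‖u - v‖ := by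
  rw [eventually_all_finset]
  intro i hi
  rw [eventually_all_finset]
  intro j hj
  by_cases h : i < j
  · filter_upwards [Γ.exists_sep (Finset.mem_Icc.1 hi).1 h (Finset.mem_Icc.1 hj).2] with B hB _
    exact hB
  · exact Eventually.of_forall fun B h' => absurd h' h

end Contours

section KPZ

variable {m : ℕ} (ζ : Fin (m - 1) → ℂ) (CL : Contours m (-1)) (CR : Contours m 1)

theorem measurableSet_kpzOm₁ (j : ℕ) : MeasurableSet (kpzOm₁ CL CR j) := by
  have h : kpzOm₁ CL CR j = {_z | 1 ≤ j} ∩ ({_z | j ≤ m} ∩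
      if Odd j then CL.Gam j else CR.Gam j) := by
    unfold kpzOm₁
    split_ifs <;> rfl
  rw [h]
  refine (MeasurableSet.const _).inter ((MeasurableSet.const _).inter ?_)
  split_ifs
  · exact CL.measurableSet_Gam j
  · exact CR.measurableSet_Gam j

theorem measurableSet_kpzOm₂ (j : ℕ) : MeasurableSet (kpzOm₂ CL CR j) := by
  have h : kpzOm₂ CL CR j = {_z | 1 ≤ j} ∩ ({_z | j ≤ m} ∩
      if Odd j then CR.Gam j else CL.Gam j) := by
    unfold kpzOm₂
    split_ifs <;> rfl
  rw [h]
  refine (MeasurableSet.const _).inter ((MeasurableSet.const _).inter ?_)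
  split_ifs
  · exact CR.measurableSet_Gam j
  · exact CL.measurableSet_Gam j

theorem measurable_kpzQ (j : ℕ) : Measurable (kpzQ ζ CL CR j) := by
  have h1 := measurableSet_kpzOm₁ CL CR j
  have h2 := measurableSet_kpzOm₂ CL CR j
  unfold kpzQ
  split_ifs <;>
    exact (measurable_const.indicator h1).add (measurable_const.indicator h2)

theorem measurable_kpzP (j : ℕ) : Measurable (kpzP ζ CL CR j) := by
  have h1 := ((CL.isClosed_graph (CL.plus j)).union (CR.isClosed_graph (CR.plus j))).measurableSet
  have h2 := ((CL.isClosed_graph (CL.minus j)).union (CR.isClosed_graph (CR.minus j))).measurableSet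
  unfold kpzP
  split_ifs
  · exact measurable_const
  · exact (measurable_const.indicator h1).add (measurable_const.indicator h2)

theorem exists_norm_kpzQ_le (j : ℕ) : ∃ M, ∀ z, ‖kpzQ ζ CL CR j z‖ ≤ M := by
  unfold kpzQ
  split_ifs <;> exact ⟨_, fun z => norm_add_le_of_le (norm_indicator_le_norm_self (fun _ => _) z)
    (norm_indicator_le_norm_self (fun _ => _) z)⟩

theorem exists_norm_kpzP_le (j : ℕ) : ∃ M, ∀ z, ‖kpzP ζ CL CR j z‖ ≤ M := by
  unfold kpzP
  split_ifs
  · exact ⟨_, fun _ => le_rfl⟩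
  · exact ⟨_, fun z => norm_add_le_of_le (norm_indicator_le_norm_self (fun _ => _) z)
      (norm_indicator_le_norm_self (fun _ => _) z)⟩

variable {CL CR} {quad : Prop} (hL : CL.Good quad) (hR : CR.Good quad)

include hL hR

theorem kpz_domains : ∃ B > 0, Domains (kpzData ζ CL CR) m B⁻¹ := by
  obtain ⟨B, h1, h2, hB⟩ :=
    (hL.eventually_re.and (hR.eventually_re.and (eventually_gt_atTop 0))).exists
  have hl : ∀ j, 1 ≤ j ∧ j ≤ m → ∀ z ∈ CL.Gam j, z.re ≤ -B⁻¹ := fun j hj z hz => by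
    have := h1 j (Finset.mem_Icc.2 hj) z hz
    rw [le_neg, inv_le_iff_one_le_mul₀ hB, mul_comm]
    linarith
  have hr : ∀ j, 1 ≤ j ∧ j ≤ m → ∀ z ∈ CR.Gam j, B⁻¹ ≤ z.re := fun j hj z hz => by
    have := h2 j (Finset.mem_Icc.2 hj) z hz
    rw [inv_le_iff_one_le_mul₀ hB, mul_comm]
    linarith
  have hlr : ∀ i j, 1 ≤ i ∧ i ≤ m → 1 ≤ j ∧ j ≤ m → ∀ z ∈ CL.Gam i, z ∉ CR.Gam j :=
    fun i j hi hj z hz hz' => by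
      have := hl i hi z hz
      have := hr j hj z hz'
      have := inv_pos.2 hB
      linarith
  refine ⟨B, hB, inv_pos.2 hB, measurableSet_kpzOm₁ CL CR, measurableSet_kpzOm₂ CL CR,
    fun j z hz => ⟨hz.1, hz.2.1⟩, fun j z hz => ⟨hz.1, hz.2.1⟩, ?_, ?_, ?_, ?_, ?_, ?_, ?_⟩
  · rintro i j z ⟨hi, hi', h⟩ ⟨hj, hj', h'⟩
    split_ifs at h h'
    · exact CL.disjoint_Gam ⟨hi, hi'⟩ ⟨hj, hj'⟩ h h'
    · exact absurd h' (hlr i j ⟨hi, hi'⟩ ⟨hj, hj'⟩ z h)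
    · exact absurd h (hlr j i ⟨hj, hj'⟩ ⟨hi, hi'⟩ z h')
    · exact CR.disjoint_Gam ⟨hi, hi'⟩ ⟨hj, hj'⟩ h h'
  · rintro i j z ⟨hi, hi', h⟩ ⟨hj, hj', h'⟩
    split_ifs at h h'
    · exact CR.disjoint_Gam ⟨hi, hi'⟩ ⟨hj, hj'⟩ h h'
    · exact absurd h (hlr j i ⟨hj, hj'⟩ ⟨hi, hi'⟩ z h')
    · exact absurd h' (hlr i j ⟨hi, hi'⟩ ⟨hj, hj'⟩ z h)
    · exact CL.disjoint_Gam ⟨hi, hi'⟩ ⟨hj, hj'⟩ h h'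
  -- `Ω_{1,i}` and `Ω_{2,j}` lie in the same half plane only if `i` and `j` have opposite parity,
  -- whereas contours in one half plane meet only if their labels agree.
  · rintro i j z ⟨hi, hi', h⟩ ⟨hj, hj', h'⟩
    split_ifs at h h' with ho ho' ho'
    · exact hlr i j ⟨hi, hi'⟩ ⟨hj, hj'⟩ z h h'
    · have := CL.disjoint_Gam ⟨hi, hi'⟩ ⟨hj, hj'⟩ h h'
      exact ho' (this ▸ ho)
    · have := CR.disjoint_Gam ⟨hi, hi'⟩ ⟨hj, hj'⟩ h h'
      exact ho (this ▸ ho')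
    · exact hlr j i ⟨hj, hj'⟩ ⟨hi, hi'⟩ z h' h
  · rintro j z ⟨hj, hj', h⟩ ho
    rw [if_pos ho] at h
    exact hl j ⟨hj, hj'⟩ z h
  · rintro j z ⟨hj, hj', h⟩ ho
    rw [if_neg ho] at h
    exact hr j ⟨hj, hj'⟩ z h
  · rintro j z ⟨hj, hj', h⟩ ho
    rw [if_pos ho] at h
    exact hr j ⟨hj, hj'⟩ z h
  · rintro j z ⟨hj, hj', h⟩ ho
    rw [if_neg ho] at h
    exact hl j ⟨hj, hj'⟩ z h

omit hL hR in
theorem mem_Gam_of_mem {j : ℕ} {z : ℂ}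
    (h : z ∈ (kpzData ζ CL CR).Om₁ j ∨ z ∈ (kpzData ζ CL CR).Om₂ j) :
    j ∈ Finset.Icc 1 m ∧ (z ∈ CL.Gam j ∨ z ∈ CR.Gam j) := by
  rw [Finset.mem_Icc]
  rcases h with ⟨h1, h2, h⟩ | ⟨h1, h2, h⟩ <;> refine ⟨⟨h1, h2⟩, ?_⟩ <;> split_ifs at h
  exacts [Or.inl h, Or.inr h, Or.inr h, Or.inl h]

theorem kpz_admissible {x y t : Fin m → ℝ}
    (hty : ∀ j, 1 ≤ j ∧ j ≤ m → entry t j - entry t (j - 1) ≤ 0 ∧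
      (entry t j - entry t (j - 1) = 0 → quad ∧ 0 < entry y j - entry y (j - 1))) :
    ∃ C η, Admissible (kpzData ζ CL CR) x y t C η := by
  obtain ⟨B, hB, hdom⟩ := kpz_domains ζ hL hR
  have hQP : ∀ᶠ C in atTop, ∀ j ∈ Finset.Icc 1 m, ∀ z,
      ‖kpzQ ζ CL CR j z * kpzP ζ CL CR j z‖ ≤ C := by
    rw [eventually_all_finset]
    intro j _
    obtain ⟨M, hM⟩ := exists_norm_kpzQ_le ζ CL CR j
    obtain ⟨M', hM'⟩ := exists_norm_kpzP_le ζ CL CR j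
    filter_upwards [eventually_ge_atTop (M * M')] with C hC z
    exact (norm_mul_le_of_le (hM z) (hM' z)).trans hC
  obtain ⟨C, hC1, hCB, hK, hw, hw', hs, hs', hq⟩ := ((eventually_ge_atTop (1 : ℝ)).and
    ((eventually_ge_atTop B).and ((eventually_ge_atTop (CL.K + CR.K + 1 : ℝ)).and
    ((hL.eventually_wfun_le (x := x) hty).and ((hR.eventually_wfun_le (x := x) hty).and
    (CL.eventually_sep.and (CR.eventually_sep.and hQP))))))).exists
  have hsep : ∀ u v : ℂ, 1 ≤ C * ‖u - v‖ → 1 ≤ C * ((1 + ‖u‖) * (1 + ‖v‖)) * ‖u - v‖ := by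
    intro u v h
    have h1 : 1 ≤ (1 + ‖u‖) * (1 + ‖v‖) :=
      one_le_mul_of_one_le_of_one_le (by linarith [norm_nonneg u]) (by linarith [norm_nonneg v])
    calc (1 : ℝ) ≤ C * ‖u - v‖ := h
      _ ≤ C * ((1 + ‖u‖) * (1 + ‖v‖)) * ‖u - v‖ :=
        mul_le_mul_of_nonneg_right (le_mul_of_one_le_right (by linarith) h1) (norm_nonneg _)
  have hopp : ∀ u v : ℂ, u.re ≤ -B⁻¹ → B⁻¹ ≤ v.re → 1 ≤ C * ‖u - v‖ := by
    intro u v hu hv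
    have h1 := (neg_le_abs _).trans (Complex.abs_re_le_norm (u - v))
    rw [Complex.sub_re] at h1
    have h2 : B⁻¹ ≤ ‖u - v‖ := by
      have := inv_pos.2 hB
      linarith
    calc (1 : ℝ) = B * B⁻¹ := (mul_inv_cancel₀ hB.ne').symm
      _ ≤ C * ‖u - v‖ := mul_le_mul hCB h2 (inv_pos.2 hB).le (by linarith)
  have hB' : ∀ j, Measurable ((kpzData ζ CL CR).B j) := fun j =>
    (measurable_kpzQ ζ CL CR j).mul (measurable_kpzP ζ CL CR j)
  refine ⟨C, B⁻¹, hdom, by linarith, ?_, ?_, ?_, ?_, ?_, ?_, ?_, ?_, ?_, ?_, ?_, ?_⟩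
  · refine (Complex.measurable_ofReal.comp (Measurable.ite ?_ ?_ ?_)).add_const _
    · exact measurableSet_lt Complex.measurable_re measurable_const
    · exact (measurable_deriv _).comp Complex.measurable_im
    · exact (measurable_deriv _).comp Complex.measurable_im
  · exact fun j => measurable_const.indicator (hdom.meas₁ j)
  · exact fun j => measurable_const.indicator (hdom.meas₂ j)
  · exact fun j => (hB' j).indicator (hdom.meas₁ j)
  · exact fun j => (hB' j).indicator (hdom.meas₂ j)
  · intro z
    refine le_trans ?_ hK
    change ‖_ + Complex.I‖ ≤ _
    refine norm_add_le_of_le ?_ Complex.norm_I.le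
    rw [Complex.norm_real]
    have := CL.K.2
    have := CR.K.2
    split_ifs
    · exact (norm_deriv_le_of_lipschitz CL.lipschitz).trans (le_add_of_nonneg_right CR.K.2)
    · exact (norm_deriv_le_of_lipschitz CR.lipschitz).trans (le_add_of_nonneg_left CL.K.2)
  -- The density `φ' + i` has imaginary part `1`.
  · intro z h
    have := congrArg Complex.im h
    simp [kpzData] at this
  · intro j z _
    change ‖(1 : ℂ)‖ ≤ C
    rwa [norm_one]
  · exact fun j z h => hq j (mem_Gam_of_mem ζ h).1 z
  · intro j z h
    obtain ⟨hj, h | h⟩ := mem_Gam_of_mem ζ h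
    · exact hw j hj z h
    · exact hw' j hj z h
  -- Equal labels put the points in opposite half planes; adjacent labels put them on different
  -- translates in the same half plane.
  · intro i j u v hu hv hij
    refine hsep u v ?_
    have hi := (mem_Gam_of_mem ζ (Or.inl hu)).1
    have hj := (mem_Gam_of_mem ζ (Or.inr hv)).1
    by_cases ho : Odd i
    · have hu' : u ∈ CL.Gam i := by
        have := hu.2.2
        rwa [if_pos ho] at this
      rcases hij with rfl | rfl | rfl
      · exact hopp u v (hdom.side₁_odd i u hu ho) (hdom.side₂_odd i v hv ho)
      · have hv' : v ∈ CL.Gam (i + 1) := by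
          have := hv.2.2
          rwa [if_neg (Nat.not_odd_iff_even.2 ho.add_one)] at this
        exact hs i hi _ hj (Nat.lt_succ_self i) u hu' v hv'
      · have hv' : v ∈ CL.Gam j := by
          have := hv.2.2
          rwa [if_neg (Nat.not_odd_iff_even.2 (by simpa [Nat.odd_add_one] using ho))] at this
        rw [norm_sub_rev]
        exact hs j hj _ hi (Nat.lt_succ_self j) v hv' u hu'
    · have hu' : u ∈ CR.Gam i := by
        have := hu.2.2
        rwa [if_neg ho] at this
      rcases hij with rfl | rfl | rfl
      · rw [norm_sub_rev]
        exact hopp v u (hdom.side₂_even i v hv ho) (hdom.side₁_even i u hu ho)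
      · have hv' : v ∈ CR.Gam (i + 1) := by
          have := hv.2.2
          rwa [if_pos (Nat.odd_add_one.2 ho)] at this
        exact hs' i hi _ hj (Nat.lt_succ_self i) u hu' v hv'
      · have hv' : v ∈ CR.Gam j := by
          have := hv.2.2
          rwa [if_pos (by simpa [Nat.odd_add_one] using ho)] at this
        rw [norm_sub_rev]
        exact hs' j hj _ hi (Nat.lt_succ_self j) v hv' u hu'
  · exact integrable_add_measure.2 ⟨CL.integrable_measure, CR.integrable_measure⟩

end KPZ

theorem IsKPZ.admissible {m : ℕ} {S : Data} {y t : Fin m → ℝ} (h : IsKPZ S y t) (x : Fin m → ℝ) :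
    ∃ C η, Admissible S x y t C η := by
  obtain ⟨ht, hty, ζ, CL, CR, -, h1, h2, h3, h4, h5, rfl⟩ := h
  have hL : CL.Good (∃ i j, i < j ∧ t i = t j) := by
    obtain ⟨a1, a2⟩ := h1
    obtain ⟨b1, b2⟩ := h2
    have := Real.pi_pos
    refine ⟨Or.inr rfl, ?_, ?_, ?_, ?_, fun h => ?_, fun h => ?_⟩
    · have := cos_neg_of_shift 0 (θ := CL.θbot) (by push_cast; linarith) (by push_cast; linarith)
      linarith
    · have := cos_neg_of_shift 0 (θ := CL.θtop) (by push_cast; linarith) (by push_cast; linarith)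
      linarith
    -- The integer counts full turns: here `3θ` lies in `(7π/2, 9π/2)`, two turns beyond `(-π/2,
    -- π/2)`.
    · have := cos_pos_of_shift 2 (θ := 3 * CL.θbot) (by push_cast; linarith) (by push_cast; linarith)
      linarith
    · have := cos_pos_of_shift 1 (θ := 3 * CL.θtop) (by push_cast; linarith) (by push_cast; linarith)
      linarith
    · obtain ⟨c1, c2, -, -⟩ := h5 h
      have := cos_neg_of_shift 1 (θ := 2 * CL.θbot) (by push_cast; linarith) (by push_cast; linarith)
      linarith
    · obtain ⟨c1, c2, -, -⟩ := h5 h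
      have := cos_neg_of_shift 0 (θ := 2 * CL.θtop) (by push_cast; linarith) (by push_cast; linarith)
      linarith
  have hR : CR.Good (∃ i j, i < j ∧ t i = t j) := by
    obtain ⟨a1, a2⟩ := h3
    obtain ⟨b1, b2⟩ := h4
    have := Real.pi_pos
    refine ⟨Or.inl rfl, ?_, ?_, ?_, ?_, fun h => ?_, fun h => ?_⟩
    · have := cos_pos_of_shift 1 (θ := CR.θbot) (by push_cast; linarith) (by push_cast; linarith)
      linarith
    · have := cos_pos_of_shift 0 (θ := CR.θtop) (by push_cast; linarith) (by push_cast; linarith)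
      linarith
    · have := cos_neg_of_shift 2 (θ := 3 * CR.θbot) (by push_cast; linarith) (by push_cast; linarith)
      linarith
    · have := cos_neg_of_shift 0 (θ := 3 * CR.θtop) (by push_cast; linarith) (by push_cast; linarith)
      linarith
    · obtain ⟨-, -, c1, c2⟩ := h5 h
      have := cos_pos_of_shift 2 (θ := 2 * CR.θbot) (by push_cast; linarith) (by push_cast; linarith)
      linarith
    · obtain ⟨-, -, c1, c2⟩ := h5 h
      have := cos_pos_of_shift 0 (θ := 2 * CR.θtop) (by push_cast; linarith) (by push_cast; linarith)
      linarith
  exact kpz_admissible ζ hL hR fun j hj => entry_sub_entry_le ht hty hj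

/-! ### Bethe roots -/

/-- All solutions of `e^{-s²/2} = ζ`. -/
def bethe (ζ : ℂ) : Set ℂ := {s | Complex.exp (-s ^ 2 / 2) = ζ}

theorem norm_of_mem_bethe {ζ s : ℂ} (h : s ∈ bethe ζ) : ‖ζ‖ = Real.exp (-(s ^ 2).re / 2) := by
  have h' : Complex.exp (-s ^ 2 / 2) = ζ := h
  rw [← h', Complex.norm_exp, Complex.div_ofNat_re, Complex.neg_re]

theorem sq_re_of_mem_bethe {ζ s : ℂ} (h : s ∈ bethe ζ) : (s ^ 2).re = -2 * Real.log ‖ζ‖ := by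
  rw [norm_of_mem_bethe h, Real.log_exp]
  ring

/-- All Bethe roots of one `ζ` lie on a hyperbola. For `0 < |ζ| < 1` its branches avoid the
imaginary axis and satisfy `|Im s| ≤ |Re s|`, so powers of `|s|` are controlled by `|Re s|`. -/
theorem re_sq_of_mem_bethe {ζ s : ℂ} (h : s ∈ bethe ζ) :
    s.re ^ 2 - s.im ^ 2 = -2 * Real.log ‖ζ‖ := by
  rw [← sq_re_of_mem_bethe h, sq s, Complex.mul_re]
  ring

theorem norm_le_of_mem_bethe {ζ s : ℂ} (hζ : ‖ζ‖ < 1) (h : s ∈ bethe ζ) : ‖s‖ ≤ 2 * |s.re| := by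
  have h1 := re_sq_of_mem_bethe h
  have h2 := Real.log_nonpos (norm_nonneg ζ) hζ.le
  have h3 : |s.im| ≤ |s.re| := sq_le_sq.1 (by linarith)
  linarith [Complex.norm_le_abs_re_add_abs_im s]

theorem exists_re_ge_of_bethe {ζ : ℂ} (hζ0 : 0 < ‖ζ‖) (hζ : ‖ζ‖ < 1) :
    ∀ᶠ B in atTop, ∀ s ∈ bethe ζ, 1 ≤ B * |s.re| := by
  have h0 : 0 < Real.sqrt (-2 * Real.log ‖ζ‖) := by
    have := Real.log_neg hζ0 hζ
    exact Real.sqrt_pos.2 (by linarith)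
  filter_upwards [eventually_ge_atTop (Real.sqrt (-2 * Real.log ‖ζ‖))⁻¹] with B hB s hs
  have h1 : Real.sqrt (-2 * Real.log ‖ζ‖) ≤ |s.re| := by
    refine Real.sqrt_le_iff.2 ⟨abs_nonneg _, ?_⟩
    rw [sq_abs, ← re_sq_of_mem_bethe hs]
    linarith [sq_nonneg s.im]
  have := mul_le_mul hB h1 h0.le ((inv_pos.2 h0).le.trans hB)
  rwa [inv_mul_cancel₀ h0.ne'] at this

/-- The real part of `(u - v)(u + v) = u² - v²` is a positive constant on the two hyperbolas, while
`u + v` grows at most linearly. The hyperbolas have common asymptotes, so a polynomial loss is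
natural. -/
theorem bethe_sep {ζ ζ' : ℂ} (hζ : 0 < ‖ζ‖) (h : ‖ζ‖ < ‖ζ'‖) :
    ∀ᶠ B in atTop, ∀ u ∈ bethe ζ, ∀ v ∈ bethe ζ',
      1 ≤ B * ((1 + ‖u‖) * (1 + ‖v‖)) * ‖u - v‖ := by
  set d := 2 * (Real.log ‖ζ'‖ - Real.log ‖ζ‖) with hd
  have hd0 : 0 < d := by
    have := Real.log_lt_log hζ h
    linarith
  filter_upwards [eventually_ge_atTop d⁻¹] with B hB u hu v hv
  have h1 : d = ((u - v) * (u + v)).re := by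
    have : (u - v) * (u + v) = u ^ 2 - v ^ 2 := by ring
    rw [this, Complex.sub_re, sq_re_of_mem_bethe hu, sq_re_of_mem_bethe hv]
    ring
  have h2 : d ≤ ‖u - v‖ * ‖u + v‖ := by
    rw [h1, ← norm_mul]
    exact Complex.re_le_norm _
  have h3 : ‖u + v‖ ≤ (1 + ‖u‖) * (1 + ‖v‖) := by
    have := norm_add_le u v
    nlinarith [mul_nonneg (norm_nonneg u) (norm_nonneg v)]
  calc (1 : ℝ) = d⁻¹ * d := (inv_mul_cancel₀ hd0.ne').symm
    _ ≤ B * (‖u - v‖ * ((1 + ‖u‖) * (1 + ‖v‖))) := by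
      refine mul_le_mul hB (h2.trans ?_) hd0.le ((inv_pos.2 hd0).le.trans hB)
      gcongr
    _ = _ := by ring

/-- Bethe roots in one half plane are enumerated by integers. -/
theorem exists_label {ζ : ℂ} (hζ : ζ ≠ 0) {A : Set ℂ} (hA : A ⊆ bethe ζ)
    (hinj : ∀ u ∈ A, ∀ v ∈ A, u ^ 2 = v ^ 2 → u = v) :
    ∃ n : A → ℤ, Function.Injective n ∧ ∃ L : ℝ, 0 ≤ L ∧ ∀ u : A, |(n u : ℝ)| ≤ ‖(u : ℂ)‖ ^ 2 + L := by
  have h : ∀ u : A, ∃ n : ℤ, -(u : ℂ) ^ 2 / 2 = Complex.log ζ + n * (2 * Real.pi * Complex.I) :=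
    fun u => by
      have hu : Complex.exp (-(u : ℂ) ^ 2 / 2) = ζ := hA u.2
      rw [← Complex.exp_eq_exp_iff_exists_int, Complex.exp_log hζ, hu]
  choose n hn using h
  refine ⟨n, fun u v huv => ?_, ‖Complex.log ζ‖, norm_nonneg _, fun u => ?_⟩
  · have h1 := hn u
    rw [huv, ← hn v] at h1
    exact Subtype.ext (hinj _ u.2 _ v.2 (by linear_combination (-2) * h1))
  · have h1 : (n u : ℂ) * (2 * Real.pi * Complex.I) = -(u : ℂ) ^ 2 / 2 - Complex.log ζ := by
      rw [hn u]; ring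
    have h2 := congrArg norm h1
    rw [norm_mul, norm_mul, norm_mul, Complex.norm_I, mul_one, Complex.norm_real, Complex.norm_ofNat,
      Real.norm_of_nonneg Real.pi_pos.le, Complex.norm_intCast] at h2
    have h3 : ‖-(u : ℂ) ^ 2 / 2 - Complex.log ζ‖ ≤ ‖(u : ℂ)‖ ^ 2 / 2 + ‖Complex.log ζ‖ := by
      refine (norm_sub_le _ _).trans_eq ?_
      rw [norm_div, norm_neg, norm_pow, Complex.norm_ofNat]
    have h4 := Real.pi_gt_three
    nlinarith [abs_nonneg (n u : ℝ), sq_nonneg ‖(u : ℂ)‖]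

theorem summable_int_inv_sq : Summable fun n : ℤ => ((1 + |(n : ℝ)|) ^ 2)⁻¹ := by
  have h : Summable fun n : ℕ => ((1 + (n : ℝ)) ^ 2)⁻¹ := by
    have := (summable_nat_add_iff 1).2 (Real.summable_nat_pow_inv.2 (one_lt_two))
    refine this.congr fun n => ?_
    push_cast
    rw [add_comm]
  refine Summable.of_nat_of_neg ?_ ?_ <;> simpa using h

/-- The integer label of a root is at most of order `|u|²`, so already `(1 + |u|)⁻⁴` is dominated by
a multiple of the summable `(1 + |n|)⁻²`. -/
theorem summable_bethe {ζ : ℂ} (hζ : ζ ≠ 0) {A : Set ℂ} (hA : A ⊆ bethe ζ)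
    (hinj : ∀ u ∈ A, ∀ v ∈ A, u ^ 2 = v ^ 2 → u = v) :
    Summable fun u : A => ((1 + ‖(u : ℂ)‖) ^ 8)⁻¹ := by
  obtain ⟨n, hn, L, hL, h⟩ := exists_label hζ hA hinj
  refine Summable.of_nonneg_of_le (fun u => by positivity) (fun u => ?_)
    ((summable_int_inv_sq.comp_injective hn).mul_left ((1 + L) ^ 2))
  have h0 := norm_nonneg (u : ℂ)
  have h1 : 1 + |(n u : ℝ)| ≤ (1 + L) * (1 + ‖(u : ℂ)‖) ^ 2 := by
    nlinarith [h u, mul_nonneg hL h0, mul_nonneg hL (sq_nonneg ‖(u : ℂ)‖)]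
  simp only [Function.comp_apply]
  rw [← div_eq_mul_inv, ← one_div, div_le_div_iff₀ (by positivity) (by positivity), one_mul]
  calc (1 + |(n u : ℝ)|) ^ 2 ≤ ((1 + L) * (1 + ‖(u : ℂ)‖) ^ 2) ^ 2 := by gcongr
    _ = (1 + L) ^ 2 * (1 + ‖(u : ℂ)‖) ^ 4 := by ring
    _ ≤ _ := by
      gcongr
      · linarith
      · norm_num

theorem betheL_inj {ζ : ℂ} : ∀ u ∈ betheL ζ, ∀ v ∈ betheL ζ, u ^ 2 = v ^ 2 → u = v := by
  rintro u ⟨-, hu⟩ v ⟨-, hv⟩ h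
  rcases sq_eq_sq_iff_eq_or_eq_neg.1 h with h | h
  · exact h
  · rw [h, Complex.neg_re] at hu
    linarith

theorem betheR_inj {ζ : ℂ} : ∀ u ∈ betheR ζ, ∀ v ∈ betheR ζ, u ^ 2 = v ^ 2 → u = v := by
  rintro u ⟨-, hu⟩ v ⟨-, hv⟩ h
  rcases sq_eq_sq_iff_eq_or_eq_neg.1 h with h | h
  · exact h
  · rw [h, Complex.neg_re] at hu
    linarith

theorem betheL_subset (ζ : ℂ) : betheL ζ ⊆ bethe ζ := fun _ h => h.1

theorem betheR_subset (ζ : ℂ) : betheR ζ ⊆ bethe ζ := fun _ h => h.1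

theorem betheL_countable {ζ : ℂ} (hζ : ζ ≠ 0) : (betheL ζ).Countable := by
  obtain ⟨n, hn, -⟩ := exists_label hζ (betheL_subset ζ) betheL_inj
  exact Set.countable_coe_iff.1 hn.countable

theorem betheR_countable {ζ : ℂ} (hζ : ζ ≠ 0) : (betheR ζ).Countable := by
  obtain ⟨n, hn, -⟩ := exists_label hζ (betheR_subset ζ) betheR_inj
  exact Set.countable_coe_iff.1 hn.countable

theorem integrableOn_count {A : Set ℂ} (hA : A.Countable)
    (h : Summable fun u : A => ((1 + ‖(u : ℂ)‖) ^ 8)⁻¹) :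
    IntegrableOn (fun u : ℂ => ((1 + ‖u‖) ^ 8)⁻¹) A Measure.count := by
  rw [← integrable_indicator_iff hA.measurableSet, integrable_count_iff]
  exact ((summable_subtype_iff_indicator (f := fun u : ℂ => ((1 + ‖u‖) ^ 8)⁻¹) (s := A)).1 h).norm

theorem measurable_indicator_of_countable {A : Set ℂ} (hA : A.Countable) (f : ℂ → ℂ) :
    Measurable (A.indicator f) := by
  refine measurable_zero.measurable_of_countable_ne (hA.mono fun z hz => ?_)
  by_contra h
  exact hz (Set.indicator_of_notMem h f).symm

/-! ### Decay of the cubic exponentials on the Bethe roots -/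

theorem exists_exp_linear_le {κ c : ℝ} (hκ : 0 < κ) :
    ∃ M, ∀ a : ℝ, 0 ≤ a → Real.exp (-(κ * a) + c) * (1 + 2 * a) ^ 6 ≤ M := by
  refine ⟨Real.exp (κ / 2 + c) * (720 / (κ / 2) ^ 6), fun a ha => ?_⟩
  have h1 := pow_six_mul_exp_neg_le (half_pos hκ) (N := 1 + 2 * a) (by linarith)
  have h2 : -(κ * a) + c = (κ / 2 + c) + -(κ / 2 * (1 + 2 * a)) := by ring
  rw [h2, Real.exp_add, mul_assoc, mul_comm (Real.exp (-_))]
  gcongr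

theorem exists_exp_cubic_le {T c₁ c₂ : ℝ} (hT : T ≤ 0) (hc : T = 0 → c₁ < 0) :
    ∃ M, ∀ a : ℝ, 0 ≤ a → Real.exp (T * a ^ 3 + c₁ * a + c₂) * (1 + 2 * a) ^ 6 ≤ M := by
  rcases hT.lt_or_eq with hT | hT
  · set b := |c₁ + 1| with hb
    -- Beyond `a₀` both `a ≥ 1` and `-T a ≥ b` hold, so the cubic term absorbs `(c₁ + 1) a`; up to
    -- `a₀` this term is at most `b a₀`. The linear term `-a` set aside supplies the decay.
    set a₀ := b / -T + 1 with ha₀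
    have hb0 : 0 ≤ b := abs_nonneg _
    have h0 : 0 ≤ a₀ := by
      have : 0 ≤ b / -T := div_nonneg hb0 (by linarith)
      linarith
    obtain ⟨M, hM⟩ := exists_exp_linear_le (κ := 1) (c := b * a₀ + c₂) one_pos
    refine ⟨M, fun a ha => le_trans ?_ (hM a ha)⟩
    have key : T * a ^ 3 + (c₁ + 1) * a ≤ b * a₀ := by
      have h1 : (c₁ + 1) * a ≤ b * a := mul_le_mul_of_nonneg_right (le_abs_self _) ha
      rcases le_total a a₀ with h | h
      · have h2 : T * a ^ 3 ≤ 0 := mul_nonpos_of_nonpos_of_nonneg hT.le (by positivity)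
        have h3 : b * a ≤ b * a₀ := mul_le_mul_of_nonneg_left h hb0
        linarith
      · have h2 : 1 ≤ a := by
          have : 0 ≤ b / -T := div_nonneg hb0 (by linarith)
          linarith
        have h3 : b ≤ -T * a := by
          have : b / -T ≤ a := by linarith
          rw [div_le_iff₀ (by linarith)] at this
          linarith
        have h4 : b * a ≤ -T * a ^ 3 := by
          calc b * a ≤ -T * a * a := mul_le_mul_of_nonneg_right h3 ha
            _ ≤ -T * a * a * a := le_mul_of_one_le_right (by
                have : 0 ≤ -T := by linarith
                positivity) h2
            _ = _ := by ring
        have h5 := mul_nonneg hb0 h0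
        linarith
    exact mul_le_mul_of_nonneg_right (Real.exp_le_exp.2 (by linarith)) (by positivity)
  · obtain ⟨M, hM⟩ := exists_exp_linear_le (κ := -c₁) (c := c₂) (by linarith [hc hT])
    refine ⟨M, fun a ha => le_trans (le_of_eq ?_) (hM a ha)⟩
    rw [hT]
    ring_nf

/-- On the hyperbola `Re s³ = -2 (Re s)³ - 6 log|ζ| Re s`, and `Re s²` is constant. The coefficients
`y` thus contribute only a bounded factor; for equal times the decay must come from the heights `x`.
-/
theorem re_wexpo_le {m : ℕ} (x y t : Fin m → ℝ) (j : ℕ) {ζ s : ℂ} (hs : s ∈ bethe ζ) :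
    (wexpo x y t j s).re ≤ (entry t j - entry t (j - 1)) * |s.re| ^ 3 +
      (3 * (entry t j - entry t (j - 1)) * Real.log ‖ζ‖ -
        (entry x j - entry x (j - 1)) / 2) * |s.re| +
      |(entry y j - entry y (j - 1)) * Real.log ‖ζ‖| := by
  have h1 := re_sq_of_mem_bethe hs
  set T := entry t j - entry t (j - 1) with hT
  set Y := entry y j - entry y (j - 1) with hY
  set X := entry x j - entry x (j - 1) with hX
  set ρ := Real.log ‖ζ‖
  have h2 : (T * s ^ 3 + Y * s ^ 2 + X * s : ℂ).re =
      T * (s.re ^ 3 - 3 * s.re * s.im ^ 2) + Y * (-2 * ρ) + X * s.re := by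
    rw [Complex.add_re, Complex.add_re, Complex.re_ofReal_mul, Complex.re_ofReal_mul,
      Complex.re_ofReal_mul, sq_re_of_mem_bethe hs]
    simp only [pow_succ, pow_zero, one_mul, Complex.mul_re, Complex.mul_im]
    ring
  have h3 : wexpo x y t j s = sgn s * (T * s ^ 3 + Y * s ^ 2 + X * s) / 2 := by
    rw [wexpo, cubic, cubic, hT, hY, hX]
    push_cast
    ring
  have h4 : s.im ^ 2 = s.re ^ 2 + 2 * ρ := by linarith
  rw [h3, sgn]
  split_ifs with h
  · rw [one_mul, Complex.div_ofNat_re, h2, h4, abs_of_neg h]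
    have := neg_le_abs (Y * ρ)
    linarith
  · rw [neg_one_mul, Complex.div_ofNat_re, Complex.neg_re, h2, h4, abs_of_nonneg (not_lt.1 h)]
    have := le_abs_self (Y * ρ)
    linarith

theorem exists_wfun_le {m : ℕ} (x y t : Fin m → ℝ) (j : ℕ) {ζ : ℂ} (hζ : ‖ζ‖ < 1)
    (hT : entry t j - entry t (j - 1) ≤ 0)
    (hX : entry t j - entry t (j - 1) = 0 → 0 < entry x j - entry x (j - 1)) :
    ∃ M, ∀ s ∈ bethe ζ, ‖wfun x y t j s‖ * (1 + ‖s‖) ^ 6 ≤ M := by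
  obtain ⟨M, hM⟩ := exists_exp_cubic_le (c₁ := 3 * (entry t j - entry t (j - 1)) * Real.log ‖ζ‖ -
    (entry x j - entry x (j - 1)) / 2) (c₂ := |(entry y j - entry y (j - 1)) * Real.log ‖ζ‖|) hT
    (fun h => by rw [h]; linarith [hX h])
  refine ⟨M, fun s hs => le_trans ?_ (hM |s.re| (abs_nonneg _))⟩
  have h1 := norm_le_of_mem_bethe hζ hs
  have h2 := re_wexpo_le x y t j hs
  rw [wfun, Complex.norm_exp]
  gcongr

/-! ### The functions `H_j` -/

theorem norm_log_one_sub_le {q : ℝ} {w : ℂ} (hw : ‖w‖ ≤ q) (hq : q < 1) :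
    ‖Complex.log (1 - w)‖ ≤ 2 * (1 - q)⁻¹ * ‖w‖ := by
  have h1 := Complex.norm_log_one_add_le (z := -w) (by rw [norm_neg]; linarith)
  rw [norm_neg, ← sub_eq_add_neg] at h1
  have h0 := norm_nonneg w
  have h2 : (1 - ‖w‖)⁻¹ ≤ (1 - q)⁻¹ := inv_anti₀ (by linarith) (by linarith)
  have h3 : 1 ≤ (1 - q)⁻¹ := (one_le_inv₀ (by linarith)).2 (by linarith)
  have h4 : ‖w‖ ^ 2 * (1 - ‖w‖)⁻¹ ≤ ‖w‖ * (1 - q)⁻¹ := by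
    refine mul_le_mul ?_ h2 (inv_nonneg.2 (by linarith)) h0
    nlinarith
  nlinarith [mul_le_mul_of_nonneg_left h3 h0]

/-- The denominator has modulus at least `|Re z| ≥ η` and the logarithm has a Gaussian bound, so the
exponent is bounded. The same bound controls the inverse of the exponential. -/
theorem exists_perH_le (κ : ℂ) {ζ : ℂ} (hζ : ‖ζ‖ < 1) {η : ℝ} (hη : 0 < η) :
    ∀ᶠ E in atTop, ∀ z : ℂ, η ≤ |z.re| → ‖perH κ ζ z‖ ≤ E ∧ ‖perH κ ζ z‖⁻¹ ≤ E := by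
  set J := ∫ r : ℝ, 2 * (1 - ‖ζ‖)⁻¹ * Real.exp (-(1 / 2) * r ^ 2) / η with hJ
  filter_upwards [eventually_ge_atTop (Real.exp (‖κ‖ * J))] with E hE z hz
  have h1 : ‖∫ r : ℝ, Complex.log (1 - ζ * Complex.exp ((Complex.I * r) ^ 2 / 2)) /
      (Complex.I * r + (if z.re < 0 then -z else z)) * Complex.I‖ ≤ J := by
    refine norm_integral_le_of_norm_le
      (((integrable_exp_neg_mul_sq (half_pos one_pos)).const_mul _).div_const η)
      (Eventually.of_forall fun r => ?_)
    have h2 : Complex.exp ((Complex.I * r) ^ 2 / 2) = (Real.exp (-(1 / 2) * r ^ 2) : ℝ) := by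
      rw [Complex.ofReal_exp, mul_pow, Complex.I_sq]
      congr 1
      push_cast
      ring
    have h3 : Real.exp (-(1 / 2) * r ^ 2) ≤ 1 := Real.exp_le_one_iff.2 (by nlinarith [sq_nonneg r])
    have h4 : ‖ζ * Complex.exp ((Complex.I * r) ^ 2 / 2)‖ = ‖ζ‖ * Real.exp (-(1 / 2) * r ^ 2) := by
      rw [h2, norm_mul, Complex.norm_real, Real.norm_of_nonneg (Real.exp_pos _).le]
    have h5 : ‖ζ * Complex.exp ((Complex.I * r) ^ 2 / 2)‖ ≤ ‖ζ‖ := by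
      rw [h4]
      exact mul_le_of_le_one_right (norm_nonneg _) h3
    have h6 := norm_log_one_sub_le h5 hζ
    have h7 : η ≤ ‖Complex.I * r + (if z.re < 0 then -z else z)‖ := by
      refine hz.trans (le_trans (le_of_eq ?_) (Complex.abs_re_le_norm _))
      rw [Complex.add_re, Complex.re_mul_ofReal, Complex.I_re, zero_mul, zero_add]
      split_ifs
      · rw [Complex.neg_re, abs_neg]
      · rfl
    rw [norm_mul, Complex.norm_I, mul_one, norm_div]
    have h8 : 0 ≤ (1 - ‖ζ‖)⁻¹ := inv_nonneg.2 (by linarith)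
    refine div_le_div₀ (by positivity) (h6.trans ?_) hη h7
    rw [h4]
    refine mul_le_mul_of_nonneg_left ?_ (by positivity)
    exact mul_le_of_le_one_left (Real.exp_pos _).le hζ.le
  have h2 := norm_mul_le_of_le (le_refl ‖-κ‖) h1
  rw [norm_neg] at h2
  unfold perH
  rw [← norm_inv, ← Complex.exp_neg]
  refine ⟨(Complex.norm_exp_le_exp_norm _).trans (le_trans (Real.exp_le_exp.2 h2) hE),
    (Complex.norm_exp_le_exp_norm _).trans (le_trans (Real.exp_le_exp.2 ?_) hE)⟩
  rwa [norm_neg]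

/-! ### The data of the periodic KPZ fixed point are admissible -/

section Periodic

variable {m : ℕ} {ζ : Fin m → ℂ} (hζ : ∀ i, 0 < ‖ζ i‖ ∧ ‖ζ i‖ < 1)
  (hζlt : ∀ i j, i < j → ‖ζ i‖ < ‖ζ j‖)

theorem betheL_disjoint_betheR {ζ ζ' z : ℂ} (h : z ∈ betheL ζ) : z ∉ betheR ζ' :=
  fun h' => lt_asymm h.2 h'.2

theorem eq_of_mem_bethe {ζ ζ' z : ℂ} (h : z ∈ bethe ζ) (h' : z ∈ bethe ζ') : ζ = ζ' :=
  Eq.trans (Eq.symm h) h'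

include hζ in
theorem norm_entry_pos {j : ℕ} (hj : 1 ≤ j ∧ j ≤ m) : 0 < ‖entry ζ j‖ := by
  rw [entry_of_mem ζ hj]
  exact (hζ _).1

include hζ in
theorem norm_entry_lt_one (j : ℕ) : ‖entry ζ j‖ < 1 := by
  by_cases hj : 1 ≤ j ∧ j ≤ m
  · rw [entry_of_mem ζ hj]
    exact (hζ _).2
  · rw [entry, dif_neg hj, norm_zero]
    exact one_pos

include hζlt in
theorem norm_entry_lt {i j : ℕ} (hi : 1 ≤ i) (hij : i < j) (hj : j ≤ m) :
    ‖entry ζ i‖ < ‖entry ζ j‖ := by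
  rw [entry_of_mem ζ ⟨hi, by omega⟩, entry_of_mem ζ ⟨by omega, hj⟩]
  refine hζlt _ _ ?_
  rw [Fin.mk_lt_mk]
  omega

include hζlt in
theorem entry_inj {i j : ℕ} (hi : 1 ≤ i ∧ i ≤ m) (hj : 1 ≤ j ∧ j ≤ m)
    (h : entry ζ i = entry ζ j) : i = j := by
  rcases lt_trichotomy i j with h' | h' | h'
  · exact absurd (congrArg norm h) (norm_entry_lt hζlt hi.1 h' hj.2).ne
  · exact h'
  · exact absurd (congrArg norm h) (norm_entry_lt hζlt hj.1 h' hi.2).ne'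

include hζ in
theorem perOm₁_countable (j : ℕ) : (perOm₁ ζ j).Countable := by
  by_cases hj : 1 ≤ j ∧ j ≤ m
  · have h0 := norm_pos_iff.1 (norm_entry_pos hζ hj)
    refine ((betheL_countable h0).union (betheR_countable h0)).mono fun z hz => ?_
    obtain ⟨-, -, h⟩ := hz
    split_ifs at h
    exacts [Or.inl h, Or.inr h]
  · exact Set.countable_empty.mono fun z hz => hj ⟨hz.1, hz.2.1⟩

include hζ in
theorem perOm₂_countable (j : ℕ) : (perOm₂ ζ j).Countable := by
  by_cases hj : 1 ≤ j ∧ j ≤ m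
  · have h0 := norm_pos_iff.1 (norm_entry_pos hζ hj)
    refine ((betheL_countable h0).union (betheR_countable h0)).mono fun z hz => ?_
    obtain ⟨-, -, h⟩ := hz
    split_ifs at h
    exacts [Or.inr h, Or.inl h]
  · exact Set.countable_empty.mono fun z hz => hj ⟨hz.1, hz.2.1⟩

theorem mem_bethe_of_mem {j : ℕ} {z : ℂ} (h : z ∈ perOm₁ ζ j ∨ z ∈ perOm₂ ζ j) :
    j ∈ Finset.Icc 1 m ∧ z ∈ bethe (entry ζ j) := by
  rw [Finset.mem_Icc]
  rcases h with ⟨h1, h2, h⟩ | ⟨h1, h2, h⟩ <;> refine ⟨⟨h1, h2⟩, ?_⟩ <;> split_ifs at h <;> exact h.1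

include hζ in
theorem exists_re_ge_of_per : ∃ B > 0, ∀ j z, z ∈ perOm₁ ζ j ∨ z ∈ perOm₂ ζ j → B⁻¹ ≤ |z.re| := by
  have h : ∀ᶠ B in atTop, ∀ j ∈ Finset.Icc 1 m, ∀ s ∈ bethe (entry ζ j), 1 ≤ B * |s.re| := by
    rw [eventually_all_finset]
    exact fun j hj => exists_re_ge_of_bethe (norm_entry_pos hζ (Finset.mem_Icc.1 hj))
      (norm_entry_lt_one hζ j)
  obtain ⟨B, hB, hB0⟩ := (h.and (eventually_gt_atTop 0)).exists
  refine ⟨B, hB0, fun j z hz => ?_⟩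
  obtain ⟨hj, hz⟩ := mem_bethe_of_mem hz
  rw [inv_le_iff_one_le_mul₀ hB0, mul_comm]
  exact hB j hj z hz

include hζ hζlt in
theorem per_domains (κ : ℂ) (p : ℕ) (δ : ℤˣ) {B : ℝ} (hB : 0 < B)
    (hre : ∀ j z, z ∈ perOm₁ ζ j ∨ z ∈ perOm₂ ζ j → B⁻¹ ≤ |z.re|) :
    Domains (perData ζ κ p δ) m B⁻¹ := by
  -- A point determines `ζ_j = exp(-z²/2)`, hence its label, because the moduli `|ζ_j|` are
  -- distinct.
  have hinj : ∀ i j z, (z ∈ perOm₁ ζ i ∨ z ∈ perOm₂ ζ i) → (z ∈ perOm₁ ζ j ∨ z ∈ perOm₂ ζ j) →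
      i = j := fun i j z hi hj => by
    obtain ⟨hi, h1⟩ := mem_bethe_of_mem hi
    obtain ⟨hj, h2⟩ := mem_bethe_of_mem hj
    exact entry_inj hζlt (Finset.mem_Icc.1 hi) (Finset.mem_Icc.1 hj) (eq_of_mem_bethe h1 h2)
  refine ⟨inv_pos.2 hB, fun j => (perOm₁_countable hζ j).measurableSet,
    fun j => (perOm₂_countable hζ j).measurableSet, fun j z hz => ⟨hz.1, hz.2.1⟩,
    fun j z hz => ⟨hz.1, hz.2.1⟩, fun i j z hi hj => hinj i j z (Or.inl hi) (Or.inl hj),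
    fun i j z hi hj => hinj i j z (Or.inr hi) (Or.inr hj), ?_, ?_, ?_, ?_, ?_⟩
  · intro i j z hi hj
    have := hinj i j z (Or.inl hi) (Or.inr hj)
    subst this
    obtain ⟨-, -, h⟩ := hi
    obtain ⟨-, -, h'⟩ := hj
    split_ifs at h h'
    · exact betheL_disjoint_betheR h h'
    · exact betheL_disjoint_betheR h' h
  · intro j z hz ho
    have h1 := hre j z (Or.inl hz)
    obtain ⟨-, -, h⟩ := hz
    rw [if_pos ho] at h
    rw [abs_of_neg h.2] at h1
    linarith
  · intro j z hz ho
    have h1 := hre j z (Or.inl hz)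
    obtain ⟨-, -, h⟩ := hz
    rw [if_neg ho] at h
    rwa [abs_of_pos h.2] at h1
  · intro j z hz ho
    have h1 := hre j z (Or.inr hz)
    obtain ⟨-, -, h⟩ := hz
    rw [if_pos ho] at h
    rwa [abs_of_pos h.2] at h1
  · intro j z hz ho
    have h1 := hre j z (Or.inr hz)
    obtain ⟨-, -, h⟩ := hz
    rw [if_neg ho] at h
    rw [abs_of_neg h.2] at h1
    linarith

include hζ in
theorem per_integrable (κ : ℂ) (p : ℕ) (δ : ℤˣ) :
    Integrable (fun u : ℂ => ((1 + ‖u‖) ^ 8)⁻¹) (perData ζ κ p δ).ν := by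
  have h : IntegrableOn (fun u : ℂ => ((1 + ‖u‖) ^ 8)⁻¹)
      (⋃ j ∈ Finset.Icc 1 m, (betheL (entry ζ j) ∪ betheR (entry ζ j))) Measure.count := by
    refine integrableOn_finset_iUnion.2 fun j hj => ?_
    have h0 := norm_pos_iff.1 (norm_entry_pos hζ (Finset.mem_Icc.1 hj))
    exact (integrableOn_count (betheL_countable h0)
        (summable_bethe h0 (betheL_subset _) betheL_inj)).union
      (integrableOn_count (betheR_countable h0)
        (summable_bethe h0 (betheR_subset _) betheR_inj))
  refine h.mono_set ?_
  rintro z (hz | hz) <;> obtain ⟨j, h1, h2, h⟩ := Set.mem_iUnion.1 hz <;>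
    refine Set.mem_iUnion₂.2 ⟨j, Finset.mem_Icc.2 ⟨h1, h2⟩, ?_⟩ <;> split_ifs at h
  exacts [Or.inl h, Or.inr h, Or.inr h, Or.inl h]

include hζ hζlt in
theorem per_sep : ∀ᶠ C in atTop, ∀ i ∈ Finset.Icc 1 m, ∀ j ∈ Finset.Icc 1 m, i < j →
    ∀ u ∈ bethe (entry ζ i), ∀ v ∈ bethe (entry ζ j),
      1 ≤ C * ((1 + ‖u‖) * (1 + ‖v‖)) * ‖u - v‖ := by
  rw [eventually_all_finset]
  intro i hi
  rw [eventually_all_finset]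
  intro j hj
  by_cases h : i < j
  · filter_upwards [bethe_sep (norm_entry_pos hζ (Finset.mem_Icc.1 hi))
      (norm_entry_lt hζlt (Finset.mem_Icc.1 hi).1 h (Finset.mem_Icc.1 hj).2)] with C hC _
    exact hC
  · exact Eventually.of_forall fun C h' => absurd h' h

include hζ hζlt in
theorem per_admissible (κ : ℂ) (p : ℕ) (δ : ℤˣ) {x y t : Fin m → ℝ}
    (hty : ∀ j, 1 ≤ j ∧ j ≤ m → entry t j - entry t (j - 1) ≤ 0 ∧
      (entry t j - entry t (j - 1) = 0 → 0 < entry x j - entry x (j - 1))) :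
    ∃ C η, Admissible (perData ζ κ p δ) x y t C η := by
  obtain ⟨B, hB, hre⟩ := exists_re_ge_of_per hζ
  have hdom := per_domains hζ hζlt κ p δ hB hre
  -- The neighbours `H_{j-1}` and `H_{j+1}` require the labels `0` and `m + 1` too, for which `entry
  -- ζ` is zero.
  have hH : ∀ᶠ E in atTop, ∀ k ∈ Finset.range (m + 2), ∀ z : ℂ, B⁻¹ ≤ |z.re| →
      ‖perH κ (entry ζ k) z‖ ≤ E ∧ ‖perH κ (entry ζ k) z‖⁻¹ ≤ E := by
    rw [eventually_all_finset]
    exact fun k _ => exists_perH_le κ (norm_entry_lt_one hζ k) (inv_pos.2 hB)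
  obtain ⟨E, hE, hE0⟩ := (hH.and (eventually_ge_atTop 0)).exists
  have hw : ∀ᶠ C in atTop, ∀ j ∈ Finset.Icc 1 m, ∀ s ∈ bethe (entry ζ j),
      ‖wfun x y t j s‖ * (1 + ‖s‖) ^ 6 ≤ C := by
    rw [eventually_all_finset]
    intro j hj
    obtain ⟨h1, h2⟩ := hty j (Finset.mem_Icc.1 hj)
    obtain ⟨M, hM⟩ := exists_wfun_le x y t j (norm_entry_lt_one hζ j) h1 h2
    filter_upwards [eventually_ge_atTop M] with C hC s hs
    exact (hM s hs).trans hC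
  have hQ : ∀ᶠ C in atTop, ∀ j ∈ Finset.Icc 1 m, (‖perQ₁ ζ j‖ + ‖perQ₂ ζ j‖) * E ≤ C := by
    rw [eventually_all_finset]
    exact fun j _ => eventually_ge_atTop _
  -- In the bound `E (B E^p)` for `A_j` the first `E` controls the numerator, `B` the factor `1/|z|`
  -- and `E^p` the power of `1/H_j`.
  obtain ⟨C, hC1, hCB, hCA, hw, hs, hQ⟩ := ((eventually_ge_atTop (1 : ℝ)).and
    ((eventually_ge_atTop B).and ((eventually_ge_atTop (E * (B * E ^ p))).and
    (hw.and ((per_sep hζ hζlt).and hQ))))).exists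
  have hopp : ∀ u v : ℂ, u.re ≤ -B⁻¹ → B⁻¹ ≤ v.re →
      1 ≤ C * ((1 + ‖u‖) * (1 + ‖v‖)) * ‖u - v‖ := by
    intro u v hu hv
    have h1 := (neg_le_abs _).trans (Complex.abs_re_le_norm (u - v))
    rw [Complex.sub_re] at h1
    have h2 : B⁻¹ ≤ ‖u - v‖ := by
      have := inv_pos.2 hB
      linarith
    have h3 : 1 ≤ (1 + ‖u‖) * (1 + ‖v‖) :=
      one_le_mul_of_one_le_of_one_le (by linarith [norm_nonneg u]) (by linarith [norm_nonneg v])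
    calc (1 : ℝ) = B * B⁻¹ := (mul_inv_cancel₀ hB.ne').symm
      _ ≤ C * ‖u - v‖ := mul_le_mul hCB h2 (inv_pos.2 hB).le (by linarith)
      _ ≤ _ := mul_le_mul_of_nonneg_right (le_mul_of_one_le_right (by linarith) h3) (norm_nonneg _)
  refine ⟨C, B⁻¹, hdom, by linarith, measurable_const,
    fun j => measurable_indicator_of_countable (perOm₁_countable hζ j) _,
    fun j => measurable_indicator_of_countable (perOm₂_countable hζ j) _,
    fun j => measurable_indicator_of_countable (perOm₁_countable hζ j) _,
    fun j => measurable_indicator_of_countable (perOm₂_countable hζ j) _, ?_, ?_, ?_, ?_, ?_, ?_,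
    per_integrable hζ κ p δ⟩
  · intro z
    change ‖(1 : ℂ)‖ ≤ C
    rwa [norm_one]
  · exact fun z => one_ne_zero
  · intro j z hz
    have h1 := hre j z hz
    obtain ⟨hj, -⟩ := mem_bethe_of_mem hz
    rw [Finset.mem_Icc] at hj
    refine le_trans ?_ hCA
    change ‖perA ζ κ p j z‖ ≤ _
    rw [perA, norm_div, norm_mul, norm_pow, div_eq_mul_inv, mul_inv, ← inv_pow]
    have h2 : ‖z‖⁻¹ ≤ B :=
      inv_le_of_inv_le₀ hB (h1.trans (Complex.abs_re_le_norm z))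
    have h3 := (hE _ (Finset.mem_range.2 (by split_ifs <;> omega) :
      (if z.re < 0 then j + 1 else j - 1) ∈ Finset.range (m + 2)) z h1).1
    have h4 := (hE j (Finset.mem_range.2 (by omega)) z h1).2
    gcongr
  · intro j z hz
    have h1 := hre j z hz
    obtain ⟨hj, -⟩ := mem_bethe_of_mem hz
    refine le_trans ?_ (hQ j hj)
    rw [Finset.mem_Icc] at hj
    refine norm_mul_le_of_le (norm_add_le_of_le (norm_indicator_le_norm_self (fun _ => _) z)
      (norm_indicator_le_norm_self (fun _ => _) z)) ?_
    exact (hE _ (Finset.mem_range.2 (by split_ifs <;> omega)) z h1).1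
  · intro j z hz
    obtain ⟨hj, h⟩ := mem_bethe_of_mem hz
    exact hw j hj z h
  · intro i j u v hu hv hij
    obtain ⟨hi, hu'⟩ := mem_bethe_of_mem (Or.inl hu)
    obtain ⟨hj, hv'⟩ := mem_bethe_of_mem (Or.inr hv)
    -- Equal labels are separated by the imaginary axis, adjacent ones by the distinct hyperbolas.
    rcases hij with rfl | rfl | rfl
    · by_cases ho : Odd i
      · exact hopp u v (hdom.side₁_odd i u hu ho) (hdom.side₂_odd i v hv ho)
      · rw [norm_sub_rev, mul_comm (1 + ‖u‖)]
        exact hopp v u (hdom.side₂_even i v hv ho) (hdom.side₁_even i u hu ho)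
    · exact hs i hi _ hj (Nat.lt_succ_self i) u hu' v hv'
    · rw [norm_sub_rev, mul_comm (1 + ‖u‖)]
      exact hs j hj _ hi (Nat.lt_succ_self j) v hv' u hu'

end Periodic

theorem IsPeriodicKPZ.admissible {m : ℕ} {S : Data} {x t : Fin m → ℝ} (h : IsPeriodicKPZ S x t)
    (y : Fin m → ℝ) : ∃ C η, Admissible S x y t C η := by
  obtain ⟨ht, htx, ζ, κ, p, δ, h1, h2, rfl⟩ := h
  refine per_admissible h1 h2 κ p δ fun j hj => ?_
  -- The heights take the place of the positions: they order the labels with equal times.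
  obtain ⟨h3, h4⟩ := entry_sub_entry_le (y := x) ht htx hj
  exact ⟨h3, fun h => (h4 h).2⟩

end KPZDet

end

theorem mainTheorem9 {m : ℕ} (hm : 1 ≤ m) (S : KPZDet.Data) (x y t : Fin m → ℝ)
    (hS : KPZDet.IsKPZ S y t ∨ KPZDet.IsPeriodicKPZ S x t)
    (hD : ∀ ξ : ℝ, 0 ≤ ξ → KPZDet.fredDet S (KPZDet.shiftHeights x ξ) y t ≠ 0) :
    (∀ ξ : ℝ, 0 ≤ ξ → KPZDet.WellDefined S (KPZDet.shiftHeights x ξ) y t) ∧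
    IntegrableOn (fun ξ : ℝ => ∑ i : Fin m,
      (KPZDet.qBlock (Finset.Ici i)
        (KPZDet.matY₁ S (KPZDet.shiftHeights x ξ) y t)).trace) (Set.Ioi 0) ∧
    IntegrableOn (fun ξ : ℝ => ∑ i : Fin m,
      (KPZDet.sBlock (Finset.Ici i)
        (KPZDet.matY₁ S (KPZDet.shiftHeights x ξ) y t)).trace) (Set.Ioi 0) ∧
    KPZDet.fredDet S x y t =
      Complex.exp (∫ ξ in Set.Ioi (0 : ℝ), ∑ i : Fin m,
        (KPZDet.qBlock (Finset.Ici i)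
          (KPZDet.matY₁ S (KPZDet.shiftHeights x ξ) y t)).trace) ∧
    KPZDet.fredDet S x y t =
      Complex.exp (-∫ ξ in Set.Ioi (0 : ℝ), ∑ i : Fin m,
        (KPZDet.sBlock (Finset.Ici i)
          (KPZDet.matY₁ S (KPZDet.shiftHeights x ξ) y t)).trace) := by
  have hadm : ∃ C η, KPZDet.Admissible S x y t C η :=
    hS.elim (fun h => h.admissible x) fun h => h.admissible y
  -- Admissibility is needed only at the unshifted heights; along the ray the kernels change by the
  -- decaying factors `exp(ξ e)`.
  obtain ⟨C, η, h⟩ := hadm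
  exact h.fredDet_eq_exp hD
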